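/- **The Cuntz–Krieger uniqueness theorem for finitely aligned $k$-graphs.** *Setting.* Let $k\in\mathbb N$. A $k$-graph $(\Lambda,d)$ is a countable small category $\Lambda$ with a functor $d:\Lambda\to\mathbb N^k$ such that whenever $d(\lambda)=m+n$ there are unique $\mu,\sigma\in\Lambda$ with $d(\mu)=m$, $d(\sigma)=n$ and $\lambda=\mu\sigma$. Morphisms are called paths, with range (codomain) $r$ and source (domain) $s$; the composite $\lambda\mu$ is defined when $s(\lambda)=r(\mu)$. Objects (vertices) are identified with their identity morphisms, and $\Lambda^0$ denotes the set of vertices. Put $v\Lambda=\{\lambda: r(\lambda)=v\}$, $\Lambda v=\{\lambda: s(\lambda)=v\}$ and $v\Lambda^{e_i}=\{\lambda\in v\Lambda: d(\lambda)=e_i\}$, where $e_i$ is the $i$-th generator of $\mathbb N^k$. For $\lambda,\mu\in\Lambda$ let $$\Lambda^{\min}(\lambda,\mu)=\{(\alpha,\beta):\lambda\alpha=\mu\beta,\ d(\lambda\alpha)=d(\lambda)\vee d(\mu)\},$$ where $\vee$ is the coordinatewise maximum. $\Lambda$ is *finitely aligned* if $\Lambda^{\min}(\lambda,\mu)$ is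 finite for all $\lambda,\mu$. A set $E\subset v\Lambda$ is *exhaustive* if for every $\mu\in v\Lambda$ there is $\lambda\in E$ with $\Lambda^{\min}(\lambda,\mu)\neq\emptyset$. For $m\in(\mathbb N\cup\{\infty\})^k$ let $\Omega_{k,m}$ be the $k$-graph with objects $\{p\in\mathbb N^k:p\le m\}$ and morphisms $(p,q)$ with $p\le q$, where $r(p,q)=p$, $s(p,q)=q$, $d(p,q)=q-p$. A *boundary path* of degree $m$ is a degree-preserving functor $x:\Omega_{k,m}\to\Lambda$ for which there is $n_x\in\mathbb N^k$ with $n_x\le m$ such that, for all $n\in\mathbb N^k$ with $n_x\le n\le m$ and all $i$, $n_i=m_i$ implies $x(n)\Lambda^{e_i}=\emptyset$; its range is $r(x)=x(0)$. If $s(\lambda)=r(x)$, then $\lambda x:\Omega_{k,m+d(\lambda)}\to\Lambda$ denotes the unique degree-preserving functor with $(\lambda x)(0,d(\lambda))=\lambda$ and $(\lambda x)(d(\lambda),n)=x(0,n-d(\lambda))$ for all $n\in\mathbb N^k$ with $d(\lambda)\le n\le m+d(\lambda)$. *Condition (B)* says: for each $v\in\Lambda^0$ there is a boundary path $x$ with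 $r(x)=v$ such that $\lambda x\neq\mu x$ for all $\lambda,\mu\in\Lambda v$ with $\lambda\neq\mu$. For finitely aligned $\Lambda$, a *Cuntz–Krieger $\Lambda$-family* is a collection $\{t_\lambda:\lambda\in\Lambda\}$ of partial isometries in a (not necessarily unital) $C^*$-algebra such that 1. $\{t_v:v\in\Lambda^0\}$ are mutually orthogonal projections; 2. $t_\lambda t_\mu=t_{\lambda\mu}$ whenever $s(\lambda)=r(\mu)$; 3. $t_\lambda^*t_\mu=\sum_{(\alpha,\beta)\in\Lambda^{\min}(\lambda,\mu)}t_\alpha t_\beta^*$ for all $\lambda,\mu\in\Lambda$; 4. $\prod_{\lambda\in E}(t_v-t_\lambda t_\lambda^*)=0$ for all $v\in\Lambda^0$ and all finite exhaustive $E\subset v\Lambda$. *Theorem.* Let $(\Lambda,d)$ be a finitely aligned $k$-graph satisfying (B). There exists a Cuntz–Krieger $\Lambda$-family $\{t_\lambda\}$ such that $t_v\neq0$ for all $v\in\Lambda^0$. Furthermore, any two such families generate canonically isomorphic $C^*$-algebras: if $\{s_\lambda\}$ and $\{t_\lambda\}$ are Cuntz–Krieger $\Lambda$-families, possibly in different $C^*$-algebras,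 with $s_v\neq0$ and $t_v\neq0$ for all $v\in\Lambda^0$, then there is a unique $*$-isomorphism $\varphi:C^*(\{s_\lambda\})\to C^*(\{t_\lambda\})$ with $\varphi(s_\lambda)=t_\lambda$ for all $\lambda\in\Lambda$. -/

import Mathlib

open CategoryTheory

universe u v w w'

namespace HigherRank

/-- The morphisms ("paths") of a small category `Λ`, all collected in one type.
`src` is the domain `s(λ)` and `tgt` is the codomain `r(λ)`. -/
structure Path (Λ : Type u) [Category.{v} Λ] : Type (max u v) where
  src : Λ
  tgt : Λ
  hom : src ⟶ tgt

namespace Path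

variable {Λ : Type u} [Category.{v} Λ]

/-- The identity morphism at `a`, i.e. the vertex `a` regarded as a path. -/
def vertex (a : Λ) : Path Λ := ⟨a, a, 𝟙 a⟩

/-- The composite `lam mu`, defined when `s(lam) = r(mu)`: first `mu`, then `lam`. -/
def comp (lam mu : Path Λ) (h : lam.src = mu.tgt) : Path Λ :=
  ⟨mu.src, lam.tgt, mu.hom ≫ eqToHom h.symm ≫ lam.hom⟩

end Path

/-- The data making a category `Λ` into a `k`-graph: `Λ` is countable, and there is a degree functor
`d : Λ → ℕᵏ` satisfying the factorisation property. -/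
structure KGraph (k : ℕ) (Λ : Type u) [Category.{v} Λ] where
  countable : Countable (Path Λ)
  deg : Path Λ → Fin k → ℕ
  deg_vertex : ∀ a : Λ, deg (Path.vertex a) = 0
  deg_comp : ∀ (lam mu : Path Λ) (h : lam.src = mu.tgt),
    deg (lam.comp mu h) = deg lam + deg mu
  factorisation : ∀ (lam : Path Λ) (m n : Fin k → ℕ), deg lam = m + n →
    ∃! p : Path Λ × Path Λ, deg p.1 = m ∧ deg p.2 = n ∧
      ∃ h : p.1.src = p.2.tgt, lam = p.1.comp p.2 h

/-- The objects of the `k`-graph `Ω_{k,m}`, where `m ∈ (ℕ ∪ {∞})ᵏ`, ordered coordinatewise. As a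
preorder this is a category with one morphism `p ⟶ q` whenever `p ≤ q`. The morphism `(p, q)` of
`Ω_{k,m}` has range `p` and source `q`, so `Ω_{k,m}` itself is the opposite category. -/
abbrev Omega (k : ℕ) (m : Fin k → ℕ∞) : Type :=
  {p : Fin k → ℕ // ∀ i, (p i : ℕ∞) ≤ m i}

namespace KGraph

variable {k : ℕ} {Λ : Type u} [Category.{v} Λ] (G : KGraph k Λ)

/-- `Λ^min(lam, mu)`: the pairs `(α, β)` with `lam α = mu β` and `d(lam α) = d(lam) ∨ d(mu)`. -/
def minExt (lam mu : Path Λ) : Set (Path Λ × Path Λ) :=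
  {p | ∃ (h₁ : lam.src = p.1.tgt) (h₂ : mu.src = p.2.tgt),
    lam.comp p.1 h₁ = mu.comp p.2 h₂ ∧ G.deg (lam.comp p.1 h₁) = G.deg lam ⊔ G.deg mu}

/-- `Λ` is finitely aligned. -/
def FinitelyAligned : Prop := ∀ lam mu : Path Λ, (G.minExt lam mu).Finite

/-- `E` is an exhaustive subset of `aΛ`. -/
def Exhaustive (a : Λ) (E : Set (Path Λ)) : Prop :=
  (∀ lam ∈ E, lam.tgt = a) ∧
    ∀ mu : Path Λ, mu.tgt = a → ∃ lam ∈ E, (G.minExt lam mu).Nonempty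

/-- A graph morphism `x : Ω_{k,m} → Λ`, i.e. a degree-preserving functor, bundled with its
degree `m`. -/
structure GraphPath where
  degree : Fin k → ℕ∞
  toFunctor : (Omega k degree)ᵒᵖ ⥤ Λ
  deg_map : ∀ (p q : Omega k degree) (h : p ≤ q),
    G.deg ⟨_, _, toFunctor.map (homOfLE h).op⟩ = q.1 - p.1

namespace GraphPath

variable {G}

/-- The object `x(n)`. -/
abbrev at' (x : G.GraphPath) (n : Omega k x.degree) : Λ := x.toFunctor.obj (Opposite.op n)

/-- The path `x(p, q)`, as a morphism `x(q) ⟶ x(p)` of `Λ`. -/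
def mor (x : G.GraphPath) {p q : Omega k x.degree} (h : p ≤ q) : x.at' q ⟶ x.at' p :=
  x.toFunctor.map (homOfLE h).op

/-- The path `x(p, q)`. -/
def seg (x : G.GraphPath) (p q : Omega k x.degree) (h : p ≤ q) : Path Λ :=
  ⟨x.at' q, x.at' p, x.mor h⟩

/-- The object `0` of `Ω_{k,m}`. -/
abbrev zero (x : G.GraphPath) : Omega k x.degree := ⟨0, fun _ => by simp⟩

theorem zero_le (x : G.GraphPath) (n : Omega k x.degree) : x.zero ≤ n := fun _ => Nat.zero_le _

/-- The range `r(x) = x(0)`. -/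
abbrev range (x : G.GraphPath) : Λ := x.at' x.zero

/-- `x` is a boundary path: there is `n_x ≤ m` in `ℕᵏ` such that `x(n) Λ^{e_i} = ∅` whenever
`n_x ≤ n ≤ m` and `n_i = m_i`. -/
def IsBoundary (x : G.GraphPath) : Prop :=
  ∃ nx : Omega k x.degree, ∀ n : Omega k x.degree, nx ≤ n →
    ∀ i : Fin k, (n.1 i : ℕ∞) = x.degree i →
      ¬ ∃ mu : Path Λ, mu.tgt = x.at' n ∧ G.deg mu = Pi.single i 1

/-- The defining property of `y = lam x`: `y` has degree `m + d(lam)`, `y(0, d(lam)) = lam`, and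
`y(d(lam), n) = x(0, n - d(lam))` for all `n ≥ d(lam)` (here `n = d(lam) + l`). -/
def IsPrepend (lam : Path Λ) (x y : G.GraphPath) : Prop :=
  (∀ i, y.degree i = x.degree i + G.deg lam i) ∧
  (∃ h : ∀ i, (G.deg lam i : ℕ∞) ≤ y.degree i,
    y.seg y.zero ⟨G.deg lam, h⟩ (fun _ => Nat.zero_le _) = lam) ∧
  ∀ (l : Fin k → ℕ) (hl : ∀ i, (l i : ℕ∞) ≤ x.degree i)
    (h : ∀ i, (G.deg lam i : ℕ∞) ≤ y.degree i)
    (h' : ∀ i, ((G.deg lam + l) i : ℕ∞) ≤ y.degree i),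
    y.seg ⟨G.deg lam, h⟩ ⟨G.deg lam + l, h'⟩ (fun _ => Nat.le_add_right _ _) =
      x.seg x.zero ⟨l, hl⟩ (x.zero_le _)

/-! The graph morphism `lam x` exists and is unique. -/

theorem comp_mk {a b c : Λ} (f : a ⟶ b) (g : c ⟶ a) :
    (⟨a, b, f⟩ : Path Λ).comp ⟨c, a, g⟩ rfl = ⟨c, b, g ≫ f⟩ := by
  simp [Path.comp]

theorem mk_eqToHom_comp {a b c : Λ} (e : c = a) (f : a ⟶ b) :
    (⟨c, b, eqToHom e ≫ f⟩ : Path Λ) = ⟨a, b, f⟩ := by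
  subst e; simp

theorem mk_comp_eqToHom {a b c : Λ} (e : b = c) (f : a ⟶ b) :
    (⟨a, c, f ≫ eqToHom e⟩ : Path Λ) = ⟨a, b, f⟩ := by
  subst e; simp

theorem deg_mk_comp (G : KGraph k Λ) {a b c : Λ} (f : a ⟶ b) (g : c ⟶ a) :
    G.deg ⟨c, b, g ≫ f⟩ = G.deg ⟨a, b, f⟩ + G.deg ⟨c, a, g⟩ := by
  rw [← comp_mk, G.deg_comp]

theorem comp_unique (G : KGraph k Λ) {lam mu lam' mu' : Path Λ}
    (h : lam.src = mu.tgt) (h' : lam'.src = mu'.tgt)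
    (e : lam.comp mu h = lam'.comp mu' h') (hd : G.deg lam = G.deg lam') :
    lam = lam' ∧ mu = mu' := by
  have h1 := G.deg_comp lam mu h
  have h2 := G.deg_comp lam' mu' h'
  have h3 : G.deg mu = G.deg mu' := by
    rw [← e, h1, hd] at h2
    exact add_left_cancel h2
  have := (G.factorisation (lam.comp mu h) _ _ h1).unique (y₁ := (lam, mu)) (y₂ := (lam', mu'))
    ⟨rfl, rfl, h, rfl⟩ ⟨hd.symm, h3.symm, h', e⟩
  exact Prod.mk.inj this

theorem mk_unique (G : KGraph k Λ) {a a' b c : Λ} (f : a ⟶ b) (g : c ⟶ a) (f' : a' ⟶ b)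
    (g' : c ⟶ a') (e : g ≫ f = g' ≫ f') (hd : G.deg ⟨a, b, f⟩ = G.deg ⟨a', b, f'⟩) :
    (⟨a, b, f⟩ : Path Λ) = ⟨a', b, f'⟩ ∧ (⟨c, a, g⟩ : Path Λ) = ⟨c, a', g'⟩ := by
  refine comp_unique G rfl rfl ?_ hd
  rw [comp_mk, comp_mk, e]

theorem hom_cancel (G : KGraph k Λ) {a b c : Λ} (f : a ⟶ b) (g g' : c ⟶ a)
    (e : g ≫ f = g' ≫ f) : g = g' := by
  have := (mk_unique G f g f g' e rfl).2
  simpa using this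

theorem exists_factor (G : KGraph k Λ) {a b : Λ} (f : a ⟶ b) (m n : Fin k → ℕ)
    (h : G.deg ⟨a, b, f⟩ = m + n) :
    ∃ (c : Λ) (g : a ⟶ c) (f' : c ⟶ b),
      G.deg ⟨c, b, f'⟩ = m ∧ G.deg ⟨a, c, g⟩ = n ∧ g ≫ f' = f := by
  obtain ⟨⟨⟨c, b', f'⟩, ⟨a', c', g⟩⟩, ⟨h1, h2, h3, h4⟩, -⟩ := G.factorisation _ m n h
  dsimp only at h3
  subst h3
  rw [comp_mk] at h4
  simp only [Path.mk.injEq] at h4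
  obtain ⟨rfl, rfl, h4⟩ := h4
  exact ⟨c, g, f', h1, h2, (eq_of_heq h4).symm⟩

theorem eq_of_deg_zero (G : KGraph k Λ) {a b : Λ} (f : a ⟶ b) (h : G.deg ⟨a, b, f⟩ = 0) :
    ∃ e : a = b, f = eqToHom e := by
  obtain ⟨-, h2⟩ := mk_unique G (𝟙 b) f f (𝟙 a) (by simp) (by
    rw [h]; exact G.deg_vertex b)
  simp only [Path.mk.injEq, true_and] at h2
  obtain ⟨rfl, h2⟩ := h2
  exact ⟨rfl, eq_of_heq h2⟩

theorem mor_trans (x : G.GraphPath) {p q s : Omega k x.degree} (h : p ≤ q) (h' : q ≤ s) :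
    x.mor h' ≫ x.mor h = x.mor (h.trans h') := by
  unfold mor
  rw [← x.toFunctor.map_comp]
  rfl

theorem deg_mor (x : G.GraphPath) {p q : Omega k x.degree} (h : p ≤ q) :
    G.deg ⟨_, _, x.mor h⟩ = q.1 - p.1 := x.deg_map p q h

theorem exists_prepend (lam : Path Λ) (x : G.GraphPath) (h0 : lam.src = x.range) :
    ∃ y : G.GraphPath, IsPrepend lam x y := by
  have hx : ∀ n : Omega k (fun i => x.degree i + G.deg lam i),
      ∀ i, ((n.1 - G.deg lam) i : ℕ∞) ≤ x.degree i := fun n i => by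
    have := n.2 i
    rw [Pi.sub_apply, ENat.natCast_sub]
    exact tsub_le_iff_right.2 this
  obtain ⟨q, hq⟩ : ∃ q : Omega k (fun i => x.degree i + G.deg lam i) → Omega k x.degree,
      ∀ n, (q n).1 = n.1 - G.deg lam := ⟨fun n => ⟨n.1 - G.deg lam, hx n⟩, fun _ => rfl⟩
  obtain ⟨T, hTdef⟩ : ∃ T : ∀ n, x.at' (q n) ⟶ lam.tgt, ∀ n,
      T n = x.mor (x.zero_le (q n)) ≫ eqToHom h0.symm ≫ lam.hom := ⟨_, fun _ => rfl⟩
  have hT : ∀ n, G.deg ⟨_, _, T n⟩ = n.1 + (G.deg lam - n.1) := fun n => by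
    have h1 : G.deg ⟨_, _, eqToHom h0.symm ≫ lam.hom⟩ = G.deg lam := by
      rw [mk_eqToHom_comp]
    rw [hTdef, deg_mk_comp, h1, deg_mor, hq]
    funext i
    simp only [Pi.add_apply, Pi.sub_apply, Pi.zero_apply]
    omega
  choose obj r ini hini hr hT' using fun n => exists_factor G (T n) _ _ (hT n)
  have hf : ∀ p s, p ≤ s → ∃ f : obj s ⟶ obj p, f ≫ ini p = ini s := by
    intro p s hps
    obtain ⟨c, g, f', h1, -, h3⟩ := exists_factor G (ini s) p.1 (s.1 - p.1) (by
      rw [hini]; exact (add_tsub_cancel_of_le (show p.1 ≤ s.1 from hps)).symm)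
    have hqs : q p ≤ q s := by
      change (q p).1 ≤ (q s).1
      rw [hq, hq]
      exact tsub_le_tsub_right (show p.1 ≤ s.1 from hps) _
    have hTT : T s = x.mor hqs ≫ T p := by
      rw [hTdef, hTdef, ← Category.assoc (x.mor hqs), mor_trans]
    have h4 := (mk_unique G f' (r s ≫ g) (ini p) (x.mor hqs ≫ r p) (by
      rw [Category.assoc, h3, hT', hTT, Category.assoc, hT']) (by rw [h1, hini])).1
    simp only [Path.mk.injEq, true_and] at h4
    obtain ⟨rfl, h4⟩ := h4
    obtain rfl := eq_of_heq h4
    exact ⟨g, h3⟩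
  choose F hF using hf
  let y : G.GraphPath :=
    { degree := fun i => x.degree i + G.deg lam i
      toFunctor :=
        { obj := fun n => obj n.unop
          map := fun {a b} g => F b.unop a.unop (leOfHom g.unop)
          map_id := fun a => hom_cancel G (ini a.unop) _ _ (by
            rw [hF, Category.id_comp])
          map_comp := fun {a b c} g g' => hom_cancel G (ini c.unop) _ _ (by
            rw [hF, Category.assoc, hF, hF]) }
      deg_map := fun p s h => by
        have h1 := deg_mk_comp G (ini p) (F p s h)
        rw [hF, hini, hini] at h1
        change G.deg ⟨_, _, F p s h⟩ = _
        rw [h1, add_tsub_cancel_left] }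
  have key : ∀ (l : Fin k → ℕ) (hl : ∀ i, (l i : ℕ∞) ≤ x.degree i)
      (h : ∀ i, (G.deg lam i : ℕ∞) ≤ y.degree i)
      (h' : ∀ i, ((G.deg lam + l) i : ℕ∞) ≤ y.degree i),
      (⟨_, _, ini ⟨G.deg lam, h⟩⟩ : Path Λ) = lam ∧
      y.seg ⟨G.deg lam, h⟩ ⟨G.deg lam + l, h'⟩ (fun _ => Nat.le_add_right _ _) =
        x.seg x.zero ⟨l, hl⟩ (x.zero_le _) := by
    intro l hl h h'
    have hs : q ⟨G.deg lam + l, h'⟩ = ⟨l, hl⟩ :=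
      Subtype.ext ((hq _).trans (add_tsub_cancel_left _ _))
    have hle : (⟨G.deg lam, h⟩ : Omega k (fun i => x.degree i + G.deg lam i)) ≤
        ⟨G.deg lam + l, h'⟩ := fun _ => Nat.le_add_right _ _
    obtain ⟨e, he⟩ := eq_of_deg_zero G (r ⟨G.deg lam + l, h'⟩) (by
      rw [hr]; exact tsub_eq_zero_of_le (fun _ => Nat.le_add_right _ _))
    obtain ⟨h1, h2⟩ := mk_unique G (ini ⟨G.deg lam, h⟩)
      (r ⟨G.deg lam + l, h'⟩ ≫ F _ _ hle) lam.hom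
      (x.mor (x.zero_le (q ⟨G.deg lam + l, h'⟩)) ≫ eqToHom h0.symm) (by
        rw [Category.assoc, hF, hT', hTdef, Category.assoc]) (hini _)
    refine ⟨h1, ?_⟩
    rw [he, mk_eqToHom_comp, mk_comp_eqToHom] at h2
    refine Eq.trans h2 ?_
    change x.seg x.zero (q ⟨G.deg lam + l, h'⟩) _ = _
    congr 1
  refine ⟨y, fun _ => rfl, ?_, fun l hl h h' => (key l hl h h').2⟩
  have h : ∀ i, (G.deg lam i : ℕ∞) ≤ y.degree i := fun i => le_add_self
  refine ⟨h, ?_⟩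
  refine Eq.trans ?_ (key 0 (fun _ => by simp) h (by simpa using h)).1
  obtain ⟨e, he⟩ := eq_of_deg_zero G (ini y.zero) (hini _)
  have := hF y.zero ⟨G.deg lam, h⟩ (y.zero_le _)
  rw [he] at this
  rw [← this, mk_comp_eqToHom]
  rfl

theorem seg_trans (x : G.GraphPath) (p q s : Omega k x.degree) (h : p ≤ q) (h' : q ≤ s) :
    x.seg p s (h.trans h') = (x.seg p q h).comp (x.seg q s h') rfl := by
  unfold seg
  rw [comp_mk, mor_trans]

theorem ext_seg {m : Fin k → ℕ∞} {F F' : (Omega k m)ᵒᵖ ⥤ Λ}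
    {hF : ∀ (p q : Omega k m) (h : p ≤ q), G.deg ⟨_, _, F.map (homOfLE h).op⟩ = q.1 - p.1}
    {hF' : ∀ (p q : Omega k m) (h : p ≤ q), G.deg ⟨_, _, F'.map (homOfLE h).op⟩ = q.1 - p.1}
    (e : ∀ (p q : Omega k m) (h : p ≤ q),
      (⟨m, F, hF⟩ : G.GraphPath).seg p q h = (⟨m, F', hF'⟩ : G.GraphPath).seg p q h) :
    (⟨m, F, hF⟩ : G.GraphPath) = ⟨m, F', hF'⟩ := by
  have : F = F' := by
    refine CategoryTheory.Functor.hext (fun n => ?_) (fun a b f => ?_)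
    · exact congrArg Path.src (e n.unop n.unop le_rfl)
    · have := e b.unop a.unop (leOfHom f.unop)
      unfold seg at this
      simp only [Path.mk.injEq] at this
      exact this.2.2
  subst this
  rfl

theorem existsUnique_prepend (lam : Path Λ) (x : G.GraphPath) (h0 : lam.src = x.range) :
    ∃! y : G.GraphPath, IsPrepend lam x y := by
  obtain ⟨y, hy⟩ := exists_prepend lam x h0
  refine ⟨y, hy, fun z hz => ?_⟩
  obtain ⟨m, F, hF⟩ := y
  obtain ⟨m', F', hF'⟩ := z
  obtain ⟨hd, ⟨hD, hlam⟩, hseg⟩ := hy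
  obtain ⟨hd', ⟨hD', hlam'⟩, hseg'⟩ := hz
  obtain rfl : m = m' := funext fun i => (hd i).trans (hd' i).symm
  have h1 : ∀ n : Omega k m, (⟨m, F', hF'⟩ : G.GraphPath).seg ⟨0, fun _ => by simp⟩ n
      (fun _ => Nat.zero_le _) =
      (⟨m, F, hF⟩ : G.GraphPath).seg ⟨0, fun _ => by simp⟩ n (fun _ => Nat.zero_le _) := by
    intro n
    have hl : ∀ i, ((n.1 - G.deg lam) i : ℕ∞) ≤ x.degree i := fun i => by
      have h2 := n.2 i
      have h3 := hd i
      dsimp only at h3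
      rw [h3] at h2
      rw [Pi.sub_apply, ENat.natCast_sub]
      exact tsub_le_iff_right.2 h2
    have hs : ∀ i, ((G.deg lam + (n.1 - G.deg lam)) i : ℕ∞) ≤ m i := fun i => by
      have h3 := hd i
      dsimp only at h3
      rw [h3, Pi.add_apply, Nat.cast_add, add_comm]
      exact add_le_add (hl i) le_rfl
    have e1 := seg_trans (⟨m, F, hF⟩ : G.GraphPath) ⟨0, fun _ => by simp⟩ ⟨_, hD⟩ ⟨_, hs⟩
      (fun _ => Nat.zero_le _) (fun _ => Nat.le_add_right _ _)
    have e2 := seg_trans (⟨m, F', hF'⟩ : G.GraphPath) ⟨0, fun _ => by simp⟩ ⟨_, hD⟩ ⟨_, hs⟩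
      (fun _ => Nat.zero_le _) (fun _ => Nat.le_add_right _ _)
    have hn : n ≤ ⟨_, hs⟩ := fun i => by
      simp only [Pi.add_apply, Pi.sub_apply]; omega
    have e3 := seg_trans (⟨m, F, hF⟩ : G.GraphPath) ⟨0, fun _ => by simp⟩ n ⟨_, hs⟩
      (fun _ => Nat.zero_le _) hn
    have e4 := seg_trans (⟨m, F', hF'⟩ : G.GraphPath) ⟨0, fun _ => by simp⟩ n ⟨_, hs⟩
      (fun _ => Nat.zero_le _) hn
    have e5 : ∀ {a b a' b' : Path Λ} (h : a.src = b.tgt) (h' : a'.src = b'.tgt), a = a' → b = b' →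
        a.comp b h = a'.comp b' h' := by
      rintro a b a' b' h h' rfl rfl; rfl
    have e6 := e5 rfl rfl (hlam'.trans hlam.symm) ((hseg' _ hl hD hs).trans (hseg _ hl hD hs).symm)
    refine (comp_unique G rfl rfl (e4.symm.trans ((e2.trans (e6.trans e1.symm)).trans e3)) ?_).1
    exact (hF' _ _ _).trans (hF _ _ _).symm
  refine ext_seg fun p q h => ?_
  have e1 := seg_trans (⟨m, F, hF⟩ : G.GraphPath) ⟨0, fun _ => by simp⟩ p q
    (fun _ => Nat.zero_le _) h
  have e2 := seg_trans (⟨m, F', hF'⟩ : G.GraphPath) ⟨0, fun _ => by simp⟩ p q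
    (fun _ => Nat.zero_le _) h
  refine (comp_unique G rfl rfl (e2.symm.trans ((h1 q).trans e1)) ?_).2
  exact (hF' _ _ _).trans (hF _ _ _).symm

/-- The graph morphism `lam x`, for `s(lam) = r(x)`. -/
noncomputable def prepend (lam : Path Λ) (x : G.GraphPath) (h : lam.src = x.range) : G.GraphPath :=
  (existsUnique_prepend lam x h).choose

theorem prepend_spec (lam : Path Λ) (x : G.GraphPath) (h : lam.src = x.range) :
    IsPrepend lam x (prepend lam x h) :=
  (existsUnique_prepend lam x h).choose_spec.1

end GraphPath

/-- Condition (B): every vertex `a` is the range of a boundary path `x` such that `lam x ≠ mu x`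
for all distinct paths `lam`, `mu` with source `a`. -/
def ConditionB : Prop :=
  ∀ a : Λ, ∃ x : G.GraphPath, x.range = a ∧ x.IsBoundary ∧
    ∀ (lam mu : Path Λ) (hlam : lam.src = x.range) (hmu : mu.src = x.range), lam ≠ mu →
      GraphPath.prepend lam x hlam ≠ GraphPath.prepend mu x hmu

/-- Cuntz–Krieger `Λ`-families in a (not necessarily unital) C*-algebra `A`.
In `gap`, `l` is a listing of a finite exhaustive set `E ⊆ aΛ`, in any order, and the product
`∏_{lam ∈ E} (t_a - t_lam t_lam*)` is taken with final factor `t_a`, which is a unit for all the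
other factors. -/
structure IsCuntzKriegerFamily (hfa : G.FinitelyAligned) {A : Type w} [NonUnitalCStarAlgebra A]
    (t : Path Λ → A) : Prop where
  partialIsometry : ∀ lam, t lam * star (t lam) * t lam = t lam
  projection : ∀ a : Λ, IsStarProjection (t (Path.vertex a))
  orthogonal : ∀ a b : Λ, a ≠ b → t (Path.vertex a) * t (Path.vertex b) = 0
  mul_eq : ∀ (lam mu : Path Λ) (h : lam.src = mu.tgt), t lam * t mu = t (lam.comp mu h)
  star_mul_eq : ∀ lam mu : Path Λ,
    star (t lam) * t mu = ∑ p ∈ (hfa lam mu).toFinset, t p.1 * star (t p.2)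
  gap : ∀ (a : Λ) (l : List (Path Λ)), l.Nodup → G.Exhaustive a {lam | lam ∈ l} →
    l.foldr (fun lam z => (t (Path.vertex a) - t lam * star (t lam)) * z) (t (Path.vertex a)) = 0

end KGraph

/-- The C*-subalgebra generated by a family of elements of a C*-algebra. -/
def generatedCStar {ι : Type w'} {A : Type w} [NonUnitalCStarAlgebra A] (t : ι → A) :
    NonUnitalStarSubalgebra ℂ A :=
  (NonUnitalStarAlgebra.adjoin ℂ (Set.range t)).topologicalClosure

/-- The generator `t i`, as an element of the generated C*-algebra. -/
def generator {ι : Type w'} {A : Type w} [NonUnitalCStarAlgebra A] (t : ι → A) (i : ι) :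
    generatedCStar t :=
  ⟨t i, NonUnitalStarSubalgebra.le_topologicalClosure _
    (NonUnitalStarAlgebra.subset_adjoin ℂ _ (Set.mem_range_self i))⟩

end HigherRank

/-! Existence. The initial segments of a boundary path form a maximal filter in the order by initial
segments. On ℓ² of the set of all maximal filters let t_λ be composition with the partial bijection
λx ↦ x. The product relations are identities between partial bijections. The gap relation holds
because a maximal filter at v contains a member of every finite exhaustive subset of vΛ, and t_v ≠ 0
because (B) provides a maximal filter at v.

Uniqueness. Finite combinations of the t_λ t_μ* are dense in C*(t); the core part of such a
combination keeps the terms with d(λ) = d(μ). The heart of the proof is `norm_corePart_le`: for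
Cuntz–Krieger families r and t with all t_v ≠ 0, the core part evaluated in r has norm at most that
of the whole combination evaluated in t. Upper bound: the paths involved lie in a finite aligned set
F (`exists_finite_isAligned`). Over F the core part is a block matrix in the matrix units t_λ Q_λ
t_μ*, where the gap projection Q_λ removes the proper extensions of λ in F. Its norm is at most the
largest norm of a coefficient block, and blocks whose Q_λ is killed by the gap relation do not
count. Lower bound: for every other block, (B) yields a maximal filter at its source that avoids the
tails removed by Q_λ and separates distinct paths with that source. Compression by the t_{λκ}, for κ
far along the filter, turns the combination into the same coefficient matrix over nonzero matrix
units.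

From the bound to the isomorphism. The pairs (z ↦ z^{d(λ)} s_λ, t_λ) form a Cuntz–Krieger family in
C(𝕋^k, A) × B. Integrating the first coordinate over the torus leaves the core part in s, so ‖∫ f₁‖
≤ ‖f₂‖ on the generated algebra. If f₂ = 0, this bound for f*f gives ∫ f₁*f₁ = 0, hence f₁ = 0. So
the second coordinate is injective there; inverting it and evaluating the first coordinate at the
identity of the torus gives C*(t) → C*(s). Exchanging s and t gives the inverse. -/

namespace HigherRank

/-! ### Initial segments and minimal common extensions -/

namespace Path

variable {Λ : Type u} [Category.{v} Λ]

open Classical in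
/-- Composition of paths as a total operation: `lam * mu = lam` when the two are not composable. -/
noncomputable instance : Mul (Path Λ) :=
  ⟨fun lam mu => if h : lam.src = mu.tgt then lam.comp mu h else lam⟩

theorem comp_eq_mul {lam mu : Path Λ} (h : lam.src = mu.tgt) : lam.comp mu h = lam * mu :=
  (dif_pos h).symm

theorem src_mul {lam mu : Path Λ} (h : lam.src = mu.tgt) : (lam * mu).src = mu.src := by
  rw [← comp_eq_mul h]; rfl

theorem tgt_mul (lam mu : Path Λ) : (lam * mu).tgt = lam.tgt := by
  by_cases h : lam.src = mu.tgt
  · rw [← comp_eq_mul h]; rfl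
  · exact congrArg Path.tgt (dif_neg h)

theorem mk_mul_mk {a b c : Λ} (f : a ⟶ b) (g : c ⟶ a) :
    (⟨a, b, f⟩ : Path Λ) * ⟨c, a, g⟩ = ⟨c, b, g ≫ f⟩ := by
  rw [← comp_eq_mul rfl, KGraph.GraphPath.comp_mk]

@[simp] theorem src_vertex (a : Λ) : (vertex a).src = a := rfl

@[simp] theorem tgt_vertex (a : Λ) : (vertex a).tgt = a := rfl

theorem mul_vertex {lam : Path Λ} {a : Λ} (h : lam.src = a) : lam * vertex a = lam := by
  obtain ⟨s, t, f⟩ := lam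
  obtain rfl : s = a := h
  simp [vertex, mk_mul_mk]

theorem vertex_mul {lam : Path Λ} {a : Λ} (h : lam.tgt = a) : vertex a * lam = lam := by
  obtain ⟨s, t, f⟩ := lam
  obtain rfl : t = a := h
  simp [vertex, mk_mul_mk]

theorem mul_assoc_of_src {lam mu nu : Path Λ} (h : lam.src = mu.tgt) (h' : mu.src = nu.tgt) :
    lam * mu * nu = lam * (mu * nu) := by
  obtain ⟨a, b, f⟩ := lam
  obtain ⟨c, a', g⟩ := mu
  obtain ⟨d, c', e⟩ := nu
  obtain rfl : a = a' := h
  obtain rfl : c = c' := h'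
  simp [mk_mul_mk]

/-- `lam ≤ nu` means that `lam` is an initial segment of `nu`. -/
instance : Preorder (Path Λ) where
  le lam nu := ∃ al, lam.src = al.tgt ∧ nu = lam * al
  le_refl lam := ⟨vertex lam.src, rfl, (mul_vertex rfl).symm⟩
  le_trans := by
    rintro lam mu nu ⟨al, h, rfl⟩ ⟨be, h', rfl⟩
    rw [src_mul h] at h'
    exact ⟨al * be, by rw [tgt_mul, h], mul_assoc_of_src h h'⟩

theorem le_mul {lam mu : Path Λ} (h : lam.src = mu.tgt) : lam ≤ lam * mu := ⟨mu, h, rfl⟩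

theorem tgt_eq_of_le {lam nu : Path Λ} (h : lam ≤ nu) : lam.tgt = nu.tgt := by
  obtain ⟨al, -, rfl⟩ := h
  rw [tgt_mul]

theorem vertex_le {lam : Path Λ} {a : Λ} (h : lam.tgt = a) : vertex a ≤ lam :=
  ⟨lam, h.symm, (vertex_mul h).symm⟩

theorem mul_le_mul_left_of_src {lam mu nu : Path Λ} (h : lam.src = mu.tgt) (h' : mu ≤ nu) :
    lam * mu ≤ lam * nu := by
  obtain ⟨al, h1, rfl⟩ := h'
  exact ⟨al, by rw [src_mul h, h1], (mul_assoc_of_src h h1).symm⟩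

/-- Two paths meet if they have a common extension. -/
def Meets (lam mu : Path Λ) : Prop := ∃ nu, lam ≤ nu ∧ mu ≤ nu

theorem Meets.symm {lam mu : Path Λ} (h : Meets lam mu) : Meets mu lam :=
  let ⟨nu, h1, h2⟩ := h
  ⟨nu, h2, h1⟩

theorem Meets.mono {lam mu lam' mu' : Path Λ} (h : Meets lam mu) (h1 : lam' ≤ lam)
    (h2 : mu' ≤ mu) : Meets lam' mu' :=
  let ⟨nu, h3, h4⟩ := h
  ⟨nu, h1.trans h3, h2.trans h4⟩

theorem Meets.tgt_eq {lam mu : Path Λ} (h : Meets lam mu) : lam.tgt = mu.tgt :=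
  let ⟨_, h1, h2⟩ := h
  (tgt_eq_of_le h1).trans (tgt_eq_of_le h2).symm

end Path

namespace KGraph

open HigherRank.Path

variable {k : ℕ} {Λ : Type u} [Category.{v} Λ] (G : KGraph k Λ)

theorem deg_mul {lam mu : Path Λ} (h : lam.src = mu.tgt) :
    G.deg (lam * mu) = G.deg lam + G.deg mu := by
  rw [← comp_eq_mul h, G.deg_comp]

theorem mul_inj {lam mu lam' mu' : Path Λ} (h : lam.src = mu.tgt) (h' : lam'.src = mu'.tgt)
    (e : lam * mu = lam' * mu') (hd : G.deg lam = G.deg lam') : lam = lam' ∧ mu = mu' := by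
  rw [← comp_eq_mul h, ← comp_eq_mul h'] at e
  exact GraphPath.comp_unique G h h' e hd

theorem mul_left_inj (G : KGraph k Λ) {lam mu mu' : Path Λ} (h : lam.src = mu.tgt) (h' : lam.src = mu'.tgt)
    (e : lam * mu = lam * mu') : mu = mu' :=
  (G.mul_inj h h' e rfl).2

theorem mul_right_inj (G : KGraph k Λ) {lam lam' mu : Path Λ} (h : lam.src = mu.tgt) (h' : lam'.src = mu.tgt)
    (e : lam * mu = lam' * mu) : lam = lam' := by
  refine (G.mul_inj h h' e ?_).1
  have := congrArg G.deg e
  rw [G.deg_mul h, G.deg_mul h'] at this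
  exact add_right_cancel this

theorem exists_eq_mul {nu : Path Λ} {m n : Fin k → ℕ} (h : G.deg nu = m + n) :
    ∃ lam mu : Path Λ, lam.src = mu.tgt ∧ nu = lam * mu ∧ G.deg lam = m ∧ G.deg mu = n := by
  obtain ⟨⟨lam, mu⟩, ⟨h1, h2, h3, h4⟩, -⟩ := G.factorisation nu m n h
  exact ⟨lam, mu, h3, by rw [h4, comp_eq_mul h3], h1, h2⟩

theorem deg_le_of_le {lam nu : Path Λ} (h : lam ≤ nu) : G.deg lam ≤ G.deg nu := by
  obtain ⟨al, h1, rfl⟩ := h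
  rw [G.deg_mul h1]
  exact le_self_add

theorem exists_le_deg_eq {nu : Path Λ} {n : Fin k → ℕ} (h : n ≤ G.deg nu) :
    ∃ lam, lam ≤ nu ∧ G.deg lam = n := by
  obtain ⟨lam, mu, h1, rfl, h2, -⟩ := G.exists_eq_mul (add_tsub_cancel_of_le h).symm
  exact ⟨lam, le_mul h1, h2⟩

theorem eq_vertex_of_deg_eq_zero {al : Path Λ} (h : G.deg al = 0) :
    al = vertex al.tgt := by
  obtain ⟨a, b, f⟩ := al
  obtain ⟨rfl, rfl⟩ := GraphPath.eq_of_deg_zero G f h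
  rfl

theorem mul_eq_left_of_deg_eq_zero {lam al : Path Λ} (h : lam.src = al.tgt) (h0 : G.deg al = 0) :
    lam * al = lam := by
  rw [G.eq_vertex_of_deg_eq_zero h0, mul_vertex h]

theorem eq_of_le_of_deg_eq {lam nu : Path Λ} (h : lam ≤ nu) (hd : G.deg lam = G.deg nu) :
    lam = nu := by
  obtain ⟨al, h1, rfl⟩ := h
  rw [G.deg_mul h1] at hd
  exact (G.mul_eq_left_of_deg_eq_zero h1 (add_eq_left.1 hd.symm)).symm

theorem eq_of_le_of_le (G : KGraph k Λ) {lam nu : Path Λ} (h : lam ≤ nu) (h' : nu ≤ lam) : lam = nu :=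
  G.eq_of_le_of_deg_eq h (le_antisymm (G.deg_le_of_le h) (G.deg_le_of_le h'))

/-- By unique factorisation a path has one initial segment of each admissible degree, so the initial
segments of a fixed path are ordered exactly as their degrees. -/
theorem le_of_le_of_deg_le {lam mu nu : Path Λ} (h : lam ≤ nu) (h' : mu ≤ nu)
    (hd : G.deg lam ≤ G.deg mu) : lam ≤ mu := by
  obtain ⟨p, q, h1, rfl, h2, -⟩ := G.exists_eq_mul (add_tsub_cancel_of_le hd).symm
  obtain ⟨al, h3, rfl⟩ := h
  obtain ⟨be, h4, h5⟩ := h'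
  rw [src_mul h1] at h4
  rw [mul_assoc_of_src h1 h4] at h5
  rw [(G.mul_inj h3 (by rw [tgt_mul, h1]) h5 h2.symm).1]
  exact le_mul h1

theorem eq_of_le_of_le_of_deg_eq {lam mu nu : Path Λ} (h : lam ≤ nu) (h' : mu ≤ nu)
    (hd : G.deg lam = G.deg mu) : lam = mu :=
  G.eq_of_le_of_deg_eq (G.le_of_le_of_deg_le h h' hd.le) hd

theorem le_of_mul_le_mul (G : KGraph k Λ) {lam mu nu : Path Λ} (h : lam.src = mu.tgt) (h' : lam.src = nu.tgt)
    (hle : lam * mu ≤ lam * nu) : mu ≤ nu := by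
  obtain ⟨al, h1, h2⟩ := hle
  rw [src_mul h] at h1
  rw [mul_assoc_of_src h h1] at h2
  exact ⟨al, h1, G.mul_left_inj h' (by rw [tgt_mul, h]) h2⟩

theorem meets_of_mul (G : KGraph k Λ) {lam mu nu : Path Λ} (h : lam.src = mu.tgt) (h' : lam.src = nu.tgt)
    (hm : Meets (lam * mu) (lam * nu)) : Meets mu nu := by
  obtain ⟨ka, h1, h2⟩ := hm
  obtain ⟨ka', h3, rfl⟩ := (le_mul h).trans h1
  exact ⟨ka', G.le_of_mul_le_mul h h3 h1, G.le_of_mul_le_mul h' h3 h2⟩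

theorem mem_minExt {lam mu : Path Λ} {p : Path Λ × Path Λ} :
    p ∈ G.minExt lam mu ↔ lam.src = p.1.tgt ∧ mu.src = p.2.tgt ∧ lam * p.1 = mu * p.2 ∧
      G.deg (lam * p.1) = G.deg lam ⊔ G.deg mu := by
  constructor
  · rintro ⟨h1, h2, h3, h4⟩
    rw [comp_eq_mul] at h3 h4
    rw [comp_eq_mul] at h3
    exact ⟨h1, h2, h3, h4⟩
  · rintro ⟨h1, h2, h3, h4⟩
    refine ⟨h1, h2, ?_, ?_⟩
    · rw [comp_eq_mul, comp_eq_mul, h3]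
    · rw [comp_eq_mul, h4]

theorem minExt_swap {lam mu al be : Path Λ} (h : (al, be) ∈ G.minExt lam mu) :
    (be, al) ∈ G.minExt mu lam := by
  obtain ⟨h1, h2, h3, h4⟩ := G.mem_minExt.1 h
  dsimp only at h1 h2 h3 h4
  exact G.mem_minExt.2 ⟨h2, h1, h3.symm, by dsimp only; rw [← h3, h4, sup_comm]⟩

/-- Truncate `nu` at degree d(lam) ∨ d(mu): every common extension passes through a minimal one. -/
theorem exists_minExt_le {lam mu nu : Path Λ} (h : lam ≤ nu) (h' : mu ≤ nu) :
    ∃ al be, (al, be) ∈ G.minExt lam mu ∧ lam * al ≤ nu := by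
  obtain ⟨ka, hka, hd⟩ := G.exists_le_deg_eq (sup_le (G.deg_le_of_le h) (G.deg_le_of_le h'))
  obtain ⟨al, h1, rfl⟩ := G.le_of_le_of_deg_le h hka (hd ▸ le_sup_left)
  obtain ⟨be, h2, h3⟩ := G.le_of_le_of_deg_le h' hka (hd ▸ le_sup_right)
  exact ⟨al, be, G.mem_minExt.2 ⟨h1, h2, h3, hd⟩, hka⟩

theorem minExt_nonempty_iff {lam mu : Path Λ} : (G.minExt lam mu).Nonempty ↔ Meets lam mu := by
  constructor
  · rintro ⟨⟨al, be⟩, h⟩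
    obtain ⟨h1, h2, h3, -⟩ := G.mem_minExt.1 h
    exact ⟨lam * al, le_mul h1, h3 ▸ le_mul h2⟩
  · rintro ⟨nu, h, h'⟩
    obtain ⟨al, be, h1, -⟩ := G.exists_minExt_le h h'
    exact ⟨_, h1⟩

/-- With this, the alignment condition specialises to closure under replacing an initial segment by
another member of the same degree and source. -/
theorem minExt_eq_of_le {lam al be : Path Λ} (h : lam.src = be.tgt) :
    (al, vertex be.src) ∈ G.minExt lam (lam * be) ↔ al = be := by
  rw [mem_minExt, src_mul h]
  dsimp only
  rw [mul_vertex (src_mul h)]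
  constructor
  · rintro ⟨h1, -, h3, -⟩
    exact G.mul_left_inj h1 h h3
  · rintro rfl
    exact ⟨h, rfl, rfl, (sup_eq_right.2 (G.deg_le_of_le (le_mul h))).symm⟩

end KGraph

end HigherRank

/-! ### Finite aligned sets of paths -/

namespace HigherRank

namespace KGraph

open HigherRank.Path

variable {k : ℕ} {Λ : Type u} [Category.{v} Λ] (G : KGraph k Λ)

/-- `F` is closed under replacing the initial segment `mu` of a minimal common extension of
`mu, nu ∈ F` by a path `lam ∈ F` with the same degree and source. -/
def IsAligned (F : Set (Path Λ)) : Prop :=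
  ∀ lam ∈ F, ∀ mu ∈ F, ∀ nu ∈ F, G.deg lam = G.deg mu → lam.src = mu.src →
    ∀ al be, (al, be) ∈ G.minExt mu nu → lam * al ∈ F

/-- The smallest aligned set containing `E`. -/
inductive AlignedHull (E : Set (Path Λ)) : Path Λ → Prop
  | base (lam : Path Λ) (h : lam ∈ E) : AlignedHull E lam
  | step (lam mu nu al be : Path Λ) (hl : AlignedHull E lam) (hm : AlignedHull E mu)
      (hn : AlignedHull E nu) (hd : G.deg lam = G.deg mu) (hs : lam.src = mu.src)
      (h : (al, be) ∈ G.minExt mu nu) : AlignedHull E (lam * al)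

variable {G}

theorem deg_mul_minExt {lam mu nu al be : Path Λ} (hd : G.deg lam = G.deg mu)
    (hs : lam.src = mu.src) (h : (al, be) ∈ G.minExt mu nu) :
    G.deg (lam * al) = G.deg mu ⊔ G.deg nu := by
  obtain ⟨h1, -, -, h4⟩ := G.mem_minExt.1 h
  rw [← h4, G.deg_mul h1, G.deg_mul (hs.trans h1), hd]

theorem AlignedHull.deg_le {E : Set (Path Λ)} {N : Fin k → ℕ} (hE : ∀ lam ∈ E, G.deg lam ≤ N)
    {lam : Path Λ} (h : G.AlignedHull E lam) : G.deg lam ≤ N := by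
  induction h with
  | base lam h => exact hE lam h
  | step lam mu nu al be hl hm hn hd hs h ih1 ih2 ih3 =>
    rw [deg_mul_minExt hd hs h]
    exact sup_le ih2 ih3

/-- Paths of `E`, and one-step paths built from `L`. -/
def hullSeed (G : KGraph k Λ) (E L : Set (Path Λ)) : Set (Path Λ) :=
  E ∪ ⋃ lam ∈ L, ⋃ mu ∈ L, ⋃ nu ∈ L, (fun p : Path Λ × Path Λ => lam * p.1) '' G.minExt mu nu

/-- Paths obtained from those in `S` by replacing an initial segment. -/
def hullSwap (G : KGraph k Λ) (L S : Set (Path Λ)) : Set (Path Λ) :=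
  ⋃ lam ∈ L, ⋃ mu ∈ L, (fun al => lam * al) ''
    {al | (lam.src = mu.src ∧ G.deg lam = G.deg mu) ∧ mu.src = al.tgt ∧ mu * al ∈ S}

theorem finite_hullSeed (hfa : G.FinitelyAligned) {E L : Set (Path Λ)} (hE : E.Finite)
    (hL : L.Finite) : (G.hullSeed E L).Finite :=
  hE.union <| hL.biUnion fun _ _ => hL.biUnion fun _ _ => hL.biUnion fun _ _ =>
    (hfa _ _).image _

theorem finite_hullSwap (G : KGraph k Λ) {L S : Set (Path Λ)} (hL : L.Finite) (hS : S.Finite) :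
    (G.hullSwap L S).Finite :=
  hL.biUnion fun _ _ => hL.biUnion fun mu _ => Set.Finite.image _ <|
    Set.Finite.of_injOn (f := fun al => mu * al) (fun _ h => h.2.2)
      (fun _ h _ h' e => G.mul_left_inj h.2.1 h'.2.1 e) hS

/-- The induction on degree that makes the hull finite. A step whose ingredients all have degree
below n lands in the seed. If `nu` already has degree n, the step merely replaces its initial
segment `mu` by `lam`, and such replacements could be iterated. Two consecutive replacements merge
into one, however, so a single replacement applied to the seed reaches everything. -/
theorem AlignedHull.mem_of_deg_eq {E : Set (Path Λ)} {n : Fin k → ℕ} {lam : Path Λ}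
    (h : G.AlignedHull E lam) (hn : G.deg lam = n) :
    lam ∈ G.hullSeed E {mu | G.AlignedHull E mu ∧ G.deg mu < n} ∪
      G.hullSwap {mu | G.AlignedHull E mu ∧ G.deg mu < n}
        (G.hullSeed E {mu | G.AlignedHull E mu ∧ G.deg mu < n}) := by
  induction h with
  | base lam h => exact Or.inl (Or.inl h)
  | step lam mu nu al be hl hm hnu hd hs h ih1 ih2 ih3 =>
    have hdeg := deg_mul_minExt hd hs h
    obtain ⟨h1, h2, h3, h4⟩ := G.mem_minExt.1 h
    dsimp only at h1 h2 h3 h4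
    have hlal : lam.src = al.tgt := hs.trans h1
    have hjoin : G.deg mu ⊔ G.deg nu = n := hdeg ▸ hn
    have hmle : G.deg mu ≤ n := hjoin ▸ le_sup_left
    have hnle : G.deg nu ≤ n := hjoin ▸ le_sup_right
    -- If `mu` has full degree, then `al` is a vertex and the step returns `lam`.
    rcases hmle.eq_or_lt with hm' | hm'
    · have h0 : G.deg al = 0 := by
        rw [G.deg_mul hlal, hd, hm'] at hn
        exact add_eq_left.1 hn
      rw [G.mul_eq_left_of_deg_eq_zero hlal h0]
      exact ih1 (hd.trans hm')
    have seed : ∀ {mu' nu' : Path Λ}, G.AlignedHull E mu' → G.AlignedHull E nu' →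
        G.deg mu' < n → G.deg nu' < n → ∀ {lam' al' be' : Path Λ}, G.AlignedHull E lam' →
        G.deg lam' < n → (al', be') ∈ G.minExt mu' nu' →
        lam' * al' ∈ G.hullSeed E {mu | G.AlignedHull E mu ∧ G.deg mu < n} := by
      intro mu' nu' a1 a2 a3 a4 lam' al' be' a5 a6 a7
      refine Or.inr ?_
      simp only [Set.mem_iUnion]
      exact ⟨lam', ⟨a5, a6⟩, mu', ⟨a1, a3⟩, nu', ⟨a2, a4⟩, (al', be'), a7, rfl⟩
    have hl' : G.deg lam < n := hd ▸ hm'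
    rcases hnle.eq_or_lt with hn' | hn'
    swap
    · exact Or.inl (seed hm hnu hm' hn' hl hl' h)
    -- Here `nu` has full degree, so `be` is a vertex and `nu = mu * al`.
    have hbe : G.deg be = 0 := by
      rw [h3, G.deg_mul h2, hjoin, hn'] at h4
      exact add_eq_left.1 h4
    rw [G.mul_eq_left_of_deg_eq_zero h2 hbe] at h3
    rcases ih3 hn' with hseed | hswap
    · refine Or.inr ?_
      simp only [hullSwap, Set.mem_iUnion]
      exact ⟨lam, ⟨hl, hl'⟩, mu, ⟨hm, hm'⟩, al, ⟨⟨hs, hd⟩, h1, h3 ▸ hseed⟩, rfl⟩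
    · simp only [hullSwap, Set.mem_iUnion] at hswap
      obtain ⟨lam', ⟨b1, b2⟩, mu', ⟨b3, b4⟩, al', ⟨⟨b8, b9⟩, b5, b6⟩, b7⟩ := hswap
      dsimp only at b7
      -- `nu = mu * al = lam' * al'`
      have c1 : lam'.src = al'.tgt := b8.trans b5
      -- Cut `nu` at the minimal common extension `mu * ga = lam' * ga'` of its two initial
      -- segments, with remainder `de`. Then `lam * al = (lam * ga) * de`, while `(mu' * ga') * de =
      -- mu' * al'` lies in the seed. So one replacement, of `mu' * ga'` by `lam * ga`, suffices
      -- when these have degree below n. Otherwise `de` is a vertex and `lam * al` is itself in the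
      -- seed.
      obtain ⟨ga, ga', hg, de, c2, c3⟩ := G.exists_minExt_le (nu := nu) (h3 ▸ le_mul h1)
        (b7 ▸ le_mul c1)
      obtain ⟨g1, g2, g3, g4⟩ := G.mem_minExt.1 hg
      dsimp only at g1 g2 g3 g4
      rw [src_mul g1] at c2
      have c4 : ga'.src = de.tgt := by rw [← c2, ← src_mul g1, g3, src_mul g2]
      have hal : al = ga * de := G.mul_left_inj h1 (by rw [tgt_mul, g1])
        (by rw [h3, c3, mul_assoc_of_src g1 c2])
      have hal' : al' = ga' * de := G.mul_left_inj c1 (by rw [tgt_mul, g2])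
        (by rw [b7, c3, g3, mul_assoc_of_src g2 c4])
      have hle : G.deg (mu * ga) ≤ n := g4 ▸ sup_le hm'.le b2.le
      have hlga : lam.src = ga.tgt := hs.trans g1
      rcases hle.eq_or_lt with hq | hq
      · have hde : G.deg de = 0 := by
          rw [c3, G.deg_mul (by rw [src_mul g1, c2]), hq] at hn'
          exact add_eq_left.1 hn'
        rw [hal, G.mul_eq_left_of_deg_eq_zero c2 hde]
        exact Or.inl (seed hm b1 hm' b2 hl hl' hg)
      · have hg' := G.minExt_swap hg
        have b10 : mu'.src = ga'.tgt := b8.symm.trans g2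
        refine Or.inr ?_
        simp only [hullSwap, Set.mem_iUnion]
        refine ⟨lam * ga, ⟨.step lam mu lam' ga ga' hl hm b1 hd hs hg, ?_⟩, mu' * ga',
          ⟨.step mu' lam' mu ga' ga b3 b1 hm b9.symm b8.symm hg', ?_⟩, de, ⟨⟨?_, ?_⟩, ?_, ?_⟩, ?_⟩
        · rwa [deg_mul_minExt hd hs hg, ← g4]
        · rwa [deg_mul_minExt b9.symm b8.symm hg', sup_comm, ← g4]
        · rw [src_mul hlga, src_mul b10, c2, c4]
        · rw [deg_mul_minExt hd hs hg, deg_mul_minExt b9.symm b8.symm hg', sup_comm]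
        · rw [src_mul b10, c4]
        · rwa [mul_assoc_of_src b10 c4, ← hal']
        · dsimp only
          rw [hal, mul_assoc_of_src hlga c2]

theorem AlignedHull.finite_deg_eq (hfa : G.FinitelyAligned) {E : Set (Path Λ)} (hE : E.Finite)
    (n : Fin k → ℕ) : {lam | G.AlignedHull E lam ∧ G.deg lam = n}.Finite := by
  induction n using WellFoundedLT.induction with
  | ind n ih =>
    have hL : {mu | G.AlignedHull E mu ∧ G.deg mu < n}.Finite := by
      refine ((Set.finite_Iio n).biUnion fun m hm => ih m hm).subset fun mu h => ?_
      simp only [Set.mem_iUnion]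
      exact ⟨_, h.2, h.1, rfl⟩
    have hS := finite_hullSeed hfa hE hL
    exact (hS.union (finite_hullSwap G hL hS)).subset fun lam h => h.1.mem_of_deg_eq h.2

/-- A step creates a path of degree d(mu) ∨ d(nu), so a degree bound for `E` persists in the hull.
Only finitely many degrees lie below the bound, each attained finitely often. -/
theorem exists_finite_isAligned (hfa : G.FinitelyAligned) {E : Set (Path Λ)} (hE : E.Finite) :
    ∃ F : Finset (Path Λ), E ⊆ F ∧ G.IsAligned F := by
  obtain ⟨N, hN⟩ := (hE.image G.deg).bddAbove
  have hfin : {lam | G.AlignedHull E lam}.Finite := by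
    refine ((Set.finite_Iic N).biUnion fun n _ => AlignedHull.finite_deg_eq hfa hE n).subset
      fun lam h => ?_
    simp only [Set.mem_iUnion]
    exact ⟨_, AlignedHull.deg_le (fun mu hmu => hN ⟨mu, hmu, rfl⟩) h, h, rfl⟩
  refine ⟨hfin.toFinset, fun lam h => by simpa using .base lam h, ?_⟩
  intro lam hl mu hm nu hn hd hs al be h
  simp only [Set.Finite.coe_toFinset, Set.mem_ofPred_eq] at *
  exact .step lam mu nu al be hl hm hn hd hs h

end KGraph

end HigherRank

/-! ### Maximal filters of paths, boundary paths and Condition (B) -/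

namespace HigherRank

open HigherRank.Path

variable {k : ℕ} {Λ : Type u} [Category.{v} Λ]

/-- A maximal filter of paths with range `a`, for the order by initial segments. -/
structure IsUltra (a : Λ) (U : Set (Path Λ)) : Prop where
  tgt : ∀ lam ∈ U, lam.tgt = a
  vertex_mem : vertex a ∈ U
  lower : ∀ lam mu, lam ≤ mu → mu ∈ U → lam ∈ U
  directed : ∀ lam ∈ U, ∀ mu ∈ U, ∃ nu ∈ U, lam ≤ nu ∧ mu ≤ nu
  decide : ∀ rho, rho.tgt = a → rho ∉ U → ∃ lam ∈ U, ¬ Meets lam rho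

namespace IsUltra

variable {a : Λ} {U : Set (Path Λ)}

theorem meets (hU : IsUltra a U) {lam mu : Path Λ} (h : lam ∈ U) (h' : mu ∈ U) :
    Meets lam mu :=
  let ⟨nu, _, h1, h2⟩ := hU.directed lam h mu h'
  ⟨nu, h1, h2⟩

theorem mem_of_meets (hU : IsUltra a U) {rho : Path Λ} (hr : rho.tgt = a)
    (h : ∀ lam ∈ U, Meets lam rho) : rho ∈ U := by
  by_contra h'
  obtain ⟨lam, h1, h2⟩ := hU.decide rho hr h'
  exact h2 (h lam h1)

/-- Directedness merges finitely many properties that hold eventually along `U` into one common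
stage. -/
theorem exists_forall_of_finite (hU : IsUltra a U) {ι : Type*} {s : Set ι} (hs : s.Finite)
    (P : ι → Path Λ → Prop)
    (h : ∀ i ∈ s, ∃ ka ∈ U, ∀ ka' ∈ U, ka ≤ ka' → P i ka') :
    ∃ ka ∈ U, ∀ i ∈ s, ∀ ka' ∈ U, ka ≤ ka' → P i ka' := by
  induction s, hs using Set.Finite.induction_on with
  | empty => exact ⟨_, hU.vertex_mem, by simp⟩
  | @insert i s _ _ ih =>
    obtain ⟨ka, h1, h2⟩ := ih fun i hi => h i (Set.mem_insert_of_mem _ hi)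
    obtain ⟨mu, h3, h4⟩ := h i (Set.mem_insert _ _)
    obtain ⟨nu, h5, h6, h7⟩ := hU.directed ka h1 mu h3
    refine ⟨nu, h5, ?_⟩
    rintro j (rfl | hj) ka' hka hle
    · exact h4 ka' hka (h7.trans hle)
    · exact h2 j hj ka' hka (h6.trans hle)

theorem exists_not_meets_of_finite (hU : IsUltra a U) {s : Set (Path Λ)} (hs : s.Finite)
    (h : ∀ al ∈ s, al.tgt = a ∧ al ∉ U) : ∃ ka ∈ U, ∀ al ∈ s, ¬ Meets ka al := by
  obtain ⟨ka, h1, h2⟩ := hU.exists_forall_of_finite hs (fun al ka => ¬ Meets ka al)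
    fun al hal => by
      obtain ⟨mu, h3, h4⟩ := hU.decide al (h al hal).1 (h al hal).2
      exact ⟨mu, h3, fun ka' _ hle hm => h4 (hm.mono hle le_rfl)⟩
  exact ⟨ka, h1, fun al hal => h2 al hal ka h1 le_rfl⟩

/-- Every finite exhaustive set contains an element of a given maximal filter. -/
theorem exists_mem_of_exhaustive (G : KGraph k Λ) (hU : IsUltra a U) {E : Set (Path Λ)}
    (hE : E.Finite) (h : G.Exhaustive a E) : ∃ lam ∈ E, lam ∈ U := by
  by_contra! hc
  obtain ⟨ka, h1, h2⟩ := hU.exists_not_meets_of_finite hE fun al hal => ⟨h.1 al hal, hc al hal⟩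
  obtain ⟨lam, h3, h4⟩ := h.2 ka (hU.tgt ka h1)
  exact h2 lam h3 (G.minExt_nonempty_iff.1 h4).symm

end IsUltra

/-- The initial segments of the paths `lam * mu`, `mu ∈ U`. -/
def prependSet (lam : Path Λ) (U : Set (Path Λ)) : Set (Path Λ) :=
  {nu | ∃ mu ∈ U, nu ≤ lam * mu}

/-- The paths `mu` with `lam * mu ∈ U`. -/
def shiftSet (lam : Path Λ) (U : Set (Path Λ)) : Set (Path Λ) :=
  {mu | lam.src = mu.tgt ∧ lam * mu ∈ U}

namespace IsUltra

variable {a : Λ} {U : Set (Path Λ)}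

theorem mul_mem_prependSet {lam mu : Path Λ} (h : mu ∈ U) : lam * mu ∈ prependSet lam U :=
  ⟨mu, h, le_rfl⟩

theorem prepend {G : KGraph k Λ} (hfa : G.FinitelyAligned) (hU : IsUltra a U) {lam : Path Λ}
    (h : lam.src = a) : IsUltra lam.tgt (prependSet lam U) where
  tgt := by
    rintro nu ⟨mu, -, h2⟩
    rw [tgt_eq_of_le h2, tgt_mul]
  vertex_mem := ⟨_, hU.vertex_mem, vertex_le (tgt_mul _ _)⟩
  lower := by
    rintro nu nu' h1 ⟨mu, h2, h3⟩
    exact ⟨mu, h2, h1.trans h3⟩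
  directed := by
    rintro nu ⟨mu, h1, h2⟩ nu' ⟨mu', h1', h2'⟩
    obtain ⟨ka, h3, h4, h5⟩ := hU.directed mu h1 mu' h1'
    exact ⟨lam * ka, mul_mem_prependSet h3,
      h2.trans (mul_le_mul_left_of_src (by rw [h, hU.tgt mu h1]) h4),
      h2'.trans (mul_le_mul_left_of_src (by rw [h, hU.tgt mu' h1']) h5)⟩
  decide := by
    intro rho hr hn
    -- If `lam * ka` meets `rho`, then `ka` meets the first entry of a minimal common extension of
    -- `lam` and `rho`. By finite alignment there are finitely many such entries; none lies in `U`,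
    -- so a single `ka` misses them all.
    obtain ⟨ka, h1, h2⟩ := hU.exists_not_meets_of_finite ((hfa lam rho).image Prod.fst) <| by
      rintro _ ⟨⟨al, be⟩, hp, rfl⟩
      obtain ⟨h1, h2, h3, -⟩ := G.mem_minExt.1 hp
      dsimp only at h1 h2 h3 ⊢
      exact ⟨by rw [← h1, h], fun hal => hn ⟨al, hal, h3 ▸ le_mul h2⟩⟩
    refine ⟨lam * ka, mul_mem_prependSet h1, ?_⟩
    have hka : lam.src = ka.tgt := by rw [h, hU.tgt ka h1]
    rintro ⟨nu, h3, h4⟩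
    obtain ⟨al, be, h5, h6⟩ := G.exists_minExt_le ((le_mul hka).trans h3) h4
    exact h2 al ⟨_, h5, rfl⟩ (G.meets_of_mul hka (G.mem_minExt.1 h5).1 ⟨nu, h3, h6⟩)

theorem shift (G : KGraph k Λ) (hU : IsUltra a U) {lam : Path Λ} (h : lam ∈ U) :
    IsUltra lam.src (shiftSet lam U) where
  tgt := fun mu hmu => hmu.1.symm
  vertex_mem := ⟨rfl, by rwa [mul_vertex rfl]⟩
  lower := by
    rintro mu nu h1 ⟨h2, h3⟩
    have h4 : lam.src = mu.tgt := h2.trans (tgt_eq_of_le h1).symm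
    exact ⟨h4, hU.lower _ _ (mul_le_mul_left_of_src h4 h1) h3⟩
  directed := by
    rintro mu ⟨h1, h2⟩ mu' ⟨h1', h2'⟩
    obtain ⟨nu, h3, h4, h5⟩ := hU.directed _ h2 _ h2'
    obtain ⟨ka, h6, rfl⟩ := (le_mul h1).trans h4
    exact ⟨ka, ⟨h6, h3⟩, G.le_of_mul_le_mul h1 h6 h4, G.le_of_mul_le_mul h1' h6 h5⟩
  decide := by
    intro rho hr hn
    have hr' : lam.src = rho.tgt := hr.symm
    obtain ⟨nu, h1, h2⟩ := hU.decide (lam * rho) (by rw [tgt_mul, hU.tgt lam h])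
      (fun h' => hn ⟨hr', h'⟩)
    obtain ⟨ka, h3, h4, h5⟩ := hU.directed _ h _ h1
    obtain ⟨mu, h6, rfl⟩ := h4
    refine ⟨mu, ⟨h6, h3⟩, fun ⟨ta, h7, h8⟩ => h2 ?_⟩
    have h9 : lam.src = ta.tgt := h6.trans (tgt_eq_of_le h7)
    exact ⟨lam * ta, h5.trans (mul_le_mul_left_of_src h6 h7), mul_le_mul_left_of_src hr' h8⟩

end IsUltra

namespace KGraph.GraphPath

variable {G : KGraph k Λ}

/-- The initial segment `x(0, n)`. -/
abbrev init (x : G.GraphPath) (n : Omega k x.degree) : Path Λ := x.seg x.zero n (x.zero_le n)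

/-- The initial segments `x(0, n)` of `x`. -/
def initials (x : G.GraphPath) : Set (Path Λ) := Set.range x.init

theorem deg_seg (x : G.GraphPath) {p q : Omega k x.degree} (h : p ≤ q) :
    G.deg (x.seg p q h) = q.1 - p.1 := x.deg_map p q h

theorem deg_init (x : G.GraphPath) (n : Omega k x.degree) :
    G.deg (x.init n) = n.1 := by
  rw [deg_seg]; exact tsub_zero _

theorem init_eq_mul (x : G.GraphPath) {m n : Omega k x.degree} (h : m ≤ n) :
    x.init n = x.init m * x.seg m n h := by
  exact (x.seg_trans _ m n (x.zero_le m) h).trans (comp_eq_mul rfl)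

theorem init_mono (x : G.GraphPath) {m n : Omega k x.degree} (h : m ≤ n) :
    x.init m ≤ x.init n :=
  ⟨x.seg m n h, rfl, x.init_eq_mul h⟩

theorem mem_initials_of_le (x : G.GraphPath) {lam mu : Path Λ} (h : lam ≤ mu)
    (hm : mu ∈ x.initials) : lam ∈ x.initials := by
  obtain ⟨n, rfl⟩ := hm
  have hd : G.deg lam ≤ n.1 := x.deg_init n ▸ G.deg_le_of_le h
  let m : Omega k x.degree := ⟨G.deg lam, fun i => (Nat.cast_le.2 (hd i)).trans (n.2 i)⟩
  exact ⟨m, G.eq_of_le_of_le_of_deg_eq (x.init_mono (show m ≤ n from hd)) h (x.deg_init m)⟩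

theorem degree_le_of_mem_initials (x : G.GraphPath) {lam : Path Λ} (h : lam ∈ x.initials) (i) :
    (G.deg lam i : ℕ∞) ≤ x.degree i := by
  obtain ⟨n, rfl⟩ := h
  rw [x.deg_init n]
  exact n.2 i

/-- The degree is recovered coordinatewise from the degrees of the initial segments, and x(p, q) by
cancelling x(0, p) from x(0, q). -/
theorem ext_initials {x y : G.GraphPath} (h : x.initials = y.initials) : x = y := by
  have key : ∀ {x y : G.GraphPath}, x.initials ⊆ y.initials → ∀ i, x.degree i ≤ y.degree i := by
    intro x y h i
    refine ENat.forall_natCast_le_iff_le.1 fun n hn => ?_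
    let m : Omega k x.degree := ⟨Pi.single i n, fun j => by
      rcases eq_or_ne j i with rfl | hj
      · simpa using hn
      · simp [hj]⟩
    have := y.degree_le_of_mem_initials (h ⟨m, rfl⟩) i
    rw [x.deg_init m] at this
    simpa [m] using this
  have hdeg : x.degree = y.degree :=
    funext fun i => le_antisymm (key h.le i) (key h.ge i)
  obtain ⟨m, F, hF⟩ := x
  obtain ⟨m', F', hF'⟩ := y
  obtain rfl : m = m' := hdeg
  refine ext_seg fun p q hpq => ?_
  have h1 : ∀ n : Omega k m, (⟨m, F, hF⟩ : G.GraphPath).init n =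
      (⟨m, F', hF'⟩ : G.GraphPath).init n := fun n => by
    have h2 : (⟨m, F, hF⟩ : G.GraphPath).init n ∈
      (⟨m, F', hF'⟩ : G.GraphPath).initials := h ▸ ⟨n, rfl⟩
    obtain ⟨n', h3⟩ := h2
    have h4 := congrArg G.deg h3
    rw [deg_init, deg_init] at h4
    obtain rfl : n' = n := Subtype.ext h4
    exact h3.symm
  have e1 := init_eq_mul (⟨m, F, hF⟩ : G.GraphPath) hpq
  have e2 := init_eq_mul (⟨m, F', hF'⟩ : G.GraphPath) hpq
  exact (G.mul_inj rfl rfl (e1.symm.trans ((h1 q).trans e2)) (by rw [h1 p])).2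

/-- Maximality comes from the boundary condition: a path that meets arbitrarily long x(0, n) without
being an initial segment of x would need an edge in a direction in which x has ended. -/
theorem IsBoundary.isUltra {x : G.GraphPath} (hx : x.IsBoundary) :
    IsUltra x.range x.initials where
  tgt := by rintro _ ⟨n, rfl⟩; rfl
  vertex_mem := by
    refine ⟨x.zero, ?_⟩
    exact G.eq_vertex_of_deg_eq_zero (x.deg_init x.zero)
  lower := fun lam mu h hm => x.mem_initials_of_le h hm
  directed := by
    rintro _ ⟨m, rfl⟩ _ ⟨n, rfl⟩
    let p : Omega k x.degree := ⟨m.1 ⊔ n.1, fun i => by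
      rcases le_total (m.1 i) (n.1 i) with h | h
      · simpa [h] using n.2 i
      · simpa [h] using m.2 i⟩
    exact ⟨_, ⟨p, rfl⟩, x.init_mono (show m ≤ p from le_sup_left (a := m.1)),
      x.init_mono (show n ≤ p from le_sup_right (a := m.1))⟩
  decide := by
    obtain ⟨nx, hnx⟩ := hx
    intro rho hr hn
    -- `N` lies beyond `nx` and, in each coordinate, reaches as far as d(rho) or the degree of x
    -- permits. Hence `N i < G.deg rho i` forces `N i` to equal the degree of x in direction i.
    let N : Omega k x.degree := ⟨fun i => nx.1 i ⊔ (min (G.deg rho i : ℕ∞) (x.degree i)).toNat,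
      fun i => by
        have h1 : ((min (G.deg rho i : ℕ∞) (x.degree i)).toNat : ℕ∞) ≤ x.degree i :=
          (ENat.natCast_toNat_le_self _).trans (min_le_right _ _)
        dsimp only
        rcases le_total (nx.1 i) (min (G.deg rho i : ℕ∞) (x.degree i)).toNat with h | h
        · rw [sup_eq_right.2 h]; exact h1
        · rw [sup_eq_left.2 h]; exact nx.2 i⟩
    refine ⟨_, ⟨N, rfl⟩, fun hm => ?_⟩
    obtain ⟨⟨al, be⟩, hp⟩ := G.minExt_nonempty_iff.2 hm
    obtain ⟨h1, h2, h3, h4⟩ := G.mem_minExt.1 hp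
    dsimp only at h1 h2 h3 h4
    by_cases h0 : G.deg al = 0
    · rw [G.mul_eq_left_of_deg_eq_zero h1 h0] at h3
      exact hn (x.mem_initials_of_le ⟨be, h2, h3⟩ ⟨N, rfl⟩)
    obtain ⟨i, hi⟩ : ∃ i, G.deg al i ≠ 0 := by
      by_contra! hc
      exact h0 (funext hc)
    rw [G.deg_mul h1, x.deg_init N] at h4
    have h5 := congrFun h4 i
    simp only [Pi.add_apply, Pi.sup_apply] at h5
    have h6 : N.1 i < G.deg rho i := by omega
    have h7 : (N.1 i : ℕ∞) = x.degree i := by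
      refine le_antisymm (N.2 i) ?_
      have h8 : (min (G.deg rho i : ℕ∞) (x.degree i)).toNat ≤ N.1 i := le_sup_right
      rcases le_total (G.deg rho i : ℕ∞) (x.degree i) with h | h
      · rw [min_eq_left h, ENat.toNat_natCast] at h8
        omega
      · rw [min_eq_right h] at h8
        have h9 : x.degree i ≠ ⊤ := ne_top_of_le_ne_top (ENat.natCast_ne_top _) h
        rw [← ENat.natCast_toNat h9]
        exact_mod_cast h8
    obtain ⟨mu, h10, h11⟩ := G.exists_le_deg_eq (nu := al) (n := Pi.single i 1) fun j => by
      rcases eq_or_ne j i with rfl | hj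
      · simp; omega
      · simp [hj]
    exact hnx N (fun j => le_sup_left) i h7 ⟨mu, (tgt_eq_of_le h10).trans h1.symm, h11⟩

theorem initials_prepend {lam : Path Λ} {x : G.GraphPath} (h : lam.src = x.range) :
    (GraphPath.prepend lam x h).initials = prependSet lam x.initials := by
  set y := GraphPath.prepend lam x h
  obtain ⟨hd, ⟨h0, hlam⟩, hseg⟩ := prepend_spec lam x h
  have key : ∀ (l : Omega k x.degree) (h' : ∀ i, ((G.deg lam + l.1) i : ℕ∞) ≤ y.degree i),
      y.init ⟨G.deg lam + l.1, h'⟩ =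
        lam * x.init l := fun l h' => by
    have := y.init_eq_mul (m := ⟨G.deg lam, h0⟩) (n := ⟨G.deg lam + l.1, h'⟩)
      (fun _ => Nat.le_add_right _ _)
    rw [this, hseg l.1 l.2 h0 h']
    exact congrArg (· * _) hlam
  have hdl : ∀ (l : Omega k x.degree), ∀ i, ((G.deg lam + l.1) i : ℕ∞) ≤ y.degree i :=
    fun l i => by
      rw [hd i, Pi.add_apply, Nat.cast_add, add_comm]
      exact add_le_add (l.2 i) le_rfl
  ext nu
  constructor
  · rintro ⟨n, rfl⟩
    let l : Omega k x.degree := ⟨n.1 - G.deg lam, fun i => by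
      have := n.2 i
      rw [hd i] at this
      rw [Pi.sub_apply, ENat.natCast_sub]
      exact tsub_le_iff_right.2 this⟩
    refine ⟨_, ⟨l, rfl⟩, ?_⟩
    rw [← key l (hdl l)]
    refine y.init_mono fun i => ?_
    change n.1 i ≤ G.deg lam i + (n.1 i - G.deg lam i)
    omega
  · rintro ⟨_, ⟨l, rfl⟩, hle⟩
    refine y.mem_initials_of_le hle ⟨⟨_, hdl l⟩, key l (hdl l)⟩

end KGraph.GraphPath

/-- The form in which Condition (B) is used. -/
theorem KGraph.ConditionB.exists_isUltra {G : KGraph k Λ} (hfa : G.FinitelyAligned)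
    (hB : G.ConditionB) (a : Λ) :
    ∃ U, IsUltra a U ∧ ∀ al be : Path Λ, al.src = a → be.src = a → al ≠ be →
      ∃ ka ∈ U, ¬ Meets (al * ka) (be * ka) := by
  obtain ⟨x, rfl, hx, hsep⟩ := hB a
  refine ⟨_, hx.isUltra, fun al be hal hbe hne => ?_⟩
  by_contra! hc
  refine hsep al be hal hbe hne (KGraph.GraphPath.ext_initials ?_)
  have hU := hx.isUltra
  -- If `al * ka` and `be * ka` meet for every `ka`, then each initial segment of `al x` meets all
  -- those of `be x`, so it belongs to that filter by maximality. By symmetry `al x = be x`.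
  have key : ∀ {al be : Path Λ}, al.src = x.range → be.src = x.range →
      (∀ ka ∈ x.initials, Meets (al * ka) (be * ka)) →
      prependSet al x.initials ⊆ prependSet be x.initials := by
    rintro al be hal hbe hm rho ⟨mu, h1, h2⟩
    have ht : be.tgt = al.tgt := by
      have := (hm _ hU.vertex_mem).tgt_eq
      rw [tgt_mul, tgt_mul] at this
      exact this.symm
    refine (hU.prepend hfa hbe).mem_of_meets (by rw [tgt_eq_of_le h2, tgt_mul, ht]) ?_
    rintro nu ⟨mu', h3, h4⟩
    obtain ⟨ka, h5, h6, h7⟩ := hU.directed mu h1 mu' h3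
    refine (hm ka h5).symm.mono (h4.trans ?_) (h2.trans ?_)
    · exact mul_le_mul_left_of_src (by rw [hbe, hU.tgt _ h3]) h7
    · exact mul_le_mul_left_of_src (by rw [hal, hU.tgt _ h1]) h6
  rw [KGraph.GraphPath.initials_prepend, KGraph.GraphPath.initials_prepend]
  exact (key hal hbe hc).antisymm (key hbe hal fun ka h => (hc ka h).symm)

end HigherRank

/-! ### Gap products and the calculus of Cuntz–Krieger families -/

namespace HigherRank

open HigherRank.Path

section GapProduct

variable {R ι : Type*} [NonUnitalRing R]

/-- The product of the differences `e - p i` over a list, with last factor `e`. -/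
def gapProd (e : R) (p : ι → R) (l : List ι) : R := l.foldr (fun i z => (e - p i) * z) e

theorem gapProd_cons (e : R) (p : ι → R) (i : ι) (l : List ι) :
    gapProd e p (i :: l) = (e - p i) * gapProd e p l := rfl

theorem gapProd_commute {e z : R} {p : ι → R} {l : List ι} (he : Commute z e)
    (hp : ∀ i ∈ l, Commute z (p i)) : Commute z (gapProd e p l) := by
  induction l with
  | nil => exact he
  | cons i l ih =>
    rw [gapProd_cons]
    exact (he.sub_right (hp i (by simp))).mul_right (ih fun j hj => hp j (by simp [hj]))

variable {e : R} {p : ι → R} {l : List ι}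

theorem gapProd_mul_unit (he : e * e = e) : gapProd e p l * e = gapProd e p l := by
  induction l with
  | nil => exact he
  | cons i l ih => rw [gapProd_cons, mul_assoc, ih]

theorem mul_gapProd_eq_self {z : R} (hz : z * e = z) (h : ∀ i ∈ l, z * p i = 0) :
    z * gapProd e p l = z := by
  induction l with
  | nil => exact hz
  | cons i l ih =>
    rw [gapProd_cons, ← mul_assoc, mul_sub, hz, h i (by simp), sub_zero,
      ih fun j hj => h j (by simp [hj])]

section

variable (he : e * e = e) (hep : ∀ i ∈ l, e * p i = p i) (hpe : ∀ i ∈ l, p i * e = p i)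
  (hpp : ∀ i ∈ l, p i * p i = p i) (hc : ∀ i ∈ l, ∀ j ∈ l, Commute (p i) (p j))
include hep hpe hc

theorem gapProd_commute_factor {i : ι} (hi : i ∈ l) : Commute (p i) (gapProd e p l) :=
  gapProd_commute (by rw [commute_iff_eq, hep i hi, hpe i hi]) fun j hj => hc i hi j hj

include hpp in
theorem gapProd_mul_factor {i : ι} (hi : i ∈ l) : gapProd e p l * p i = 0 := by
  rw [← (gapProd_commute_factor hep hpe hc hi).eq]
  induction l with
  | nil => simp at hi
  | cons j l ih =>
    rcases List.mem_cons.1 hi with rfl | hi'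
    · rw [gapProd_cons, ← mul_assoc, mul_sub, hpe i hi, hpp i hi, sub_self, zero_mul]
    · have h1 : Commute (p i) (e - p j) :=
        Commute.sub_right (by rw [commute_iff_eq, hep i hi, hpe i hi]) (hc i hi j (by simp))
      rw [gapProd_cons, ← mul_assoc, h1.eq, mul_assoc, ih, mul_zero]
      all_goals first | assumption | skip
      all_goals intros
      · exact hep _ (by simp_all)
      · exact hpe _ (by simp_all)
      · exact hpp _ (by simp_all)
      · exact hc _ (by simp_all) _ (by simp_all)

end

theorem star_gapProd [StarRing R] (hse : star e = e)
    (hep : ∀ i ∈ l, e * p i = p i) (hs : ∀ i ∈ l, star (p i) = p i)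
    (hc : ∀ i ∈ l, ∀ j ∈ l, Commute (p i) (p j)) : star (gapProd e p l) = gapProd e p l := by
  have hpe : ∀ i ∈ l, p i * e = p i := fun i hi => by
    have := congrArg star (hep i hi)
    rwa [star_mul, hse, hs i hi] at this
  induction l with
  | nil => exact hse
  | cons i l ih =>
    have h1 : Commute (e - p i) (gapProd e p l) := by
      refine gapProd_commute ?_ fun j hj => ?_
      · exact (Commute.refl e).sub_left (by
          rw [commute_iff_eq, hep i (by simp), hpe i (by simp)])
      · refine Commute.sub_left ?_ (hc i (by simp) j (by simp [hj]))
        rw [commute_iff_eq, hep j (by simp [hj]), hpe j (by simp [hj])]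
    rw [gapProd_cons, star_mul, star_sub, hse, hs i (by simp), ih, h1.eq]
    · exact fun j hj => hep j (by simp [hj])
    · exact fun j hj => hs j (by simp [hj])
    · exact fun j hj j' hj' => hc j (by simp [hj]) j' (by simp [hj'])
    · exact fun j hj => hpe j (by simp [hj])

end GapProduct

namespace KGraph.IsCuntzKriegerFamily

variable {k : ℕ} {Λ : Type u} [Category.{v} Λ] {G : KGraph k Λ} {hfa : G.FinitelyAligned}
  {A : Type w} [NonUnitalCStarAlgebra A] {t : Path Λ → A}

theorem star_vertex (ht : G.IsCuntzKriegerFamily hfa t) (a : Λ) :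
    star (t (vertex a)) = t (vertex a) := (ht.projection a).isSelfAdjoint

theorem vertex_mul_vertex (ht : G.IsCuntzKriegerFamily hfa t) (a : Λ) :
    t (vertex a) * t (vertex a) = t (vertex a) := (ht.projection a).isIdempotentElem

theorem mul_eq_mul (ht : G.IsCuntzKriegerFamily hfa t) {lam mu : Path Λ}
    (h : lam.src = mu.tgt) : t lam * t mu = t (lam * mu) := by
  rw [ht.mul_eq lam mu h, comp_eq_mul]

theorem mul_vertex (ht : G.IsCuntzKriegerFamily hfa t) {lam : Path Λ} {a : Λ}
    (h : lam.src = a) : t lam * t (vertex a) = t lam := by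
  rw [ht.mul_eq_mul (by exact h), Path.mul_vertex h]

theorem vertex_mul (ht : G.IsCuntzKriegerFamily hfa t) {lam : Path Λ} {a : Λ}
    (h : lam.tgt = a) : t (vertex a) * t lam = t lam := by
  rw [ht.mul_eq_mul (by exact h.symm), Path.vertex_mul h]

theorem star_mul_vertex (ht : G.IsCuntzKriegerFamily hfa t) {lam : Path Λ} {a : Λ}
    (h : lam.tgt = a) : star (t lam) * t (vertex a) = star (t lam) := by
  rw [← ht.star_vertex, ← star_mul, ht.vertex_mul h]

theorem vertex_mul_star (ht : G.IsCuntzKriegerFamily hfa t) {lam : Path Λ} {a : Λ}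
    (h : lam.src = a) : t (vertex a) * star (t lam) = star (t lam) := by
  rw [← ht.star_vertex, ← star_mul, ht.mul_vertex h]

theorem mul_eq_zero (ht : G.IsCuntzKriegerFamily hfa t) {lam mu : Path Λ}
    (h : lam.src ≠ mu.tgt) : t lam * t mu = 0 := by
  rw [← ht.mul_vertex (lam := lam) rfl, ← ht.vertex_mul (lam := mu) rfl, mul_assoc,
    ← mul_assoc (t (vertex _)), ht.orthogonal _ _ h, zero_mul, mul_zero]

theorem mul_star_eq_zero (ht : G.IsCuntzKriegerFamily hfa t) {lam mu : Path Λ}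
    (h : lam.src ≠ mu.src) : t lam * star (t mu) = 0 := by
  rw [← ht.mul_vertex (lam := lam) rfl, ← ht.vertex_mul_star (lam := mu) rfl, mul_assoc,
    ← mul_assoc (t (vertex _)), ht.orthogonal _ _ h, zero_mul, mul_zero]

theorem star_mul_eq_zero (ht : G.IsCuntzKriegerFamily hfa t) {lam mu : Path Λ}
    (h : ¬ Meets lam mu) : star (t lam) * t mu = 0 := by
  rw [ht.star_mul_eq, Finset.sum_eq_zero]
  intro p hp
  exact absurd (G.minExt_nonempty_iff.1 ⟨p, by simpa using hp⟩) h

/-- The only minimal common extension of `lam` with itself is the pair of vertices at s(lam). -/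
theorem star_mul_self (ht : G.IsCuntzKriegerFamily hfa t) (lam : Path Λ) :
    star (t lam) * t lam = t (vertex lam.src) := by
  have h : (hfa lam lam).toFinset = {(vertex lam.src, vertex lam.src)} := by
    ext ⟨al, be⟩
    rw [Set.Finite.mem_toFinset, Finset.mem_singleton, mem_minExt]
    dsimp only
    constructor
    · rintro ⟨h1, h2, h3, h4⟩
      have h5 : G.deg al = 0 := by
        rw [G.deg_mul h1, sup_idem] at h4
        exact add_eq_left.1 h4
      have h6 := G.mul_left_inj h1 h2 h3
      rw [← h6, G.eq_vertex_of_deg_eq_zero h5, h1]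
    · rintro h
      obtain ⟨rfl, rfl⟩ := Prod.mk.inj h
      refine ⟨rfl, rfl, rfl, ?_⟩
      rw [Path.mul_vertex rfl, sup_idem]
  rw [ht.star_mul_eq, h, Finset.sum_singleton, ht.star_vertex, ht.vertex_mul_vertex]

theorem star_mul_mul (ht : G.IsCuntzKriegerFamily hfa t) {lam mu : Path Λ}
    (h : lam.src = mu.tgt) : star (t lam) * t (lam * mu) = t mu := by
  rw [← ht.mul_eq_mul h, ← mul_assoc, ht.star_mul_self, ht.vertex_mul h.symm]

theorem star_mul_mul_self (ht : G.IsCuntzKriegerFamily hfa t) {lam mu : Path Λ}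
    (h : lam.src = mu.tgt) : star (t (lam * mu)) * t lam = star (t mu) := by
  rw [← ht.star_mul_mul h, star_mul, star_star]

theorem star_mul_eq_zero_of_deg_eq (ht : G.IsCuntzKriegerFamily hfa t) {lam mu : Path Λ}
    (hd : G.deg lam = G.deg mu) (h : lam ≠ mu) : star (t lam) * t mu = 0 :=
  ht.star_mul_eq_zero fun ⟨_, h1, h2⟩ => h (G.eq_of_le_of_le_of_deg_eq h1 h2 hd)

theorem proj_mul_of_le (ht : G.IsCuntzKriegerFamily hfa t) {lam nu : Path Λ} (h : lam ≤ nu) :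
    t lam * star (t lam) * t nu = t nu := by
  obtain ⟨al, h1, rfl⟩ := h
  rw [mul_assoc, ht.star_mul_mul h1, ht.mul_eq_mul h1]

theorem star_proj (t : Path Λ → A) (lam : Path Λ) :
    star (t lam * star (t lam)) = t lam * star (t lam) := by
  rw [star_mul, star_star]

theorem star_mul_proj_of_le (ht : G.IsCuntzKriegerFamily hfa t) {lam nu : Path Λ}
    (h : lam ≤ nu) : star (t nu) * (t lam * star (t lam)) = star (t nu) := by
  have := congrArg star (ht.proj_mul_of_le h)
  rwa [star_mul, star_proj] at this

theorem proj_mul_proj (ht : G.IsCuntzKriegerFamily hfa t) (lam : Path Λ) :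
    t lam * star (t lam) * (t lam * star (t lam)) = t lam * star (t lam) := by
  rw [← mul_assoc, ht.proj_mul_of_le le_rfl]

/-- The product is a sum of range projections over the minimal common extensions, hence
self-adjoint; a self-adjoint product of self-adjoint elements commutes. -/
theorem proj_commute (ht : G.IsCuntzKriegerFamily hfa t) (lam mu : Path Λ) :
    Commute (t lam * star (t lam)) (t mu * star (t mu)) := by
  have h : t lam * star (t lam) * (t mu * star (t mu)) =
      ∑ p ∈ (hfa lam mu).toFinset, t (lam * p.1) * star (t (lam * p.1)) := by
    rw [mul_assoc, ← mul_assoc (star (t lam)), ht.star_mul_eq, Finset.sum_mul, Finset.mul_sum]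
    refine Finset.sum_congr rfl fun p hp => ?_
    obtain ⟨h1, h2, h3, -⟩ := G.mem_minExt.1 ((hfa lam mu).mem_toFinset.1 hp)
    rw [mul_assoc, ← star_mul, ht.mul_eq_mul h2, ← mul_assoc, ht.mul_eq_mul h1, h3]
  have h' := congrArg star h
  rw [star_mul, star_proj, star_proj, star_sum] at h'
  rw [commute_iff_eq, h', h]
  exact Finset.sum_congr rfl fun p _ => (star_proj t _).symm

open Classical in
/-- The product of `t_a - t_lam t_lam*` over a finite set of paths with range `a`. -/
noncomputable def gapSet (t : Path Λ → A) (a : Λ) (S : Set (Path Λ)) : A :=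
  if h : S.Finite then gapProd (t (vertex a)) (fun lam => t lam * star (t lam)) h.toFinset.toList
  else 0

section gapSet

variable {a : Λ} {S : Set (Path Λ)}

theorem gapSet_eq (t : Path Λ → A) (a : Λ) (hS : S.Finite) : gapSet t a S =
    gapProd (t (vertex a)) (fun lam => t lam * star (t lam)) hS.toFinset.toList := dif_pos hS

theorem gapSet_mul_vertex (ht : G.IsCuntzKriegerFamily hfa t) (hS : S.Finite) :
    gapSet t a S * t (vertex a) = gapSet t a S := by
  rw [gapSet_eq t a hS]
  exact gapProd_mul_unit (ht.vertex_mul_vertex a)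

theorem mul_gapSet_eq_self (hS : S.Finite) {z : A} (hz : z * t (vertex a) = z)
    (h : ∀ al ∈ S, z * t al = 0) : z * gapSet t a S = z := by
  rw [gapSet_eq t a hS]
  refine mul_gapProd_eq_self hz fun al hal => ?_
  rw [← mul_assoc, h al (by simpa using hal), zero_mul]

theorem gapSet_mul_of_mem (ht : G.IsCuntzKriegerFamily hfa t) (hS : S.Finite)
    (hr : ∀ al ∈ S, al.tgt = a) {al : Path Λ} (hal : al ∈ S) : gapSet t a S * t al = 0 := by
  rw [gapSet_eq t a hS, ← ht.proj_mul_of_le (le_refl al), ← mul_assoc]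
  rw [gapProd_mul_factor (p := fun lam => t lam * star (t lam)) (i := al), zero_mul]
  · intro i hi
    rw [← mul_assoc, ht.vertex_mul (hr i (by simpa using hi))]
  · intro i hi
    rw [mul_assoc, ht.star_mul_vertex (hr i (by simpa using hi))]
  · exact fun i _ => ht.proj_mul_proj i
  · exact fun i _ j _ => ht.proj_commute i j
  · simpa using hal

theorem star_gapSet (ht : G.IsCuntzKriegerFamily hfa t) (hS : S.Finite)
    (hr : ∀ al ∈ S, al.tgt = a) : star (gapSet t a S) = gapSet t a S := by
  rw [gapSet_eq t a hS]
  refine star_gapProd (ht.star_vertex a) ?_ (fun i _ => star_proj t i)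
    (fun i _ j _ => ht.proj_commute i j)
  intro i hi
  rw [← mul_assoc, ht.vertex_mul (hr i (by simpa using hi))]

theorem gapSet_mul_self (ht : G.IsCuntzKriegerFamily hfa t) (hS : S.Finite)
    (hr : ∀ al ∈ S, al.tgt = a) : gapSet t a S * gapSet t a S = gapSet t a S :=
  mul_gapSet_eq_self hS (ht.gapSet_mul_vertex hS) fun _ h => ht.gapSet_mul_of_mem hS hr h

theorem gapSet_eq_zero (ht : G.IsCuntzKriegerFamily hfa t) (hS : S.Finite)
    (h : G.Exhaustive a S) : gapSet t a S = 0 := by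
  rw [gapSet_eq t a hS]
  refine ht.gap a _ (Finset.nodup_toList _) ?_
  simpa using h

end gapSet

end KGraph.IsCuntzKriegerFamily

end HigherRank

/-! ### Matrix units of a finite aligned set -/

namespace HigherRank

open HigherRank.Path

namespace Path

variable {Λ : Type u} [Category.{v} Λ]

/-- `(lam, mu)` arises from `(rho, tau)` by appending a common path. -/
def Linked (rho tau lam mu : Path Λ) : Prop :=
  ∃ al, rho.src = al.tgt ∧ tau.src = al.tgt ∧ lam = rho * al ∧ mu = tau * al

end Path

namespace KGraph

variable {k : ℕ} {Λ : Type u} [Category.{v} Λ] (G : KGraph k Λ)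

/-- The paths of nonzero degree which extend `lam` to an element of `F`. -/
def tails (F : Finset (Path Λ)) (lam : Path Λ) : Set (Path Λ) :=
  {al | lam.src = al.tgt ∧ G.deg al ≠ 0 ∧ lam * al ∈ F}

variable {G} {F : Finset (Path Λ)}

theorem finite_tails (F : Finset (Path Λ)) (lam : Path Λ) : (G.tails F lam).Finite :=
  Set.Finite.of_injOn (f := fun al => lam * al) (fun _ h => h.2.2)
    (fun _ h _ h' e => G.mul_left_inj h.1 h'.1 e) F.finite_toSet

theorem tgt_of_mem_tails {lam al : Path Λ} (h : al ∈ G.tails F lam) : al.tgt = lam.src := h.1.symm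

theorem IsAligned.mul_mem (hF : G.IsAligned (F : Set (Path Λ))) {lam mu al : Path Λ}
    (hl : lam ∈ F) (hm : mu ∈ F) (hd : G.deg lam = G.deg mu) (hs : lam.src = mu.src)
    (h : mu.src = al.tgt) (hal : mu * al ∈ F) : lam * al ∈ F :=
  hF lam hl mu hm _ hal hd hs al _ ((G.minExt_eq_of_le h).2 rfl)

/-- This makes the gap projection depend only on source and degree, so that the t_λ Q_λ t_μ* within
a block multiply as matrix units. -/
theorem IsAligned.tails_eq (hF : G.IsAligned (F : Set (Path Λ))) {lam mu : Path Λ}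
    (hl : lam ∈ F) (hm : mu ∈ F) (hd : G.deg lam = G.deg mu) (hs : lam.src = mu.src) :
    G.tails F lam = G.tails F mu := by
  ext al
  constructor
  · rintro ⟨h1, h2, h3⟩
    exact ⟨hs ▸ h1, h2, hF.mul_mem hm hl hd.symm hs.symm h1 h3⟩
  · rintro ⟨h1, h2, h3⟩
    exact ⟨hs ▸ h1, h2, hF.mul_mem hl hm hd hs h1 h3⟩

/-- An element of an aligned set which meets `lam` either is an initial segment of `lam`, or the
common extension passes through `lam * al` for some `al ∈ tails F lam`. -/
theorem IsAligned.exists_tail (hF : G.IsAligned (F : Set (Path Λ))) {lam rho nu : Path Λ}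
    (hl : lam ∈ F) (hr : rho ∈ F) (h1 : lam ≤ nu) (h2 : rho ≤ nu) (hn : ¬ rho ≤ lam) :
    ∃ al ∈ G.tails F lam, lam * al ≤ nu := by
  obtain ⟨al, be, h3, h4⟩ := G.exists_minExt_le h1 h2
  obtain ⟨h5, h6, h7, -⟩ := G.mem_minExt.1 h3
  refine ⟨al, ⟨h5, fun h0 => hn ?_, hF lam hl lam hl rho hr rfl rfl al be h3⟩, h4⟩
  rw [G.mul_eq_left_of_deg_eq_zero h5 h0] at h7
  exact ⟨be, h6, h7⟩

namespace IsCuntzKriegerFamily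

variable {hfa : G.FinitelyAligned} {A : Type w} [NonUnitalCStarAlgebra A] {t : Path Λ → A}

variable (G) in
/-- The gap projection at `s(lam)` cut out by the extensions of `lam` in `F`. -/
noncomputable def gapAt (F : Finset (Path Λ)) (t : Path Λ → A) (lam : Path Λ) : A :=
  gapSet t lam.src (G.tails F lam)

variable (G) in
/-- The matrix units attached to a finite aligned set `F`. -/
noncomputable def unitAt (F : Finset (Path Λ)) (t : Path Λ → A) (lam mu : Path Λ) : A :=
  t lam * gapAt G F t lam * star (t mu)

theorem gapAt_congr (t : Path Λ → A) (hF : G.IsAligned (F : Set (Path Λ))) {lam mu : Path Λ}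
    (hl : lam ∈ F) (hm : mu ∈ F) (hd : G.deg lam = G.deg mu) (hs : lam.src = mu.src) :
    gapAt G F t lam = gapAt G F t mu := by
  rw [gapAt, gapAt, hF.tails_eq hl hm hd hs, hs]

theorem star_gapAt (ht : G.IsCuntzKriegerFamily hfa t) (lam : Path Λ) :
    star (gapAt G F t lam) = gapAt G F t lam :=
  ht.star_gapSet (finite_tails F lam) fun _ => tgt_of_mem_tails

theorem gapAt_mul_self (ht : G.IsCuntzKriegerFamily hfa t) (lam : Path Λ) :
    gapAt G F t lam * gapAt G F t lam = gapAt G F t lam :=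
  ht.gapSet_mul_self (finite_tails F lam) fun _ => tgt_of_mem_tails

theorem gapAt_mul_vertex (ht : G.IsCuntzKriegerFamily hfa t) (lam : Path Λ) :
    gapAt G F t lam * t (vertex lam.src) = gapAt G F t lam :=
  ht.gapSet_mul_vertex (finite_tails F lam)

theorem star_unitAt (ht : G.IsCuntzKriegerFamily hfa t) (hF : G.IsAligned (F : Set (Path Λ)))
    {lam mu : Path Λ} (hl : lam ∈ F) (hm : mu ∈ F) (hd : G.deg lam = G.deg mu)
    (hs : lam.src = mu.src) : star (unitAt G F t lam mu) = unitAt G F t mu lam := by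
  rw [unitAt, unitAt, star_mul, star_mul, star_star, ht.star_gapAt,
    gapAt_congr t hF hl hm hd hs, mul_assoc]

/-- Expand t_lam* t_rho over minimal common extensions (α, β). Since `rho` is not an initial segment
of `lam`, each α has nonzero degree; by alignment it is a tail of `lam`, so the gap projection kills
t_α. -/
theorem gapAt_mul_star_mul (ht : G.IsCuntzKriegerFamily hfa t)
    (hF : G.IsAligned (F : Set (Path Λ))) {lam rho : Path Λ} (hl : lam ∈ F) (hr : rho ∈ F)
    (hn : ¬ rho ≤ lam) : gapAt G F t lam * star (t lam) * t rho = 0 := by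
  rw [mul_assoc, ht.star_mul_eq, Finset.mul_sum, Finset.sum_eq_zero]
  intro p hp
  have hp' := (hfa lam rho).mem_toFinset.1 hp
  obtain ⟨h1, h2, h3, -⟩ := G.mem_minExt.1 hp'
  rw [← mul_assoc, gapAt, ht.gapSet_mul_of_mem (finite_tails F lam) (fun _ => tgt_of_mem_tails),
    zero_mul]
  refine ⟨h1, fun h0 => hn ?_, hF lam hl lam hl rho hr rfl rfl p.1 p.2 hp'⟩
  rw [G.mul_eq_left_of_deg_eq_zero h1 h0] at h3
  exact ⟨p.2, h2, h3⟩

theorem star_mul_mul_gapAt (ht : G.IsCuntzKriegerFamily hfa t)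
    (hF : G.IsAligned (F : Set (Path Λ))) {lam rho : Path Λ} (hl : lam ∈ F) (hr : rho ∈ F)
    (hn : ¬ rho ≤ lam) : star (t rho) * (t lam * gapAt G F t lam) = 0 := by
  have := congrArg star (ht.gapAt_mul_star_mul hF hl hr hn)
  rwa [star_mul, star_mul, star_star, ht.star_gapAt, star_zero] at this

theorem unitAt_mul_unitAt_self (ht : G.IsCuntzKriegerFamily hfa t)
    (hF : G.IsAligned (F : Set (Path Λ))) {lam mu rho : Path Λ} (hl : lam ∈ F) (hm : mu ∈ F)
    (hd : G.deg lam = G.deg mu) (hs : lam.src = mu.src) :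
    unitAt G F t lam mu * unitAt G F t mu rho = unitAt G F t lam rho := by
  rw [unitAt, unitAt, unitAt, gapAt_congr t hF hl hm hd hs]
  calc t lam * gapAt G F t mu * star (t mu) * (t mu * gapAt G F t mu * star (t rho))
      = t lam * (gapAt G F t mu * (star (t mu) * t mu) * gapAt G F t mu) * star (t rho) := by
        simp only [mul_assoc]
    _ = _ := by rw [ht.star_mul_self, ht.gapAt_mul_vertex, ht.gapAt_mul_self]

/-- Distinct `mu` and `nu` are not initial segments of each other, so one of the two gap projections
annihilates the middle of the product. -/
theorem unitAt_mul_unitAt_of_ne (ht : G.IsCuntzKriegerFamily hfa t)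
    (hF : G.IsAligned (F : Set (Path Λ))) {lam mu nu rho : Path Λ} (hl : lam ∈ F) (hm : mu ∈ F)
    (hd : G.deg lam = G.deg mu) (hs : lam.src = mu.src) (hn : nu ∈ F) (hne : mu ≠ nu) :
    unitAt G F t lam mu * unitAt G F t nu rho = 0 := by
  rw [unitAt, unitAt, gapAt_congr t hF hl hm hd hs]
  by_cases h : nu ≤ mu
  · have h' : ¬ mu ≤ nu := fun h' => hne (G.eq_of_le_of_le h' h)
    calc t lam * gapAt G F t mu * star (t mu) * (t nu * gapAt G F t nu * star (t rho))
        = t lam * gapAt G F t mu * (star (t mu) * (t nu * gapAt G F t nu)) * star (t rho) := by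
          simp only [mul_assoc]
      _ = 0 := by rw [ht.star_mul_mul_gapAt hF hn hm h', mul_zero, zero_mul]
  · calc t lam * gapAt G F t mu * star (t mu) * (t nu * gapAt G F t nu * star (t rho))
        = t lam * (gapAt G F t mu * star (t mu) * t nu) * (gapAt G F t nu * star (t rho)) := by
          simp only [mul_assoc]
      _ = 0 := by rw [ht.gapAt_mul_star_mul hF hm hn h, mul_zero, zero_mul]

theorem unitAt_mul_proj_of_le (ht : G.IsCuntzKriegerFamily hfa t) {lam mu nu : Path Λ}
    (h : nu ≤ mu) : unitAt G F t lam mu * (t nu * star (t nu)) = unitAt G F t lam mu := by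
  rw [unitAt, mul_assoc, ht.star_mul_proj_of_le h]

theorem unitAt_mul_of_not_le (ht : G.IsCuntzKriegerFamily hfa t)
    (hF : G.IsAligned (F : Set (Path Λ))) {lam nu : Path Λ} (hl : lam ∈ F) (hn : nu ∈ F)
    (h : ¬ nu ≤ lam) : unitAt G F t lam lam * t nu = 0 := by
  rw [unitAt, mul_assoc, mul_assoc, ← mul_assoc (gapAt G F t lam),
    ht.gapAt_mul_star_mul hF hl hn h, mul_zero]

open Classical in
-- Induction on the number of elements of `F` extending `lam`. The difference z of the two sides
-- satisfies z = z t_lam t_lam*, and by induction it annihilates the range projections of the longer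
-- paths in `F`. So z t_lam is unchanged by the gap projection of `lam`. But on t_lam Q_lam only the
-- summand at `lam` acts, and it cancels t_lam t_lam*.
theorem proj_eq_sum_unitAt (ht : G.IsCuntzKriegerFamily hfa t)
    (hF : G.IsAligned (F : Set (Path Λ))) (lam : Path Λ) (hl : lam ∈ F) :
    t lam * star (t lam) = ∑ nu ∈ F with lam ≤ nu, unitAt G F t nu nu := by
  induction hc : (F.filter (lam ≤ ·)).card using Nat.strong_induction_on generalizing lam with
  | _ c ih =>
  set z := t lam * star (t lam) - ∑ nu ∈ F with lam ≤ nu, unitAt G F t nu nu with hz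
  have hzlam : z * (t lam * star (t lam)) = z := by
    rw [hz, sub_mul, ht.proj_mul_proj, Finset.sum_mul]
    congr 1
    exact Finset.sum_congr rfl fun nu hnu => ht.unitAt_mul_proj_of_le (Finset.mem_filter.1 hnu).2
  have hzmu : ∀ mu ∈ F, lam ≤ mu → mu ≠ lam → z * (t mu * star (t mu)) = 0 := by
    intro mu hm hle hne
    have hnot : ¬ mu ≤ lam := fun h => hne (G.eq_of_le_of_le h hle)
    have hlt : (F.filter (mu ≤ ·)).card < c := by
      rw [← hc]
      refine Finset.card_lt_card ⟨fun nu h => ?_, fun h => ?_⟩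
      · rw [Finset.mem_filter] at h ⊢
        exact ⟨h.1, hle.trans h.2⟩
      · exact hnot (Finset.mem_filter.1 (h (Finset.mem_filter.2 ⟨hl, le_rfl⟩))).2
    rw [hz, sub_mul, ← mul_assoc, ht.proj_mul_of_le hle, sub_eq_zero, Finset.sum_mul, ← Finset.sum_subset (s₁ := F.filter (mu ≤ ·))]
    · rw [Finset.sum_congr rfl fun nu hnu =>
        ht.unitAt_mul_proj_of_le (Finset.mem_filter.1 hnu).2]
      exact ih _ hlt mu hm rfl
    · intro nu h
      rw [Finset.mem_filter] at h ⊢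
      exact ⟨h.1, hle.trans h.2⟩
    · intro nu h1 h2
      rw [Finset.mem_filter] at h1 h2
      rw [← mul_assoc, ht.unitAt_mul_of_not_le hF h1.1 hm fun h => h2 ⟨h1.1, h⟩, zero_mul]
  have hy : z * t lam * gapAt G F t lam = z * t lam := by
    refine mul_gapSet_eq_self (finite_tails F lam) ?_ fun al hal => ?_
    · rw [mul_assoc, ht.mul_vertex rfl]
    · have h1 := hzmu (lam * al) hal.2.2 (le_mul hal.1) fun h => hal.2.1 <| by
        have := congrArg G.deg h
        rw [G.deg_mul hal.1] at this
        exact add_eq_left.1 this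
      rw [mul_assoc, ht.mul_eq_mul hal.1, ← ht.proj_mul_of_le (le_refl (lam * al)), ← mul_assoc,
        h1, zero_mul]
  have hy0 : z * t lam * gapAt G F t lam = 0 := by
    rw [hz, sub_mul, sub_mul, ht.proj_mul_of_le le_rfl, Finset.sum_mul, Finset.sum_mul,
      Finset.sum_eq_single lam, sub_eq_zero, unitAt]
    · rw [mul_assoc, mul_assoc, ← mul_assoc (star (t lam)), ht.star_mul_self, ← mul_assoc,
        mul_assoc (t lam), ht.gapAt_mul_vertex, mul_assoc, ht.gapAt_mul_self]
    · intro nu hnu hne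
      rw [Finset.mem_filter] at hnu
      rw [unitAt, mul_assoc, mul_assoc, mul_assoc, ht.star_mul_mul_gapAt hF hl hnu.1
        fun h => hne (G.eq_of_le_of_le h hnu.2), mul_zero, mul_zero]
    · intro h
      exact absurd (Finset.mem_filter.2 ⟨hl, le_rfl⟩) h
  have hz0 : z = 0 := by
    rw [← hzlam, ← mul_assoc, ← hy, hy0, zero_mul]
  exact sub_eq_zero.1 hz0

open Classical in
-- Multiply the expansion of t_rho t_rho* on the right by t_rho t_tau*. The unit at `rho * al`
-- becomes the unit from `tau * al` to `rho * al`, and alignment puts `tau * al` in `F`.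
theorem mul_star_eq_sum_unitAt (ht : G.IsCuntzKriegerFamily hfa t)
    (hF : G.IsAligned (F : Set (Path Λ))) {rho tau : Path Λ} (hr : rho ∈ F) (hta : tau ∈ F)
    (hd : G.deg rho = G.deg tau) (hs : rho.src = tau.src) :
    t rho * star (t tau) =
      ∑ lam ∈ F, ∑ mu ∈ F, if Linked rho tau lam mu then unitAt G F t lam mu else 0 := by
  rw [← ht.proj_mul_of_le (le_refl rho), ht.proj_eq_sum_unitAt hF rho hr, Finset.sum_mul,
    Finset.sum_mul, Finset.sum_filter]
  refine Finset.sum_congr rfl fun lam hl => ?_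
  split_ifs with h
  · obtain ⟨al, h1, rfl⟩ := h
    rw [Finset.sum_eq_single (tau * al), if_pos ⟨al, h1, hs ▸ h1, rfl, rfl⟩]
    · rw [unitAt, unitAt, mul_assoc (t (rho * al) * _), ht.star_mul_mul_self h1, mul_assoc,
        ← star_mul, ht.mul_eq_mul (hs ▸ h1)]
    · rintro mu hm hne
      refine if_neg ?_
      rintro ⟨be, h3, h4, h5, rfl⟩
      exact hne (by rw [G.mul_left_inj h1 h3 h5])
    · intro h
      exact absurd (hF.mul_mem hta hr hd.symm hs.symm h1 hl) h
  · refine (Finset.sum_eq_zero fun mu _ => if_neg ?_).symm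
    rintro ⟨al, h1, -, rfl, -⟩
    exact h (le_mul h1)

end IsCuntzKriegerFamily

end KGraph

end HigherRank

/-! ### Norms of combinations of matrix units -/

namespace HigherRank

section MatrixUnits

open scoped ComplexOrder

variable {A : Type*} [NonUnitalCStarAlgebra A]

/-- The homomorphism from a matrix algebra given by a system of matrix units. -/
def matrixHom {ι : Type*} [Fintype ι] [DecidableEq ι] (e : ι → ι → A)
    (hs : ∀ i j, star (e i j) = e j i)
    (hm : ∀ i j k l, e i j * e k l = if j = k then e i l else 0) :
    CStarMatrix ι ι ℂ →⋆ₙₐ[ℂ] A where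
  toFun M := ∑ i, ∑ j, M i j • e i j
  map_smul' z M := by
    simp [Finset.smul_sum, smul_smul]
  map_zero' := by simp
  map_add' M N := by
    simp [add_smul, Finset.sum_add_distrib]
  map_mul' M N := by
    rw [Finset.sum_mul]
    refine Finset.sum_congr rfl fun i _ => ?_
    simp only [CStarMatrix.mul_apply, Finset.sum_smul]
    rw [Finset.sum_mul]
    refine Finset.sum_comm.trans (Finset.sum_congr rfl fun j _ => Eq.symm ?_)
    rw [Finset.mul_sum]
    refine (Finset.sum_eq_single j (fun k _ hk => ?_) (by simp)).trans ?_
    · simp [Finset.mul_sum, smul_mul_smul_comm, hm, hk.symm]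
    · simp [Finset.mul_sum, smul_mul_smul_comm, hm]
  map_star' M := by
    simp only [star_sum, star_smul, hs]
    rw [Finset.sum_comm]
    rfl

theorem matrixHom_apply {ι : Type*} [Fintype ι] [DecidableEq ι] (e : ι → ι → A)
    (hs : ∀ i j, star (e i j) = e j i)
    (hm : ∀ i j k l, e i j * e k l = if j = k then e i l else 0) (M : CStarMatrix ι ι ℂ) :
    matrixHom e hs hm M = ∑ i, ∑ j, M i j • e i j := rfl

/-- An injective homomorphism of C*-algebras is isometric. Injectivity follows since multiplying by
`e i i` on the left and `e j i` on the right isolates the entry (i, j). -/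
theorem norm_sum_matrixUnits {ι : Type*} [Fintype ι] [DecidableEq ι] (e : ι → ι → A)
    (hs : ∀ i j, star (e i j) = e j i)
    (hm : ∀ i j k l, e i j * e k l = if j = k then e i l else 0) (h0 : ∀ i, e i i ≠ 0)
    (M : CStarMatrix ι ι ℂ) : ‖∑ i, ∑ j, M i j • e i j‖ = ‖M‖ := by
  rw [← matrixHom_apply e hs hm]
  refine NonUnitalStarAlgHom.norm_map _ ?_ M
  rw [injective_iff_map_eq_zero]
  intro N hN
  ext i j
  have h1 : e i i * matrixHom e hs hm N * e j i = N i j • e i i := by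
    rw [matrixHom_apply]
    simp only [Finset.mul_sum, Finset.sum_mul, mul_smul_comm, smul_mul_assoc, hm]
    rw [Finset.sum_eq_single i (by simp +contextual [eq_comm]) (by simp),
      Finset.sum_eq_single j (by simp +contextual [hm]) (by simp)]
    simp [hm]
  rw [hN, mul_zero, zero_mul, eq_comm, smul_eq_zero] at h1
  exact h1.resolve_right (h0 i)

/-- Homomorphisms with mutually orthogonal ranges combine to one on the product. -/
def sumHom {κ : Type*} [Fintype κ] {B : κ → Type*} [∀ a, NonUnitalCStarAlgebra (B a)]
    (φ : ∀ a, B a →⋆ₙₐ[ℂ] A) (h : ∀ a b, a ≠ b → ∀ x y, φ a x * φ b y = 0) :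
    (∀ a, B a) →⋆ₙₐ[ℂ] A where
  toFun x := ∑ a, φ a (x a)
  map_smul' z x := by simp [Finset.smul_sum]
  map_zero' := by simp
  map_add' x y := by simp [Finset.sum_add_distrib]
  map_mul' x y := by
    rw [Finset.sum_mul_sum]
    refine Finset.sum_congr rfl fun a _ => ?_
    rw [Finset.sum_eq_single a (fun b _ hb => h a b hb.symm _ _) (by simp), Pi.mul_apply, map_mul]
  map_star' x := by simp [star_sum, map_star]

/-- Distinct blocks are orthogonal, so the sum is the image of the tuple of blocks under a
homomorphism, which is contractive. The units may vanish, so only an upper bound is available. -/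
theorem norm_sum_blocks_le {ι κ : Type*} [Fintype ι] [DecidableEq ι] [Fintype κ] [DecidableEq κ]
    (key : ι → κ) (e : ι → ι → A)
    (hs : ∀ i j, key i = key j → star (e i j) = e j i)
    (hm : ∀ i j k l, key i = key j → key k = key l →
      e i j * e k l = if j = k then e i l else 0)
    (M : ι → ι → ℂ) {C : ℝ} (hC : 0 ≤ C)
    (hM : ∀ a, ‖(CStarMatrix.ofMatrix fun i j => M i j :
      CStarMatrix {i // key i = a} {i // key i = a} ℂ)‖ ≤ C) :
    ‖∑ i, ∑ j, if key i = key j then M i j • e i j else 0‖ ≤ C := by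
  let φ : ∀ a, CStarMatrix {i // key i = a} {i // key i = a} ℂ →⋆ₙₐ[ℂ] A := fun a =>
    matrixHom (fun i j => e i j) (fun i j => hs i j (i.2.trans j.2.symm)) (fun i j k l => by
      rw [hm i j k l (i.2.trans j.2.symm) (k.2.trans l.2.symm)]
      simp [Subtype.ext_iff])
  let ψ := sumHom φ (fun a b hab x y => by
    simp only [φ, matrixHom_apply, Finset.sum_mul, Finset.mul_sum, smul_mul_smul_comm]
    refine Finset.sum_eq_zero fun i _ => Finset.sum_eq_zero fun j _ =>
      Finset.sum_eq_zero fun k _ => Finset.sum_eq_zero fun l _ => ?_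
    rw [hm _ _ _ _ (by rw [k.2, l.2]) (by rw [i.2, j.2]), if_neg, smul_zero]
    intro h
    exact hab (by rw [← l.2, ← i.2, h]))
  have h1 : ∑ i, ∑ j, (if key i = key j then M i j • e i j else 0) =
      ψ fun a => CStarMatrix.ofMatrix fun i j => M i j := by
    change _ = ∑ a, ∑ i : {i // key i = a}, ∑ j : {i // key i = a}, M i j • e i j
    rw [← Fintype.sum_fiberwise key]
    refine Finset.sum_congr rfl fun a _ => Finset.sum_congr rfl fun i _ => ?_
    rw [← Finset.sum_filter, Finset.sum_subtype (p := fun j => key j = a)]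
    intro j
    simp [i.2, eq_comm]
  rw [h1]
  exact (NonUnitalStarAlgHom.norm_apply_le ψ _).trans ((pi_norm_le_iff_of_nonneg hC).2 hM)

end MatrixUnits

end HigherRank

/-! ### Compression along a separating filter and the bound on the core part -/

namespace HigherRank

open HigherRank.Path

open scoped ComplexOrder

variable {k : ℕ} {Λ : Type u} [Category.{v} Λ]

/-- The formal combination `∑ c (lam, mu) lam mu*`, evaluated in a family `t`. -/
noncomputable def evalFormal {A : Type w} [NonUnitalCStarAlgebra A] (t : Path Λ → A) :
    (Path Λ × Path Λ →₀ ℂ) →ₗ[ℂ] A :=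
  Finsupp.linearCombination ℂ fun p => t p.1 * star (t p.2)

open Classical in
/-- The `(lam, mu)` matrix coefficient of a formal combination. -/
noncomputable def matrixCoeff (c : Path Λ × Path Λ →₀ ℂ) (lam mu : Path Λ) : ℂ :=
  ∑ p ∈ c.support, if Linked p.1 p.2 lam mu then c p else 0

theorem evalFormal_apply {A : Type w} [NonUnitalCStarAlgebra A] (t : Path Λ → A)
    (c : Path Λ × Path Λ →₀ ℂ) :
    evalFormal t c = ∑ p ∈ c.support, c p • (t p.1 * star (t p.2)) := rfl

namespace KGraph

variable {G : KGraph k Λ} {hfa : G.FinitelyAligned}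

/-- The part of degree zero of a formal combination. -/
noncomputable def corePart (G : KGraph k Λ) (c : Path Λ × Path Λ →₀ ℂ) :
    Path Λ × Path Λ →₀ ℂ :=
  c.filter fun p => G.deg p.1 = G.deg p.2

/-- A maximal filter `U` at `a` along which distinct paths `al`, `be` with source `a` separate. -/
structure IsSeparating (a : Λ) (U : Set (Path Λ)) : Prop extends IsUltra a U where
  separates : ∀ al be : Path Λ, al.src = a → be.src = a → al ≠ be →
    ∃ ka ∈ U, ¬ Meets (al * ka) (be * ka)

/-- Non-exhaustiveness gives a path `xi` that meets no member of `S`. Prefix `xi` to the filter that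
(B) provides at s(xi); separation is inherited because `al * xi ≠ be * xi`. -/
theorem ConditionB.exists_isSeparating (hfa : G.FinitelyAligned) (hB : G.ConditionB) {a : Λ}
    {S : Set (Path Λ)} (hS : ∀ al ∈ S, al.tgt = a) (hex : ¬ G.Exhaustive a S) :
    ∃ U, IsSeparating a U ∧ ∀ al ∈ S, al ∉ U := by
  obtain ⟨xi, hxi, hn⟩ : ∃ xi : Path Λ, xi.tgt = a ∧ ∀ al ∈ S, ¬ Meets al xi := by
    by_contra! hc
    refine hex ⟨hS, fun mu hmu => ?_⟩
    obtain ⟨al, h1, h2⟩ := hc mu hmu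
    exact ⟨al, h1, G.minExt_nonempty_iff.2 h2⟩
  obtain ⟨V, hV, hsep⟩ := hB.exists_isUltra hfa xi.src
  have hU := hV.prepend hfa (lam := xi) rfl
  rw [hxi] at hU
  have hxiU : xi ∈ prependSet xi V := ⟨_, hV.vertex_mem, le_mul rfl⟩
  refine ⟨_, ⟨hU, fun al be hal hbe hne => ?_⟩, fun al hal h => hn al hal (hU.meets h hxiU)⟩
  have h1 : al.src = xi.tgt := hal.trans hxi.symm
  have h2 : be.src = xi.tgt := hbe.trans hxi.symm
  obtain ⟨ka, hka, hm⟩ := hsep (al * xi) (be * xi) (src_mul h1) (src_mul h2)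
    fun h => hne (G.mul_right_inj h1 h2 h)
  have h3 : xi.src = ka.tgt := (hV.tgt ka hka).symm
  refine ⟨xi * ka, IsUltra.mul_mem_prependSet hka, ?_⟩
  rwa [← mul_assoc_of_src h1 h3, ← mul_assoc_of_src h2 h3]

namespace IsCuntzKriegerFamily

variable {A : Type w} [NonUnitalCStarAlgebra A] {t : Path Λ → A} {F : Finset (Path Λ)}

/-- Were `rho` in the filter `lam U`, a common extension with `lam` would pass through `lam * al`
for some tail `al`, and then `al` would lie in `U`. So some member of `lam U` does not meet `rho`,
nor does anything beyond it. -/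
theorem exists_star_mul_eq_zero (ht : G.IsCuntzKriegerFamily hfa t)
    (hF : G.IsAligned (F : Set (Path Λ))) {a : Λ} {U : Set (Path Λ)} (hU : IsUltra a U)
    {lam rho : Path Λ} (hl : lam ∈ F) (hr : rho ∈ F) (hs : lam.src = a)
    (htl : ∀ al ∈ G.tails F lam, al ∉ U) (hn : ¬ rho ≤ lam) :
    ∃ ka ∈ U, ∀ ka' ∈ U, ka ≤ ka' → star (t (lam * ka')) * t rho = 0 := by
  have hnot : rho ∉ prependSet lam U := by
    rintro ⟨mu, h1, h2⟩
    have h3 : lam.src = mu.tgt := by rw [hs, hU.tgt mu h1]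
    obtain ⟨al, h4, h5⟩ := hF.exists_tail hl hr (le_mul h3) h2 hn
    exact htl al h4 (hU.lower _ _ (G.le_of_mul_le_mul h4.1 h3 h5) h1)
  have hmeet : ∃ nu ∈ prependSet lam U, ¬ Meets nu rho := by
    by_cases htgt : rho.tgt = lam.tgt
    · exact (hU.prepend hfa hs).decide rho htgt hnot
    · exact ⟨vertex lam.tgt, (hU.prepend hfa hs).vertex_mem, fun h => htgt h.tgt_eq.symm⟩
  obtain ⟨nu, ⟨ka, h1, h2⟩, h3⟩ := hmeet
  refine ⟨ka, h1, fun ka' _ hle => ht.star_mul_eq_zero fun h => h3 (h.mono (h2.trans ?_) le_rfl)⟩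
  exact mul_le_mul_left_of_src (by rw [hs, hU.tgt ka h1]) hle

open Classical in
-- Terms survive only if `lam = rho * al` and `mu = tau * be`, where the compression is t_{al κ}*
-- t_{be κ}. This is a vertex projection if `al = be`; otherwise separation makes it vanish far
-- along `U`. This is where terms outside the core disappear.
theorem exists_compress (ht : G.IsCuntzKriegerFamily hfa t)
    (hF : G.IsAligned (F : Set (Path Λ))) {a : Λ} {U : Set (Path Λ)} (hU : IsSeparating a U)
    {lam mu rho tau : Path Λ} (hl : lam ∈ F) (hm : mu ∈ F) (hr : rho ∈ F) (hta : tau ∈ F)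
    (hls : lam.src = a) (hms : mu.src = a) (htl : ∀ al ∈ G.tails F lam, al ∉ U)
    (htm : ∀ al ∈ G.tails F mu, al ∉ U) :
    ∃ ka ∈ U, ∀ ka' ∈ U, ka ≤ ka' →
      star (t (lam * ka')) * (t rho * star (t tau)) * t (mu * ka') =
        if Linked rho tau lam mu then t (vertex ka'.src) else 0 := by
  by_cases h1 : rho ≤ lam
  swap
  · obtain ⟨ka, h2, h3⟩ := ht.exists_star_mul_eq_zero hF hU.toIsUltra hl hr hls htl h1
    refine ⟨ka, h2, fun ka' h4 h5 => ?_⟩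
    rw [← mul_assoc, h3 ka' h4 h5, zero_mul, zero_mul, if_neg]
    rintro ⟨al, h6, -, rfl, -⟩
    exact h1 (le_mul h6)
  by_cases h1' : tau ≤ mu
  swap
  · obtain ⟨ka, h2, h3⟩ := ht.exists_star_mul_eq_zero hF hU.toIsUltra hm hta hms htm h1'
    refine ⟨ka, h2, fun ka' h4 h5 => ?_⟩
    have h6 := congrArg star (h3 ka' h4 h5)
    rw [star_mul, star_star, star_zero] at h6
    rw [← mul_assoc, mul_assoc, h6, mul_zero, if_neg]
    rintro ⟨al, -, h7, -, rfl⟩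
    exact h1' (le_mul h7)
  obtain ⟨al, h2, rfl⟩ := h1
  obtain ⟨be, h3, rfl⟩ := h1'
  rw [src_mul h2] at hls
  rw [src_mul h3] at hms
  have key : ∀ ka' ∈ U,
      star (t (rho * al * ka')) * (t rho * star (t tau)) * t (tau * be * ka') =
        star (t (al * ka')) * t (be * ka') := by
    intro ka' hka
    have h4 : al.src = ka'.tgt := by rw [hls, hU.tgt ka' hka]
    have h5 : be.src = ka'.tgt := by rw [hms, hU.tgt ka' hka]
    rw [mul_assoc_of_src h2 h4, mul_assoc_of_src h3 h5, ← mul_assoc,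
      ht.star_mul_mul_self (by rw [tgt_mul, h2]), mul_assoc, ht.star_mul_mul (by rw [tgt_mul, h3])]
  by_cases hab : al = be
  · subst hab
    refine ⟨_, hU.vertex_mem, fun ka' h4 _ => ?_⟩
    rw [key ka' h4, ht.star_mul_self, src_mul (by rw [hls, hU.tgt ka' h4]),
      if_pos ⟨al, h2, h3, rfl, rfl⟩]
  · obtain ⟨ka, h4, h5⟩ := hU.separates al be hls hms hab
    refine ⟨ka, h4, fun ka' h6 h7 => ?_⟩
    rw [key ka' h6, if_neg]
    · refine ht.star_mul_eq_zero fun h => h5 (h.mono ?_ ?_)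
      · exact mul_le_mul_left_of_src (by rw [hls, hU.tgt ka h4]) h7
      · exact mul_le_mul_left_of_src (by rw [hms, hU.tgt ka h4]) h7
    · rintro ⟨ga, h8, h9, h10, h11⟩
      exact hab ((G.mul_left_inj h2 h8 h10).trans (G.mul_left_inj h3 h9 h11).symm)

/-- One `ka` far along `U` stabilises all compressions at once. The `f i * ka` are distinct paths of
one degree, so the w_i w_j* are matrix units, nonzero because t at s(ka) is. Cutting the combination
down by the contraction W gives the coefficient matrix in these units. -/
theorem norm_matrixCoeff_le (ht : G.IsCuntzKriegerFamily hfa t)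
    (h0 : ∀ a, t (vertex a) ≠ 0) (hF : G.IsAligned (F : Set (Path Λ)))
    {c : Path Λ × Path Λ →₀ ℂ} (hc : ∀ p ∈ c.support, p.1 ∈ F ∧ p.2 ∈ F) {a : Λ}
    {U : Set (Path Λ)} (hU : IsSeparating a U) {n : Fin k → ℕ} {ι : Type*} [Fintype ι]
    (f : ι → Path Λ) (hf : Function.Injective f) (hfF : ∀ i, f i ∈ F) (hsrc : ∀ i, (f i).src = a)
    (hdeg : ∀ i, G.deg (f i) = n) (htl : ∀ i, ∀ al ∈ G.tails F (f i), al ∉ U) :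
    ‖(CStarMatrix.ofMatrix fun i j => matrixCoeff c (f i) (f j) : CStarMatrix ι ι ℂ)‖ ≤
      ‖evalFormal t c‖ := by
  classical
  obtain ⟨ka, hka, hP⟩ := hU.exists_forall_of_finite
    (s := {q : (ι × ι) × (Path Λ × Path Λ) | q.2 ∈ c.support})
    ((Set.finite_univ.prod c.support.finite_toSet).subset fun q hq => ⟨trivial, hq⟩)
    (fun q ka' => star (t (f q.1.1 * ka')) * (t q.2.1 * star (t q.2.2)) * t (f q.1.2 * ka') =
        if Linked q.2.1 q.2.2 (f q.1.1) (f q.1.2) then t (vertex ka'.src) else 0)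
    fun q hq => ht.exists_compress hF hU (hfF _) (hfF _) (hc _ hq).1 (hc _ hq).2 (hsrc _)
      (hsrc _) (htl _) (htl _)
  have hP' := fun i j p hp => hP ((i, j), p) hp ka hka le_rfl
  dsimp only at hP'
  have hcomp : ∀ i, (f i).src = ka.tgt := fun i => by rw [hsrc i, hU.tgt ka hka]
  set w : ι → A := fun i => t (f i * ka) with hw
  set e : ι → ι → A := fun i j => w i * star (w j) with he
  have hww : ∀ i j, star (w i) * w j = if i = j then t (vertex ka.src) else 0 := by
    intro i j
    split_ifs with h
    · subst h
      rw [hw, ht.star_mul_self, src_mul (hcomp i)]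
    · refine ht.star_mul_eq_zero_of_deg_eq ?_ fun h' =>
        h (hf (G.mul_right_inj (hcomp i) (hcomp j) h'))
      rw [G.deg_mul (hcomp i), G.deg_mul (hcomp j), hdeg, hdeg]
  have hwp : ∀ i, w i * t (vertex ka.src) = w i := fun i => ht.mul_vertex (src_mul (hcomp i))
  have hs : ∀ i j, star (e i j) = e j i := fun i j => by simp [he]
  have hm : ∀ i j m l, e i j * e m l = if j = m then e i l else 0 := by
    intro i j m l
    have : e i j * e m l = w i * (star (w j) * w m) * star (w l) := by simp only [he, mul_assoc]
    rw [this, hww]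
    split_ifs
    · rw [hwp]
    · rw [mul_zero, zero_mul]
  have hne : ∀ i, e i i ≠ 0 := fun i h => h0 ka.src <| by
    have h1 : star (w i) * e i i * w i = t (vertex ka.src) := by
      have : star (w i) * e i i * w i = star (w i) * w i * (star (w i) * w i) := by
        simp only [he, mul_assoc]
      rw [this, hww, if_pos rfl, ht.vertex_mul_vertex]
    rw [← h1, h, mul_zero, zero_mul]
  set W : A := ∑ i, e i i with hW
  have hWn : ‖W‖ ≤ 1 := by
    rcases isEmpty_or_nonempty ι with hι | hι
    · simp [hW]
    have h1 : W = matrixHom e hs hm 1 := by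
      rw [matrixHom_apply]
      refine Finset.sum_congr rfl fun i _ => ?_
      rw [Finset.sum_eq_single i (fun j _ hj => by
        rw [CStarMatrix.one_apply_ne hj.symm, zero_smul]) (by simp), CStarMatrix.one_apply_eq,
        one_smul]
    rw [h1]
    refine (NonUnitalStarAlgHom.norm_apply_le _ _).trans ?_
    exact CStarRing.norm_one.le
  have hsum : ∑ i, ∑ j, (CStarMatrix.ofMatrix fun i j => matrixCoeff c (f i) (f j) :
      CStarMatrix ι ι ℂ) i j • e i j = W * evalFormal t c * W := by
    rw [hW, Finset.sum_mul, Finset.sum_mul]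
    refine Finset.sum_congr rfl fun i _ => ?_
    rw [Finset.mul_sum]
    refine Finset.sum_congr rfl fun j _ => ?_
    have h1 : star (w i) * evalFormal t c * w j = matrixCoeff c (f i) (f j) • t (vertex ka.src) := by
      rw [evalFormal_apply, matrixCoeff, Finset.mul_sum, Finset.sum_mul, Finset.sum_smul]
      refine Finset.sum_congr rfl fun p hp => ?_
      rw [mul_smul_comm, smul_mul_assoc, hP' i j p hp]
      split_ifs <;> simp
    have h2 : e i i * evalFormal t c * e j j =
        w i * (star (w i) * evalFormal t c * w j) * star (w j) := by simp only [he, mul_assoc]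
    rw [h2, h1, mul_smul_comm, hwp, smul_mul_assoc]
    rfl
  rw [← norm_sum_matrixUnits e hs hm hne, hsum]
  calc ‖W * evalFormal t c * W‖ ≤ ‖W‖ * ‖evalFormal t c‖ * ‖W‖ :=
        (norm_mul_le _ _).trans (mul_le_mul_of_nonneg_right (norm_mul_le _ _) (norm_nonneg _))
    _ ≤ 1 * ‖evalFormal t c‖ * 1 := by gcongr
    _ = _ := by ring

/-- Source and degree, which index the blocks of matrix units. -/
def blockKey (G : KGraph k Λ) (lam : Path Λ) : Λ × (Fin k → ℕ) := (lam.src, G.deg lam)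

theorem blockKey_eq_iff {lam mu : Path Λ} :
    blockKey G lam = blockKey G mu ↔ lam.src = mu.src ∧ G.deg lam = G.deg mu := Prod.mk_inj

open Classical in
-- Linked pairs have the same difference of degrees, so keeping only pairs within one block selects
-- exactly the terms of degree zero.
theorem evalFormal_corePart (ht : G.IsCuntzKriegerFamily hfa t)
    (hF : G.IsAligned (F : Set (Path Λ))) {c : Path Λ × Path Λ →₀ ℂ}
    (hc : ∀ p ∈ c.support, p.1 ∈ F ∧ p.2 ∈ F) :
    evalFormal t (G.corePart c) = ∑ lam ∈ F, ∑ mu ∈ F,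
      if blockKey G lam = blockKey G mu then matrixCoeff c lam mu • unitAt G F t lam mu else 0 := by
  have h1 : evalFormal t (G.corePart c) = ∑ p ∈ c.support,
      if G.deg p.1 = G.deg p.2 then c p • (t p.1 * star (t p.2)) else 0 := by
    rw [evalFormal_apply, corePart, Finsupp.support_filter, Finset.sum_filter]
    refine Finset.sum_congr rfl fun p _ => ?_
    split_ifs with h
    · rw [Finsupp.filter_apply_pos (fun p : Path Λ × Path Λ => G.deg p.1 = G.deg p.2) c h]
    · rfl
  have h2 : ∀ p ∈ c.support, (if G.deg p.1 = G.deg p.2 then c p • (t p.1 * star (t p.2)) else 0) =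
      ∑ lam ∈ F, ∑ mu ∈ F, if blockKey G lam = blockKey G mu then
        (if Linked p.1 p.2 lam mu then c p else 0) • unitAt G F t lam mu else 0 := by
    intro p hp
    have key : ∀ lam mu, Linked p.1 p.2 lam mu →
        (blockKey G lam = blockKey G mu ↔ G.deg p.1 = G.deg p.2) := by
      rintro lam mu ⟨al, h3, h4, rfl, rfl⟩
      rw [blockKey_eq_iff, src_mul h3, src_mul h4, G.deg_mul h3, G.deg_mul h4]
      simp
    split_ifs with hd
    · by_cases hs : p.1.src = p.2.src
      · rw [ht.mul_star_eq_sum_unitAt hF (hc p hp).1 (hc p hp).2 hd hs, Finset.smul_sum]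
        refine Finset.sum_congr rfl fun lam _ => ?_
        rw [Finset.smul_sum]
        refine Finset.sum_congr rfl fun mu _ => ?_
        by_cases hL : Linked p.1 p.2 lam mu
        · rw [if_pos hL, if_pos ((key _ _ hL).2 hd), if_pos hL]
        · simp [hL]
      · rw [ht.mul_star_eq_zero hs, smul_zero]
        refine (Finset.sum_eq_zero fun lam _ => Finset.sum_eq_zero fun mu _ => ?_).symm
        rw [if_neg (c := Linked p.1 p.2 lam mu), zero_smul, ite_self]
        rintro ⟨al, h3, h4, -⟩
        exact hs (h3.trans h4.symm)
    · refine (Finset.sum_eq_zero fun lam _ => Finset.sum_eq_zero fun mu _ => ?_).symm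
      by_cases hL : Linked p.1 p.2 lam mu
      · rw [if_neg fun h => hd ((key _ _ hL).1 h)]
      · simp [hL]
  rw [h1, Finset.sum_congr rfl h2, Finset.sum_comm]
  refine Finset.sum_congr rfl fun lam _ => ?_
  rw [Finset.sum_comm]
  refine Finset.sum_congr rfl fun mu _ => ?_
  split_ifs
  · rw [matrixCoeff, Finset.sum_smul]
  · exact Finset.sum_const_zero

/-- The norm of the degree-zero part is controlled by any Cuntz–Krieger family with nonzero
vertex projections. -/
theorem norm_corePart_le {B : Type w'} [NonUnitalCStarAlgebra B] {r : Path Λ → B}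
    (hB : G.ConditionB) (hr : G.IsCuntzKriegerFamily hfa r) (ht : G.IsCuntzKriegerFamily hfa t)
    (h0 : ∀ a, t (vertex a) ≠ 0) (c : Path Λ × Path Λ →₀ ℂ) :
    ‖evalFormal r (G.corePart c)‖ ≤ ‖evalFormal t c‖ := by
  classical
  obtain ⟨F, hEF, hF⟩ := exists_finite_isAligned hfa
    ((c.support.image Prod.fst ∪ c.support.image Prod.snd).finite_toSet)
  have hc : ∀ p ∈ c.support, p.1 ∈ F ∧ p.2 ∈ F := fun p hp =>
    ⟨hEF (Finset.mem_coe.2 (Finset.mem_union_left _ (Finset.mem_image_of_mem _ hp))),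
      hEF (Finset.mem_coe.2 (Finset.mem_union_right _ (Finset.mem_image_of_mem _ hp)))⟩
  -- When the tails are exhaustive the gap relation in `r` makes the matrix units vanish, so these
  -- coefficients may be replaced by 0. Only the remaining blocks must be compared with `t`.
  let M : F → F → ℂ := fun lam mu =>
    if G.Exhaustive lam.1.src (G.tails F lam) then 0 else matrixCoeff c lam mu
  -- Blocks are indexed by the finitely many keys that occur in `F`.
  obtain ⟨κ, _, key, hkey'⟩ : ∃ (κ : Type (max u v)) (_ : Fintype κ) (key : F → κ), ∀ lam mu : F,
      key lam = key mu ↔ blockKey G lam.1 = blockKey G mu.1 :=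
    ⟨ULift.{max u v} (F.image (blockKey G)), inferInstance,
      fun lam => ⟨blockKey G lam, Finset.mem_image_of_mem _ lam.2⟩, fun lam mu => by simp⟩
  have hkey : ∀ lam mu : F, key lam = key mu ↔ lam.1.src = mu.1.src ∧ G.deg lam.1 = G.deg mu.1 :=
    fun lam mu => (hkey' lam mu).trans blockKey_eq_iff
  have hsum : evalFormal r (G.corePart c) =
      ∑ lam : F, ∑ mu : F, if key lam = key mu then M lam mu • unitAt G F r lam mu else 0 := by
    rw [hr.evalFormal_corePart hF hc, ← Finset.sum_coe_sort F]
    refine Finset.sum_congr rfl fun lam _ => ?_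
    rw [← Finset.sum_coe_sort F]
    refine Finset.sum_congr rfl fun mu _ => ?_
    refine if_congr (hkey' lam mu).symm ?_ rfl
    by_cases hex : G.Exhaustive lam.1.src (G.tails F lam)
    · have : unitAt G F r lam.1 mu.1 = 0 := by
        rw [unitAt, gapAt, hr.gapSet_eq_zero (finite_tails F _) hex, mul_zero, zero_mul]
      rw [this, smul_zero, smul_zero]
    · simp only [M, if_neg hex]
  rw [hsum]
  refine norm_sum_blocks_le key (fun lam mu : F => unitAt G F r lam.1 mu.1) ?_ ?_ M
    (norm_nonneg _) ?_
  · intro lam mu h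
    obtain ⟨h1, h2⟩ := (hkey lam mu).1 h
    exact hr.star_unitAt hF lam.2 mu.2 h2 h1
  · intro lam mu nu rho h h'
    obtain ⟨h1, h2⟩ := (hkey lam mu).1 h
    split_ifs with hmn
    · subst hmn
      exact hr.unitAt_mul_unitAt_self hF lam.2 mu.2 h2 h1
    · exact hr.unitAt_mul_unitAt_of_ne hF lam.2 mu.2 h2 h1 nu.2 fun h => hmn (Subtype.ext h)
  · intro j
    by_cases hj : ∃ lam : F, key lam = j ∧ ¬ G.Exhaustive lam.1.src (G.tails F lam)
    · obtain ⟨lam0, rfl, hex⟩ := hj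
      have htail : ∀ i : {lam // key lam = key lam0}, G.tails F i.1.1 = G.tails F lam0.1 := fun i =>
        hF.tails_eq i.1.2 lam0.2 ((hkey _ _).1 i.2).2 ((hkey _ _).1 i.2).1
      have hM : (fun i j : {lam // key lam = key lam0} => M i j) =
          fun i j => matrixCoeff c i.1.1 j.1.1 := by
        funext i j
        refine if_neg ?_
        rwa [htail i, ((hkey _ _).1 i.2).1]
      rw [hM]
      -- All paths of the block have the same tails, so one filter serves the whole block.
      obtain ⟨U, hU, hSU⟩ := hB.exists_isSeparating hfa (fun al => tgt_of_mem_tails) hex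
      let f : {lam // key lam = key lam0} → Path Λ := fun i => i.1.1
      have hf : Function.Injective f := fun i i' h => Subtype.ext (Subtype.ext h)
      have hfF : ∀ i, f i ∈ F := fun i => i.1.2
      have hsrc : ∀ i, (f i).src = lam0.1.src := fun i => ((hkey _ _).1 i.2).1
      have hdeg : ∀ i, G.deg (f i) = G.deg lam0.1 := fun i => ((hkey _ _).1 i.2).2
      have htl : ∀ i, ∀ al ∈ G.tails F (f i), al ∉ U := fun i al hal => hSU al (htail i ▸ hal)
      have := ht.norm_matrixCoeff_le h0 hF hc hU f hf hfF hsrc hdeg htl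
      exact this
    · push Not at hj
      have hM : (CStarMatrix.ofMatrix fun i i' => M i i' :
          CStarMatrix {lam // key lam = j} {lam // key lam = j} ℂ) = 0 := by
        ext i i'
        exact if_pos (hj i.1 i.2)
      rw [hM, norm_zero]
      exact norm_nonneg _

end IsCuntzKriegerFamily

end KGraph

end HigherRank

/-! ### Averaging over the torus -/

namespace HigherRank

open HigherRank.Path

open MeasureTheory UnitAddTorus

section Torus

/-- The normalised Haar measure on the torus. -/
noncomputable def torusMeasure (k : ℕ) : Measure (UnitAddTorus (Fin k)) :=
  Measure.pi fun _ => AddCircle.haarAddCircle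

instance (k : ℕ) : IsProbabilityMeasure (torusMeasure k) :=
  inferInstanceAs (IsProbabilityMeasure (Measure.pi _))

instance (k : ℕ) : (torusMeasure k).IsOpenPosMeasure :=
  inferInstanceAs (Measure.IsOpenPosMeasure (Measure.pi _))

theorem integral_mFourier {k : ℕ} (n : Fin k → ℤ) :
    ∫ x, mFourier n x ∂(torusMeasure k) = if n = 0 then 1 else 0 := by
  split_ifs with h
  · subst h
    simp [mFourier_zero]
  · obtain ⟨i, hi⟩ : ∃ i, n i ≠ 0 := Function.ne_iff.1 h
    change ∫ x, ∏ j, fourier (n j) (x j) ∂(Measure.pi fun _ => AddCircle.haarAddCircle) = 0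
    rw [integral_fintype_prod_eq_prod (f := fun j (x : UnitAddCircle) => fourier (n j) x)]
    refine Finset.prod_eq_zero (Finset.mem_univ i) ?_
    have h1 := congrFun (fourierCoeff_fourier (T := 1) (n i)) 0
    rw [Pi.single_eq_of_ne (M := fun _ : ℤ => ℂ) (Ne.symm hi)] at h1
    simpa [fourierCoeff] using h1

variable {X : Type*} [TopologicalSpace X] [CompactSpace X] [MeasurableSpace X] [BorelSpace X]
  {μ : Measure X} [IsProbabilityMeasure μ] {A : Type*} [NonUnitalCStarAlgebra A]

theorem integrable_of_continuousMap [SecondCountableTopology X] (f : C(X, A)) : Integrable f μ := by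
  refine Integrable.of_bound (C := ‖f‖) ?_ (ae_of_all _ f.norm_coe_le_norm)
  exact f.continuous.aestronglyMeasurable

omit [BorelSpace X] in
theorem norm_integral_continuousMap_le (f : C(X, A)) : ‖∫ x, f x ∂μ‖ ≤ ‖f‖ := by
  simpa using norm_integral_le_of_norm_le_const (μ := μ) (ae_of_all _ f.norm_coe_le_norm)

theorem continuous_integral [SecondCountableTopology X] :
    Continuous fun f : C(X, A) => ∫ x, f x ∂μ := by
  refine continuous_iff_continuousAt.2 fun f => ?_
  rw [ContinuousAt, tendsto_iff_norm_sub_tendsto_zero]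
  refine squeeze_zero (fun _ => norm_nonneg _) (fun g => ?_)
    (tendsto_iff_norm_sub_tendsto_zero.1 (Filter.tendsto_id (x := nhds f)))
  rw [← integral_sub (integrable_of_continuousMap g) (integrable_of_continuousMap f)]
  exact norm_integral_continuousMap_le (g - f)

open CStarAlgebra in
-- Over any measurable set the integral of f*f lies between 0 and the total integral 0. So f*f
-- vanishes almost everywhere, and everywhere by continuity, as nonempty open sets have positive
-- measure.
theorem eq_zero_of_integral_star_mul_self_eq_zero [SecondCountableTopology X]
    [μ.IsOpenPosMeasure] (f : C(X, A)) (h : ∫ x, (star f * f) x ∂μ = 0) : f = 0 := by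
  let : PartialOrder A := CStarAlgebra.spectralOrder A
  have : StarOrderedRing A := CStarAlgebra.spectralOrderedRing A
  have hpos : ∀ x, 0 ≤ (star f * f) x := fun x => star_mul_self_nonneg (f x)
  have hint : Integrable (star f * f : C(X, A)) μ := integrable_of_continuousMap _
  have h1 : (star f * f : C(X, A)) =ᵐ[μ] (0 : X → A) := by
    refine hint.ae_eq_zero_of_forall_setIntegral_eq_zero fun s _ _ => ?_
    refine le_antisymm ?_ (integral_nonneg hpos)
    rw [← h]
    exact setIntegral_le_integral hint (ae_of_all _ hpos)
  have h2 := (Continuous.ae_eq_iff_eq μ (star f * f : C(X, A)).continuous continuous_zero).1 h1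
  ext x
  exact CStarRing.star_mul_self_eq_zero_iff (f x) |>.1 (congrFun h2 x)

end Torus

/-! ### Homomorphisms of generated C*-algebras -/

section Generated

variable {ι : Type*} {A : Type w} [NonUnitalCStarAlgebra A] {B : Type w'} [NonUnitalCStarAlgebra B]

instance (t : ι → A) : IsClosed (generatedCStar t : Set A) :=
  NonUnitalStarSubalgebra.isClosed_topologicalClosure _

theorem continuous_starHom (φ : A →⋆ₙₐ[ℂ] B) : Continuous φ :=
  AddMonoidHomClass.continuous_of_bound φ 1 fun x => by
    simpa using NonUnitalStarAlgHom.norm_apply_le φ x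

theorem map_mem_generatedCStar (φ : A →⋆ₙₐ[ℂ] B) (t : ι → A) {s : ι → B}
    (h : ∀ i, φ (t i) = s i) {x : A} (hx : x ∈ generatedCStar t) : φ x ∈ generatedCStar s := by
  have h1 : generatedCStar t ≤ (generatedCStar s).comap φ := by
    refine NonUnitalStarSubalgebra.topologicalClosure_minimal _ ?_ ?_
    · refine NonUnitalStarAlgebra.adjoin_le ?_
      rintro _ ⟨i, rfl⟩
      change φ (t i) ∈ generatedCStar s
      rw [h]
      exact (generator s i).2
    · have hcl : IsClosed (generatedCStar s : Set B) := inferInstance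
      exact hcl.preimage (continuous_starHom φ)
  exact h1 hx

/-- Two homomorphisms from a generated C*-algebra which agree on the generators are equal. -/
theorem generatedCStar_hom_ext {t : ι → A} {φ ψ : generatedCStar t →⋆ₙₐ[ℂ] B}
    (h : ∀ i, φ (generator t i) = ψ (generator t i)) : φ = ψ := by
  have hcl : IsClosed ((NonUnitalStarAlgHom.equalizer φ ψ :
      NonUnitalStarSubalgebra ℂ (generatedCStar t)) : Set (generatedCStar t)) :=
    isClosed_eq (continuous_starHom φ) (continuous_starHom ψ)
  have h1 : generatedCStar t ≤ (NonUnitalStarAlgHom.equalizer φ ψ).map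
      (NonUnitalStarSubalgebraClass.subtype (generatedCStar t)) := by
    refine NonUnitalStarSubalgebra.topologicalClosure_minimal _ ?_ ?_
    · refine NonUnitalStarAlgebra.adjoin_le ?_
      rintro _ ⟨i, rfl⟩
      exact ⟨generator t i, h i, rfl⟩
    · have hcl' : IsClosed (generatedCStar t : Set A) := inferInstance
      exact hcl'.isClosedEmbedding_subtypeVal.isClosedMap _ hcl
  ext x
  obtain ⟨y, hy, hyx⟩ := h1 x.2
  obtain rfl : y = x := Subtype.ext hyx
  exact hy

/-- An injective homomorphism maps `C*(t)` onto the C*-algebra generated by the image of `t`. -/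
theorem exists_of_mem_generatedCStar {t : ι → A} (φ : generatedCStar t →⋆ₙₐ[ℂ] B)
    (hφ : Function.Injective φ) {s : ι → B} (h : ∀ i, φ (generator t i) = s i) {y : B}
    (hy : y ∈ generatedCStar s) : ∃ x, φ x = y := by
  have h1 : generatedCStar s ≤ NonUnitalStarAlgHom.range φ := by
    refine NonUnitalStarSubalgebra.topologicalClosure_minimal _ ?_ ?_
    · refine NonUnitalStarAlgebra.adjoin_le ?_
      rintro _ ⟨i, rfl⟩
      exact ⟨generator t i, h i⟩
    · have := (NonUnitalStarAlgHom.isometry φ hφ).isClosedEmbedding.isClosed_range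
      exact this
  exact h1 hy

end Generated

/-! ### Transfer of the Cuntz–Krieger relations and density of formal combinations -/

section Transfer

variable {k : ℕ} {Λ : Type u} [Category.{v} Λ] {G : KGraph k Λ} {hfa : G.FinitelyAligned}
  {A B : Type*} [NonUnitalCStarAlgebra A] [NonUnitalCStarAlgebra B]

theorem map_evalFormal (φ : A →⋆ₙₐ[ℂ] B) (t : Path Λ → A) (c : Path Λ × Path Λ →₀ ℂ) :
    φ (evalFormal t c) = evalFormal (fun lam => φ (t lam)) c := by
  simp [evalFormal_apply, map_sum, map_smul, map_mul, map_star]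

theorem map_foldr_gap (φ : A →⋆ₙₐ[ℂ] B) (t : Path Λ → A) (e : A) (l : List (Path Λ)) :
    φ (l.foldr (fun lam z => (e - t lam * star (t lam)) * z) e) =
      l.foldr (fun lam z => (φ e - φ (t lam) * star (φ (t lam))) * z) (φ e) := by
  induction l with
  | nil => rfl
  | cons lam l ih => simp [ih, map_mul, map_sub, map_star]

/-- A family is Cuntz–Krieger if its images under a jointly injective family of homomorphisms are.
-/
theorem isCuntzKriegerFamily_of_jointly_injective {ι C : Type*} [NonUnitalCStarAlgebra C]
    (φ : ι → A →⋆ₙₐ[ℂ] B) (ψ : A →⋆ₙₐ[ℂ] C)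
    (hinj : ∀ x y, (∀ i, φ i x = φ i y) → ψ x = ψ y → x = y) {t : Path Λ → A}
    (hφ : ∀ i, G.IsCuntzKriegerFamily hfa fun lam => φ i (t lam))
    (hψ : G.IsCuntzKriegerFamily hfa fun lam => ψ (t lam)) : G.IsCuntzKriegerFamily hfa t where
  partialIsometry lam := hinj _ _
    (fun i => by simpa only [map_mul, map_star] using (hφ i).partialIsometry lam)
    (by simpa only [map_mul, map_star] using hψ.partialIsometry lam)
  projection a :=
    { isIdempotentElem := hinj _ _
        (fun i => by simpa only [map_mul] using ((hφ i).projection a).isIdempotentElem.eq)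
        (by simpa only [map_mul] using (hψ.projection a).isIdempotentElem.eq)
      isSelfAdjoint := hinj _ _
        (fun i => by simpa only [map_star] using ((hφ i).projection a).isSelfAdjoint.star_eq)
        (by simpa only [map_star] using (hψ.projection a).isSelfAdjoint.star_eq) }
  orthogonal a b hab := hinj _ _
    (fun i => by simpa only [map_mul, map_zero] using (hφ i).orthogonal a b hab)
    (by simpa only [map_mul, map_zero] using hψ.orthogonal a b hab)
  mul_eq lam mu h := hinj _ _
    (fun i => by simpa only [map_mul] using (hφ i).mul_eq lam mu h)
    (by simpa only [map_mul] using hψ.mul_eq lam mu h)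
  star_mul_eq lam mu := hinj _ _
    (fun i => by simpa only [map_mul, map_star, map_sum] using (hφ i).star_mul_eq lam mu)
    (by simpa only [map_mul, map_star, map_sum] using hψ.star_mul_eq lam mu)
  gap a l hl hE := hinj _ _
    (fun i => by rw [map_foldr_gap, map_zero]; exact (hφ i).gap a l hl hE)
    (by rw [map_foldr_gap, map_zero]; exact hψ.gap a l hl hE)

/-- Multiplying a Cuntz–Krieger family by a character of the degree. -/
theorem KGraph.IsCuntzKriegerFamily.twist {t : Path Λ → A} (ht : G.IsCuntzKriegerFamily hfa t)
    {χ : (Fin k → ℕ) → ℂ} (h0 : χ 0 = 1) (hadd : ∀ m n, χ (m + n) = χ m * χ n)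
    (hu : ∀ n, χ n * star (χ n) = 1) :
    G.IsCuntzKriegerFamily hfa fun lam => χ (G.deg lam) • t lam := by
  have hv : ∀ a, χ (G.deg (vertex a)) • t (vertex a) = t (vertex a) := fun a => by
    rw [G.deg_vertex, h0, one_smul]
  have hp : ∀ lam, χ (G.deg lam) • t lam * star (χ (G.deg lam) • t lam) =
      t lam * star (t lam) := fun lam => by
    rw [star_smul, smul_mul_smul_comm, hu, one_smul]
  refine ⟨fun lam => ?_, fun a => ?_, fun a b hab => ?_, fun lam mu h => ?_, fun lam mu => ?_,
    fun a l hl hE => ?_⟩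
  · rw [hp, mul_smul_comm, ht.partialIsometry]
  · simpa only [hv] using ht.projection a
  · simpa only [hv] using ht.orthogonal a b hab
  · rw [smul_mul_smul_comm, ht.mul_eq lam mu h, G.deg_comp, hadd]
  · rw [star_smul, smul_mul_smul_comm, ht.star_mul_eq, Finset.smul_sum]
    refine Finset.sum_congr rfl fun p hp => ?_
    obtain ⟨h1, h2, h3, -⟩ := G.mem_minExt.1 ((hfa lam mu).mem_toFinset.1 hp)
    -- From λα = μβ the characters satisfy χ(λ)χ(α) = χ(μ)χ(β), so the scalars on the two sides of
    -- the relation agree.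
    have h4 := congrArg G.deg h3
    rw [G.deg_mul h1, G.deg_mul h2] at h4
    rw [star_smul, smul_mul_smul_comm]
    congr 1
    have h5 : χ (G.deg lam) * χ (G.deg p.1) = χ (G.deg mu) * χ (G.deg p.2) := by
      rw [← hadd, ← hadd, h4]
    calc star (χ (G.deg lam)) * χ (G.deg mu)
        = star (χ (G.deg lam)) * (χ (G.deg mu) * χ (G.deg p.2)) * star (χ (G.deg p.2)) := by
          rw [mul_assoc, mul_assoc, hu, mul_one]
      _ = χ (G.deg lam) * star (χ (G.deg lam)) * (χ (G.deg p.1) * star (χ (G.deg p.2))) := by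
          rw [← h5]; ring
      _ = _ := by rw [hu, one_mul]
  · simpa only [hv, hp] using ht.gap a l hl hE

/-- The span of the t_λ t_μ* is closed under products, because the inner factor t_μ* t_ν expands
over minimal common extensions; it contains t_λ = t_λ t_{s(λ)}*. -/
theorem KGraph.IsCuntzKriegerFamily.exists_evalFormal_eq {t : Path Λ → A}
    (ht : G.IsCuntzKriegerFamily hfa t) {x : A}
    (hx : x ∈ NonUnitalStarAlgebra.adjoin ℂ (Set.range t)) : ∃ c, evalFormal t c = x := by
  have hrange : LinearMap.range (evalFormal t) =
      Submodule.span ℂ (Set.range fun p : Path Λ × Path Λ => t p.1 * star (t p.2)) :=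
    Finsupp.range_linearCombination ℂ
  suffices h : x ∈ LinearMap.range (evalFormal t) from h
  rw [hrange]
  induction hx using NonUnitalStarAlgebra.adjoin_induction with
  | mem x hx =>
    obtain ⟨lam, rfl⟩ := hx
    refine Submodule.subset_span ⟨(lam, vertex lam.src), ?_⟩
    dsimp only
    rw [ht.star_vertex, ht.mul_vertex rfl]
  | add x y _ _ hx hy => exact add_mem hx hy
  | zero => exact zero_mem _
  | smul r x _ hx => exact Submodule.smul_mem _ r hx
  | star x hm hx =>
    clear hm
    induction hx using Submodule.span_induction with
    | mem x hx =>
      obtain ⟨p, rfl⟩ := hx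
      exact Submodule.subset_span ⟨p.swap, by simp⟩
    | zero => simp
    | add x y _ _ hx hy => rw [star_add]; exact add_mem hx hy
    | smul r x _ hx => rw [star_smul]; exact Submodule.smul_mem _ _ hx
  | mul x y hm hm' hx hy =>
    clear hm hm'
    induction hx using Submodule.span_induction with
    | zero => simp
    | add x x' _ _ hx hx' => rw [add_mul]; exact add_mem hx hx'
    | smul r x _ hx => rw [smul_mul_assoc]; exact Submodule.smul_mem _ _ hx
    | mem x hx =>
      obtain ⟨p, rfl⟩ := hx
      induction hy using Submodule.span_induction with
      | zero => simp
      | add x x' _ _ hx hx' => rw [mul_add]; exact add_mem hx hx'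
      | smul r x _ hx => rw [mul_smul_comm]; exact Submodule.smul_mem _ _ hx
      | mem y hy =>
        obtain ⟨q, rfl⟩ := hy
        dsimp only
        rw [mul_assoc, ← mul_assoc (star (t p.2)), ht.star_mul_eq, Finset.sum_mul,
          Finset.mul_sum]
        refine sum_mem fun m hm => ?_
        obtain ⟨-, h2, -, -⟩ := G.mem_minExt.1 ((hfa p.2 q.1).mem_toFinset.1 hm)
        have h3 : t p.1 * (t m.1 * star (t m.2) * star (t q.2)) =
            t p.1 * t m.1 * star (t q.2 * t m.2) := by
          rw [star_mul]; simp only [mul_assoc]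
        rw [h3]
        by_cases h4 : p.1.src = m.1.tgt
        · by_cases h5 : q.2.src = m.2.tgt
          · rw [ht.mul_eq_mul h4, ht.mul_eq_mul h5]
            exact Submodule.subset_span ⟨(p.1 * m.1, q.2 * m.2), rfl⟩
          · rw [ht.mul_eq_zero h5, star_zero, mul_zero]
            exact zero_mem _
        · rw [ht.mul_eq_zero h4, zero_mul]
          exact zero_mem _

end Transfer

end HigherRank

/-! ### The gauge-twisted pair and uniqueness -/

namespace HigherRank

open HigherRank.Path

open MeasureTheory UnitAddTorus

variable {k : ℕ} {Λ : Type u} [Category.{v} Λ] {G : KGraph k Λ} {hfa : G.FinitelyAligned}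
  {A : Type w} {B : Type w'} [NonUnitalCStarAlgebra A] [NonUnitalCStarAlgebra B]

/-- Evaluation at a point, as a homomorphism of C*-algebras. -/
def evalHom {X : Type*} [TopologicalSpace X] [CompactSpace X] (x : X) : C(X, A) →⋆ₙₐ[ℂ] A where
  toFun f := f x
  map_smul' _ _ := rfl
  map_zero' := rfl
  map_add' _ _ := rfl
  map_mul' _ _ := rfl
  map_star' _ := rfl

/-- The character of `ℤᵏ` given by a point of the torus, restricted to `ℕᵏ`. -/
noncomputable def torusChar (x : UnitAddTorus (Fin k)) (n : Fin k → ℕ) : ℂ :=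
  mFourier (fun i => (n i : ℤ)) x

theorem torusChar_zero (x : UnitAddTorus (Fin k)) : torusChar x 0 = 1 := by
  have : (fun i : Fin k => (((0 : Fin k → ℕ) i : ℕ) : ℤ)) = 0 := rfl
  rw [torusChar, this, mFourier_zero, ContinuousMap.one_apply]

theorem torusChar_add (x : UnitAddTorus (Fin k)) (m n : Fin k → ℕ) :
    torusChar x (m + n) = torusChar x m * torusChar x n := by
  rw [torusChar, torusChar, torusChar, ← mFourier_add]
  congr 2

theorem torusChar_mul_star (x : UnitAddTorus (Fin k)) (m n : Fin k → ℕ) :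
    torusChar x m * star (torusChar x n) = mFourier (fun i => (m i : ℤ) - n i) x := by
  have : (fun i => (m i : ℤ) - n i) = (fun i => (m i : ℤ)) + -(fun i => (n i : ℤ)) := by
    funext i; simp [sub_eq_add_neg]
  rw [this, mFourier_add, mFourier_neg]
  rfl

theorem torusChar_mul_star_self (x : UnitAddTorus (Fin k)) (n : Fin k → ℕ) :
    torusChar x n * star (torusChar x n) = 1 := by
  rw [torusChar_mul_star]
  have : (fun i => (n i : ℤ) - n i) = 0 := by funext i; simp
  rw [this, mFourier_zero, ContinuousMap.one_apply]

variable (G) in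
/-- The family `s` twisted by the gauge action, as a family of functions on the torus, paired with
the family `t`. -/
noncomputable def gaugePair (s : Path Λ → A) (t : Path Λ → B) (lam : Path Λ) :
    C(UnitAddTorus (Fin k), A) × B :=
  (⟨fun x => mFourier (fun i => (G.deg lam i : ℤ)) x • s lam, by fun_prop⟩, t lam)

/-- Evaluations at points of the torus and the projection to `B` are jointly injective; they yield
the twists of `s` and the family `t`. -/
theorem isCuntzKriegerFamily_gaugePair {s : Path Λ → A} {t : Path Λ → B}
    (hs : G.IsCuntzKriegerFamily hfa s) (ht : G.IsCuntzKriegerFamily hfa t) :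
    G.IsCuntzKriegerFamily hfa (gaugePair G s t) := by
  refine isCuntzKriegerFamily_of_jointly_injective
    (fun x : UnitAddTorus (Fin k) => (evalHom x).comp (NonUnitalStarAlgHom.fst ℂ _ B))
    (NonUnitalStarAlgHom.snd ℂ C(UnitAddTorus (Fin k), A) B) ?_ (fun x => ?_) ht
  · intro f g h1 h2
    exact Prod.ext (ContinuousMap.ext h1) h2
  · exact hs.twist (torusChar_zero x) (torusChar_add x) (torusChar_mul_star_self x)

/-- The term at (λ, μ) carries the character d(λ) - d(μ), whose integral is 1 if the degrees agree
and 0 otherwise. -/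
theorem integral_evalFormal_gaugePair (s : Path Λ → A) (t : Path Λ → B)
    (c : Path Λ × Path Λ →₀ ℂ) :
    ∫ x, (evalFormal (gaugePair G s t) c).1 x ∂(torusMeasure k) =
      evalFormal s (G.corePart c) := by
  have h1 : ∀ x, (evalFormal (gaugePair G s t) c).1 x = ∑ p ∈ c.support,
      mFourier (fun i => (G.deg p.1 i : ℤ) - G.deg p.2 i) x • (c p • (s p.1 * star (s p.2))) := by
    intro x
    have := map_evalFormal ((evalHom x).comp (NonUnitalStarAlgHom.fst ℂ _ B)) (gaugePair G s t) c
    refine this.trans ?_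
    rw [evalFormal_apply]
    refine Finset.sum_congr rfl fun p _ => ?_
    change c p • (torusChar x (G.deg p.1) • s p.1 * star (torusChar x (G.deg p.2) • s p.2)) = _
    rw [star_smul, smul_mul_smul_comm, torusChar_mul_star, smul_comm]
  simp_rw [h1]
  rw [integral_finsetSum, evalFormal_apply, KGraph.corePart, Finsupp.support_filter,
    Finset.sum_filter]
  · refine Finset.sum_congr rfl fun p _ => ?_
    rw [integral_smul_const, integral_mFourier]
    have h2 : (fun i => (G.deg p.1 i : ℤ) - G.deg p.2 i) = 0 ↔ G.deg p.1 = G.deg p.2 := by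
      simp [funext_iff, sub_eq_zero]
    by_cases h : G.deg p.1 = G.deg p.2
    · rw [if_pos (h2.2 h), if_pos h, one_smul,
        Finsupp.filter_apply_pos (fun p : Path Λ × Path Λ => G.deg p.1 = G.deg p.2) c h]
    · rw [if_neg fun h' => h (h2.1 h'), if_neg h, zero_smul]
  · intro p _
    refine Integrable.smul_const ?_ _
    exact integrable_of_continuousMap (mFourier fun i => (G.deg p.1 i : ℤ) - G.deg p.2 i)

theorem norm_integral_le_of_mem_generatedCStar (hB : G.ConditionB) {s : Path Λ → A}
    {t : Path Λ → B} (hs : G.IsCuntzKriegerFamily hfa s) (ht : G.IsCuntzKriegerFamily hfa t)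
    (h0 : ∀ a, t (vertex a) ≠ 0) {f : C(UnitAddTorus (Fin k), A) × B}
    (hf : f ∈ generatedCStar (gaugePair G s t)) :
    ‖∫ x, f.1 x ∂(torusMeasure k)‖ ≤ ‖f.2‖ := by
  have hcl : IsClosed {f : C(UnitAddTorus (Fin k), A) × B |
      ‖∫ x, f.1 x ∂(torusMeasure k)‖ ≤ ‖f.2‖} :=
    isClosed_le (continuous_integral.comp continuous_fst).norm continuous_snd.norm
  refine closure_minimal (fun f hf => ?_) hcl hf
  obtain ⟨c, rfl⟩ := (isCuntzKriegerFamily_gaugePair hs ht).exists_evalFormal_eq hf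
  have h2 : (evalFormal (gaugePair G s t) c).2 = evalFormal t c :=
    map_evalFormal (NonUnitalStarAlgHom.snd ℂ C(UnitAddTorus (Fin k), A) B) (gaugePair G s t) c
  change ‖∫ x, (evalFormal (gaugePair G s t) c).1 x ∂(torusMeasure k)‖ ≤
    ‖(evalFormal (gaugePair G s t) c).2‖
  rw [integral_evalFormal_gaugePair, h2]
  exact KGraph.IsCuntzKriegerFamily.norm_corePart_le hB hs ht h0 c

/-- If a family `g` lies over the families `s` and `t`, and its C*-algebra is faithfully
represented by that of `t`, then the C*-algebra of `t` maps onto that of `s`. -/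
theorem exists_generatedCStar_hom_of_span {C : Type*} [NonUnitalCStarAlgebra C]
    {g : Path Λ → C} {s : Path Λ → A} {t : Path Λ → B} (p : C →⋆ₙₐ[ℂ] A) (q : C →⋆ₙₐ[ℂ] B)
    (hp : ∀ lam, p (g lam) = s lam) (hq : ∀ lam, q (g lam) = t lam)
    (h0 : ∀ f ∈ generatedCStar g, q f = 0 → f = 0) :
    ∃ φ : generatedCStar t →⋆ₙₐ[ℂ] generatedCStar s,
      ∀ lam, φ (generator t lam) = generator s lam := by
  let ι : generatedCStar g →⋆ₙₐ[ℂ] C := NonUnitalStarSubalgebraClass.subtype (generatedCStar g)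
  let p' : generatedCStar g →⋆ₙₐ[ℂ] generatedCStar s :=
    NonUnitalStarAlgHom.codRestrict (p.comp ι) (generatedCStar s)
      fun f => map_mem_generatedCStar p g hp f.2
  let q' : generatedCStar g →⋆ₙₐ[ℂ] generatedCStar t :=
    NonUnitalStarAlgHom.codRestrict (q.comp ι) (generatedCStar t)
      fun f => map_mem_generatedCStar q g hq f.2
  have hι : Function.Injective (q.comp ι) := by
    rw [injective_iff_map_eq_zero]
    exact fun f hf => Subtype.ext (h0 f.1 f.2 hf)
  have hq' : Function.Bijective q' := by
    refine ⟨fun f g h => hι (congrArg Subtype.val h), fun y => ?_⟩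
    obtain ⟨f, hf⟩ := exists_of_mem_generatedCStar (t := g) (s := t) (q.comp ι) hι hq y.2
    exact ⟨f, Subtype.ext hf⟩
  let e := StarAlgEquiv.ofBijective q' hq'
  refine ⟨p'.comp (e.symm : generatedCStar t →⋆ₙₐ[ℂ] generatedCStar g), fun lam => ?_⟩
  have h1 : e (generator g lam) = generator t lam := Subtype.ext (hq lam)
  change p' (e.symm (generator t lam)) = _
  rw [← h1, e.symm_apply_apply]
  exact Subtype.ext (hp lam)

/-- The C*-algebra of a family with nonzero vertex projections maps onto that of any other. -/
theorem exists_generatedCStar_hom (hB : G.ConditionB) {s : Path Λ → A}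
    {t : Path Λ → B} (hs : G.IsCuntzKriegerFamily hfa s) (ht : G.IsCuntzKriegerFamily hfa t)
    (h0 : ∀ a, t (vertex a) ≠ 0) :
    ∃ φ : generatedCStar t →⋆ₙₐ[ℂ] generatedCStar s,
      ∀ lam, φ (generator t lam) = generator s lam := by
  refine exists_generatedCStar_hom_of_span (g := gaugePair G s t)
    ((evalHom 0).comp (NonUnitalStarAlgHom.fst ℂ C(UnitAddTorus (Fin k), A) B))
    (NonUnitalStarAlgHom.snd ℂ C(UnitAddTorus (Fin k), A) B) (fun lam => ?_) (fun _ => rfl) ?_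
  -- At the identity 0 of the torus every character is 1.
  · change torusChar 0 (G.deg lam) • s lam = s lam
    simp [torusChar, mFourier]
  · rintro ⟨f, b⟩ hf (rfl : b = 0)
    -- The bound is applied to f*f, whose second coordinate is 0.
    have h1 := norm_integral_le_of_mem_generatedCStar hB hs ht h0
      (mul_mem (star_mem hf) hf)
    have h2 : (star (f, (0 : B)) * (f, (0 : B))).2 = 0 := mul_zero _
    rw [h2, norm_zero, norm_le_zero_iff] at h1
    exact Prod.ext (eq_zero_of_integral_star_mul_self_eq_zero f h1) rfl

theorem existsUnique_generatedCStar_equiv (hB : G.ConditionB) {s : Path Λ → A}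
    {t : Path Λ → B} (hs : G.IsCuntzKriegerFamily hfa s) (hs0 : ∀ a, s (vertex a) ≠ 0)
    (ht : G.IsCuntzKriegerFamily hfa t) (ht0 : ∀ a, t (vertex a) ≠ 0) :
    ∃! φ : generatedCStar s ≃⋆ₐ[ℂ] generatedCStar t,
      ∀ lam, φ (generator s lam) = generator t lam := by
  obtain ⟨φ, hφ⟩ := exists_generatedCStar_hom hB ht hs hs0
  obtain ⟨ψ, hψ⟩ := exists_generatedCStar_hom hB hs ht ht0
  have h1 : ψ.comp φ = NonUnitalStarAlgHom.id ℂ _ := generatedCStar_hom_ext fun lam => by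
    simp [hφ, hψ]
  have h2 : φ.comp ψ = NonUnitalStarAlgHom.id ℂ _ := generatedCStar_hom_ext fun lam => by
    simp [hφ, hψ]
  have hbij : Function.Bijective φ :=
    Function.bijective_iff_has_inverse.2 ⟨ψ, DFunLike.congr_fun h1, DFunLike.congr_fun h2⟩
  refine ⟨StarAlgEquiv.ofBijective φ hbij, hφ, fun χ hχ => ?_⟩
  have h3 : (χ : generatedCStar s →⋆ₙₐ[ℂ] generatedCStar t) = φ :=
    generatedCStar_hom_ext fun lam => (hχ lam).trans (hφ lam).symm
  ext x
  exact congrArg Subtype.val (DFunLike.congr_fun h3 x)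

end HigherRank

/-! ### Operators on ℓ² from partial bijections -/

namespace HigherRank

open HigherRank.Path

section PartialShift

variable {X : Type w}

/-- The square-summable functions on `X`. -/
abbrev EllTwo (X : Type w) : Type w := lp (fun _ : X => ℂ) 2

/-- By injectivity of `f`, no value of `F` is counted twice. -/
theorem sum_elim_le (f : X ≃. X) {F : X → ℝ} (hF : Summable F) (h0 : ∀ x, 0 ≤ F x)
    (s : Finset X) : ∑ x ∈ s, (f x).elim 0 F ≤ ∑' x, F x := by
  classical
  have h1 : ∑ x ∈ s, (f x).elim 0 F =
      ∑ x ∈ s.filter (fun x => (f x).isSome), F ((f x).getD x) := by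
    rw [Finset.sum_filter]
    refine Finset.sum_congr rfl fun x _ => ?_
    cases f x <;> rfl
  rw [h1, ← Finset.sum_image (g := fun x => (f x).getD x) (f := F)]
  · exact hF.sum_le_tsum _ fun x _ => h0 x
  · intro x hx y hy hxy
    obtain ⟨z, hz⟩ := Option.isSome_iff_exists.1 (Finset.mem_filter.1 hx).2
    obtain ⟨z', hz'⟩ := Option.isSome_iff_exists.1 (Finset.mem_filter.1 hy).2
    simp only [hz, hz', Option.getD_some] at hxy
    subst hxy
    exact f.inj hz hz'

theorem norm_elim_rpow (f : X ≃. X) (ψ : X → ℂ) (x : X) :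
    ‖(f x).elim 0 ψ‖ ^ (2 : ENNReal).toReal =
      (f x).elim 0 fun y => ‖ψ y‖ ^ (2 : ENNReal).toReal := by
  cases f x <;> simp

theorem memℓp_elim (f : X ≃. X) (ψ : EllTwo X) :
    Memℓp (fun x => (f x).elim 0 (ψ : X → ℂ) : ∀ _ : X, ℂ) 2 := by
  have hψ := (lp.memℓp ψ).summable (by simp)
  refine memℓp_gen (summable_of_sum_le (c := ∑' x, ‖ψ x‖ ^ (2 : ENNReal).toReal)
    (fun _ => by positivity) fun s => ?_)
  simp_rw [norm_elim_rpow]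
  exact sum_elim_le f hψ (fun _ => by positivity) s

/-- The operator on `ℓ²(X)` of composition with a partial bijection of `X`. -/
noncomputable def compOperator (f : X ≃. X) : EllTwo X →L[ℂ] EllTwo X :=
  LinearMap.mkContinuous
    { toFun := fun ψ => ⟨fun x => (f x).elim 0 (ψ : X → ℂ), memℓp_elim f ψ⟩
      map_add' := fun ψ χ => by
        ext x
        change (f x).elim 0 (fun y => ψ y + χ y) =
          (f x).elim 0 (ψ : X → ℂ) + (f x).elim 0 (χ : X → ℂ)
        cases f x <;> simp
      map_smul' := fun c ψ => by
        ext x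
        change (f x).elim 0 (fun y => c * ψ y) = c * (f x).elim 0 (ψ : X → ℂ)
        cases f x <;> simp } 1 fun ψ => by
    rw [one_mul]
    refine lp.norm_le_of_forall_sum_le (by simp) (norm_nonneg _) fun s => ?_
    rw [lp.norm_rpow_eq_tsum (by simp)]
    change ∑ x ∈ s, ‖(f x).elim 0 (ψ : X → ℂ)‖ ^ (2 : ENNReal).toReal ≤ _
    simp_rw [norm_elim_rpow]
    exact sum_elim_le f ((lp.memℓp ψ).summable (by simp)) (fun _ => by positivity) s

theorem compOperator_apply (f : X ≃. X) (ψ : EllTwo X) (x : X) :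
    compOperator f ψ x = (f x).elim 0 (ψ : X → ℂ) := rfl

theorem compOperator_mul (f g : X ≃. X) :
    compOperator f * compOperator g = compOperator (f.trans g) := by
  ext ψ x
  change (f x).elim 0 (fun y => (g y).elim 0 (ψ : X → ℂ)) = ((f x).bind g).elim 0 (ψ : X → ℂ)
  cases f x <;> rfl

theorem star_compOperator (f : X ≃. X) : star (compOperator f) = compOperator f.symm := by
  symm
  refine (ContinuousLinearMap.eq_adjoint_iff _ _).2 fun ψ χ => ?_
  rw [lp.inner_eq_tsum, lp.inner_eq_tsum]
  have key : ∀ x, inner ℂ (compOperator f.symm ψ x) (χ x) ≠ 0 → (f.symm x).isSome := by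
    intro x hx
    rw [compOperator_apply] at hx
    cases h : f.symm x with
    | none => simp [h] at hx
    | some y => rfl
  symm
  -- Both inner products sum over the graph of `f`, once indexed by targets and once by sources.
  refine tsum_eq_tsum_of_ne_zero_bij (fun x => (f.symm x.1).get (key x.1 x.2)) ?_ ?_ ?_
  · intro x y hxy
    dsimp only at hxy
    have h1 := Option.get_mem (key x.1 x.2)
    rw [hxy] at h1
    exact Subtype.ext (f.symm.inj h1 (Option.get_mem (key y.1 y.2)))
  · intro y hy
    rw [Function.mem_support, compOperator_apply] at hy
    cases h : f y with
    | none => simp [h] at hy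
    | some x =>
      have hx : f.symm x = some y := f.eq_some_iff.2 h
      refine ⟨⟨x, ?_⟩, ?_⟩
      · rw [Function.mem_support, compOperator_apply, hx]
        simpa [h] using hy
      · simp [hx]
  · intro x
    obtain ⟨y, hy⟩ := Option.isSome_iff_exists.1 (key x.1 x.2)
    have hx : f y = some x.1 := f.eq_some_iff.1 hy
    simp only [compOperator_apply, hy, Option.get_some, hx, Option.elim_some]

end PartialShift

end HigherRank

/-! ### The representation on maximal filters and existence -/

namespace HigherRank

open HigherRank.Path

variable {k : ℕ} {Λ : Type u} [Category.{v} Λ] {G : KGraph k Λ}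

section PartialShift

variable {X : Type w}

theorem pequiv_ext {f g : X ≃. X} (h : ∀ x y, y ∈ f x ↔ y ∈ g x) : f = g :=
  PEquiv.ext fun x => Option.ext (h x)

theorem compOperator_ofSet (s : Set X) [DecidablePred (· ∈ s)] (ψ : EllTwo X) (x : X) :
    compOperator (PEquiv.ofSet s) ψ x = if x ∈ s then ψ x else 0 := by
  rw [compOperator_apply]
  split_ifs with h
  · rw [PEquiv.ofSet_eq_some_self_iff.2 h, Option.elim_some]
  · have : PEquiv.ofSet s x = none := by
      by_contra h'
      obtain ⟨y, hy⟩ := Option.ne_none_iff_exists'.1 h'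
      have := PEquiv.ofSet_eq_some_iff.1 hy
      exact h (this.1 ▸ this.2)
    rw [this, Option.elim_none]

/-- The pieces `g i` have disjoint domains, so at each point at most one summand contributes. -/
theorem compOperator_eq_sum {ι : Type*} (f : X ≃. X) (g : ι → X ≃. X) (s : Finset ι)
    (h : ∀ x y, y ∈ f x ↔ ∃ i ∈ s, y ∈ g i x)
    (huniq : ∀ i ∈ s, ∀ j ∈ s, ∀ x y z, y ∈ g i x → z ∈ g j x → i = j) :
    compOperator f = ∑ i ∈ s, compOperator (g i) := by
  ext ψ x
  have h1 : (∑ i ∈ s, compOperator (g i)) ψ x = ∑ i ∈ s, compOperator (g i) ψ x := by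
    rw [sum_apply, lp.coeFn_sum, Finset.sum_apply]
  rw [h1]
  simp only [compOperator_apply]
  cases hf : f x with
  | none =>
    refine (Finset.sum_eq_zero fun i hi => ?_).symm
    cases hg : g i x with
    | none => rfl
    | some y => simpa [hf] using (h x y).2 ⟨i, hi, hg⟩
  | some y =>
    obtain ⟨i, hi, hg⟩ := (h x y).1 hf
    rw [Finset.sum_eq_single_of_mem i hi]
    · rw [show g i x = some y from hg]
    · intro j hj hji
      cases hg' : g j x with
      | none => rfl
      | some z => exact absurd (huniq j hj i hi x z y hg' hg) hji

end PartialShift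

/-! Prefixing a path to a maximal filter. -/

theorem prependSet_shiftSet {a : Λ} {U : Set (Path Λ)} (hU : IsUltra a U) {lam : Path Λ}
    (h : lam ∈ U) : prependSet lam (shiftSet lam U) = U := by
  ext nu
  constructor
  · rintro ⟨mu, ⟨-, h1⟩, h2⟩
    exact hU.lower _ _ h2 h1
  · intro h1
    obtain ⟨ka, h2, ⟨mu, h3, rfl⟩, h4⟩ := hU.directed _ h _ h1
    exact ⟨mu, ⟨h3, h2⟩, h4⟩

theorem shiftSet_prependSet (G : KGraph k Λ) {lam : Path Λ} {U : Set (Path Λ)}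
    (hU : IsUltra lam.src U) : shiftSet lam (prependSet lam U) = U := by
  ext nu
  constructor
  · rintro ⟨h1, mu, h2, h3⟩
    exact hU.lower _ _ (G.le_of_mul_le_mul h1 (hU.tgt _ h2).symm h3) h2
  · exact fun h => ⟨(hU.tgt _ h).symm, nu, h, le_rfl⟩

theorem prependSet_mul {lam mu : Path Λ} (h : lam.src = mu.tgt) {U : Set (Path Λ)}
    (hU : IsUltra mu.src U) : prependSet (lam * mu) U = prependSet lam (prependSet mu U) := by
  ext nu
  constructor
  · rintro ⟨ka, h1, h2⟩
    exact ⟨mu * ka, ⟨ka, h1, le_rfl⟩, by rwa [← mul_assoc_of_src h (hU.tgt _ h1).symm]⟩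
  · rintro ⟨rho, ⟨ka, h1, h2⟩, h3⟩
    refine ⟨ka, h1, h3.trans ?_⟩
    rw [mul_assoc_of_src h (hU.tgt _ h1).symm]
    exact mul_le_mul_left_of_src (by rw [tgt_eq_of_le h2, tgt_mul, h]) h2

theorem prependSet_vertex {a : Λ} {U : Set (Path Λ)} (hU : IsUltra a U) :
    prependSet (vertex a) U = U := by
  ext nu
  constructor
  · rintro ⟨mu, h1, h2⟩
    rw [vertex_mul (hU.tgt _ h1)] at h2
    exact hU.lower _ _ h2 h1
  · exact fun h => ⟨nu, h, by rw [vertex_mul (hU.tgt _ h)]⟩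

variable (Λ) in
/-- The maximal filters of paths. -/
abbrev UltraPath : Type (max u v) := {U : Set (Path Λ) // ∃ a : Λ, IsUltra a U}

namespace UltraPath

theorem isUltra {x : UltraPath Λ} {a : Λ} (h : vertex a ∈ x.1) : IsUltra a x.1 := by
  obtain ⟨b, hb⟩ := x.2
  obtain rfl : a = b := hb.tgt _ h
  exact hb

theorem isUltra_tgt {x : UltraPath Λ} {lam : Path Λ} (h : lam ∈ x.1) : IsUltra lam.tgt x.1 := by
  obtain ⟨b, hb⟩ := x.2
  obtain rfl := hb.tgt _ h
  exact hb

open Classical in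
/-- The partial bijection `lam x ↦ x` of the maximal filters. -/
noncomputable def shift (hfa : G.FinitelyAligned) (lam : Path Λ) :
    UltraPath Λ ≃. UltraPath Λ where
  toFun x := if h : lam ∈ x.1 then
    some ⟨shiftSet lam x.1, lam.src, (isUltra_tgt h).shift G h⟩ else none
  invFun x := if h : vertex lam.src ∈ x.1 then
    some ⟨prependSet lam x.1, lam.tgt, (isUltra h).prepend hfa rfl⟩ else none
  inv x y := by
    simp only [Option.dite_none_right_eq_some, Option.some_inj]
    constructor
    · rintro ⟨h, rfl⟩
      have h' : lam ∈ prependSet lam y.1 := ⟨_, h, by rw [mul_vertex rfl]⟩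
      exact ⟨h', Subtype.ext (shiftSet_prependSet G (isUltra h))⟩
    · rintro ⟨h, rfl⟩
      exact ⟨((isUltra_tgt h).shift G h).vertex_mem,
        Subtype.ext (prependSet_shiftSet (isUltra_tgt h) h)⟩

variable {hfa : G.FinitelyAligned} {lam mu : Path Λ} {x y : UltraPath Λ}

theorem mem_shift : y ∈ shift hfa lam x ↔ vertex lam.src ∈ y.1 ∧ x.1 = prependSet lam y.1 := by
  rw [← PEquiv.mem_iff_mem]
  classical
  change x ∈ dite _ _ _ ↔ _
  rw [Option.mem_dite_none_right]
  simp only [Option.mem_some_iff]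
  exact ⟨fun ⟨h, h'⟩ => ⟨h, (congrArg Subtype.val h').symm⟩,
    fun ⟨h, h'⟩ => ⟨h, Subtype.ext h'.symm⟩⟩

theorem isSome_shift : (shift hfa lam x).isSome ↔ lam ∈ x.1 := by
  classical
  change (dite _ _ _ : Option _).isSome ↔ _
  by_cases h : lam ∈ x.1
  · simp only [h, dif_pos, Option.isSome_some]
  · simp [h]

theorem exists_prependSet_eq (hfa : G.FinitelyAligned) (h : lam ∈ x.1) :
    ∃ y : UltraPath Λ, vertex lam.src ∈ y.1 ∧ x.1 = prependSet lam y.1 := by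
  obtain ⟨y, hy⟩ := Option.isSome_iff_exists.1 (isSome_shift (hfa := hfa).2 h)
  exact ⟨y, mem_shift.1 hy⟩

theorem eq_of_prependSet_eq (G : KGraph k Λ) (hx : vertex lam.src ∈ x.1)
    (hy : vertex lam.src ∈ y.1) (h : prependSet lam x.1 = prependSet lam y.1) : x.1 = y.1 := by
  rw [← shiftSet_prependSet G (isUltra hx), h, shiftSet_prependSet G (isUltra hy)]

theorem vertex_mem_prependSet (h : vertex lam.src ∈ y.1) :
    vertex lam.tgt ∈ prependSet lam y.1 :=
  ⟨_, h, vertex_le (tgt_mul _ _)⟩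

theorem mem_prependSet (h : vertex lam.src ∈ y.1) : lam ∈ prependSet lam y.1 :=
  ⟨_, h, by rw [mul_vertex rfl]⟩

theorem exists_vertex_mem_prependSet (hfa : G.FinitelyAligned) (h : vertex lam.src ∈ y.1) :
    ∃ z : UltraPath Λ, z.1 = prependSet lam y.1 :=
  ⟨⟨_, _, (isUltra h).prepend hfa rfl⟩, rfl⟩

theorem shift_trans (h : lam.src = mu.tgt) :
    (shift hfa lam).trans (shift hfa mu) = shift hfa (lam * mu) := by
  refine pequiv_ext fun x y => ?_
  rw [PEquiv.mem_trans, mem_shift, src_mul h]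
  constructor
  · rintro ⟨z, hz, hy⟩
    obtain ⟨-, h2⟩ := mem_shift.1 hz
    obtain ⟨h3, h4⟩ := mem_shift.1 hy
    exact ⟨h3, by rw [h2, h4, prependSet_mul h (isUltra h3)]⟩
  · rintro ⟨h1, h2⟩
    obtain ⟨z, hz⟩ := exists_vertex_mem_prependSet hfa h1
    refine ⟨z, mem_shift.2 ⟨by rw [h, hz]; exact vertex_mem_prependSet h1, ?_⟩,
      mem_shift.2 ⟨h1, hz⟩⟩
    rw [h2, hz, prependSet_mul h (isUltra h1)]

open Classical in
theorem shift_trans_symm :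
    (shift hfa lam).trans (shift hfa lam).symm = PEquiv.ofSet {x | lam ∈ x.1} := by
  rw [PEquiv.self_trans_symm]
  congr 1
  ext x
  exact isSome_shift

open Classical in
theorem shift_vertex (a : Λ) :
    shift hfa (vertex a) = PEquiv.ofSet {x : UltraPath Λ | vertex a ∈ x.1} := by
  refine pequiv_ext fun x y => ?_
  rw [mem_shift, PEquiv.mem_ofSet_iff]
  constructor
  · rintro ⟨h1, h2⟩
    rw [prependSet_vertex (a := a) (isUltra h1)] at h2
    obtain rfl := Subtype.ext h2
    exact ⟨rfl, h1⟩
  · rintro ⟨rfl, h⟩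
    exact ⟨h, (prependSet_vertex (isUltra h)).symm⟩

theorem mem_shift_symm_trans : y ∈ (shift hfa lam).symm.trans (shift hfa mu) x ↔
    vertex lam.src ∈ x.1 ∧ vertex mu.src ∈ y.1 ∧ prependSet lam x.1 = prependSet mu y.1 := by
  rw [PEquiv.mem_trans]
  constructor
  · rintro ⟨z, hz, hy⟩
    obtain ⟨h1, h2⟩ := mem_shift.1 ((PEquiv.mem_iff_mem _).1 hz)
    obtain ⟨h3, h4⟩ := mem_shift.1 hy
    exact ⟨h1, h3, h2.symm.trans h4⟩
  · rintro ⟨h1, h2, h3⟩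
    obtain ⟨z, hz⟩ := exists_vertex_mem_prependSet hfa h1
    exact ⟨z, (PEquiv.mem_iff_mem _).2 (mem_shift.2 ⟨h1, hz⟩), mem_shift.2 ⟨h2, hz.trans h3⟩⟩

theorem mem_shift_trans_symm : y ∈ (shift hfa lam).trans (shift hfa mu).symm x ↔
    ∃ z : UltraPath Λ, (vertex lam.src ∈ z.1 ∧ x.1 = prependSet lam z.1) ∧
      vertex mu.src ∈ z.1 ∧ y.1 = prependSet mu z.1 := by
  rw [PEquiv.mem_trans]
  refine exists_congr fun z => and_congr mem_shift ?_
  rw [PEquiv.mem_iff_mem, mem_shift]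

/-- If λx = μy, directedness gives a common extension of λ and μ in this filter, and it passes
through a minimal one λα = μβ. Stripping λα leaves z with x = αz and y = βz. -/
theorem mem_symm_trans_iff_exists_minExt :
    y ∈ (shift hfa lam).symm.trans (shift hfa mu) x ↔
      ∃ p ∈ (hfa lam mu).toFinset, y ∈ (shift hfa p.1).trans (shift hfa p.2).symm x := by
  simp only [mem_shift_symm_trans, mem_shift_trans_symm, Set.Finite.mem_toFinset]
  constructor
  · rintro ⟨hx, hy, h⟩
    have hU := (isUltra hx).prepend hfa (lam := lam) rfl
    obtain ⟨w, hw⟩ := exists_vertex_mem_prependSet hfa hx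
    obtain ⟨ka, h1, h2, h3⟩ := hU.directed _ (mem_prependSet hx) mu (h ▸ mem_prependSet hy)
    obtain ⟨al, be, h4, h5⟩ := G.exists_minExt_le h2 h3
    obtain ⟨h6, h7, h8, -⟩ := G.mem_minExt.1 h4
    dsimp only at h6 h7 h8
    have hs : al.src = be.src := by rw [← src_mul h6, h8, src_mul h7]
    obtain ⟨z, hz, hwz⟩ := exists_prependSet_eq (x := w) hfa (hw ▸ hU.lower _ _ h5 h1)
    rw [src_mul h6] at hz
    have hz' := hs ▸ hz
    obtain ⟨x', hx'⟩ := exists_vertex_mem_prependSet hfa hz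
    obtain ⟨y', hy'⟩ := exists_vertex_mem_prependSet hfa hz'
    refine ⟨(al, be), h4, z, ⟨hz, ?_⟩, hz', ?_⟩
    · rw [← hx']
      refine eq_of_prependSet_eq G hx (by rw [h6, hx']; exact vertex_mem_prependSet hz) ?_
      rw [← hw, hwz, prependSet_mul h6 (isUltra hz), hx']
    · rw [← hy']
      refine eq_of_prependSet_eq G hy (by rw [h7, hy']; exact vertex_mem_prependSet hz') ?_
      rw [← h, ← hw, hwz, h8, prependSet_mul h7 (isUltra hz'), hy']
  · rintro ⟨⟨al, be⟩, hp, z, ⟨h1, h2⟩, h3, h4⟩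
    obtain ⟨h6, h7, h8, -⟩ := G.mem_minExt.1 hp
    dsimp only at *
    refine ⟨by rw [h2, h6]; exact vertex_mem_prependSet h1,
      by rw [h4, h7]; exact vertex_mem_prependSet h3, ?_⟩
    rw [h2, h4, ← prependSet_mul h6 (isUltra h1), ← prependSet_mul h7 (isUltra h3), h8]

/-- The two minimal extensions have equal degree and a common extension, hence coincide. This makes
the pieces in the expansion of t_λ* t_μ disjoint. -/
theorem minExt_eq_of_mem {p q : Path Λ × Path Λ} (hp : p ∈ G.minExt lam mu)
    (hq : q ∈ G.minExt lam mu) (h : p.1 ∈ x.1) (h' : q.1 ∈ x.1) : p = q := by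
  obtain ⟨h1, h2, h3, h4⟩ := G.mem_minExt.1 hp
  obtain ⟨h1', h2', h3', h4'⟩ := G.mem_minExt.1 hq
  obtain ⟨nu, -, h5, h6⟩ := (isUltra_tgt h).directed _ h _ h'
  have h7 : lam * p.1 = lam * q.1 := G.eq_of_le_of_le_of_deg_eq
    (mul_le_mul_left_of_src h1 h5) (mul_le_mul_left_of_src h1' h6) (h4.trans h4'.symm)
  exact Prod.ext (G.mul_left_inj h1 h1' h7)
    (G.mul_left_inj h2 h2' (by rw [← h3, ← h3', h7]))

end UltraPath

/-- The Cuntz–Krieger family on the square-summable functions of maximal filters. -/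
noncomputable def ultraFamily (hfa : G.FinitelyAligned) (lam : Path Λ) :
    EllTwo (UltraPath Λ) →L[ℂ] EllTwo (UltraPath Λ) :=
  compOperator (UltraPath.shift hfa lam)

open Classical in
theorem ultraFamily_proj_apply (hfa : G.FinitelyAligned) (lam : Path Λ)
    (ψ : EllTwo (UltraPath Λ)) (x : UltraPath Λ) :
    (ultraFamily hfa lam * star (ultraFamily hfa lam)) ψ x = if lam ∈ x.1 then ψ x else 0 := by
  rw [ultraFamily, star_compOperator, compOperator_mul, UltraPath.shift_trans_symm,
    compOperator_ofSet]
  rfl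

open Classical in
theorem ultraFamily_vertex_apply (hfa : G.FinitelyAligned) (a : Λ)
    (ψ : EllTwo (UltraPath Λ)) (x : UltraPath Λ) :
    ultraFamily hfa (vertex a) ψ x = if vertex a ∈ x.1 then ψ x else 0 := by
  rw [ultraFamily, UltraPath.shift_vertex, compOperator_ofSet]
  rfl

/-- All factors are diagonal. At a filter x at `a`, the factor of any `lam` in x vanishes; at all
other filters t_a is already 0. -/
theorem ultraFamily_gap_apply (hfa : G.FinitelyAligned) {a : Λ} (l : List (Path Λ))
    (ψ : EllTwo (UltraPath Λ)) (x : UltraPath Λ)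
    (h : vertex a ∈ x.1 → ∃ lam ∈ l, lam ∈ x.1) (hl : ∀ lam ∈ l, lam.tgt = a) :
    l.foldr (fun lam z => (ultraFamily hfa (vertex a) -
      ultraFamily hfa lam * star (ultraFamily hfa lam)) * z) (ultraFamily hfa (vertex a)) ψ x
      = 0 := by
  classical
  induction l with
  | nil =>
    rw [List.foldr_nil, ultraFamily_vertex_apply, if_neg]
    exact fun h' => by simpa using h h'
  | cons lam l ih =>
    rw [List.foldr_cons]
    set z := l.foldr _ _
    change ultraFamily hfa (vertex a) (z ψ) x -
      (ultraFamily hfa lam * star (ultraFamily hfa lam)) (z ψ) x = 0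
    rw [ultraFamily_vertex_apply, ultraFamily_proj_apply]
    by_cases hlam : lam ∈ x.1
    · have : vertex a ∈ x.1 := hl lam (by simp) ▸ (UltraPath.isUltra_tgt hlam).vertex_mem
      rw [if_pos hlam, if_pos this, sub_self]
    · rw [if_neg hlam, sub_zero]
      split_ifs with ha
      · refine ih (fun h' => ?_) fun mu hmu => hl mu (List.mem_cons_of_mem _ hmu)
        obtain ⟨mu, h1, h2⟩ := h h'
        rcases List.mem_cons.1 h1 with rfl | h1
        · exact absurd h2 hlam
        · exact ⟨mu, h1, h2⟩
      · rfl

theorem isCuntzKriegerFamily_ultraFamily (hfa : G.FinitelyAligned) :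
    G.IsCuntzKriegerFamily hfa (ultraFamily hfa) where
  partialIsometry lam := by
    rw [ultraFamily, star_compOperator, compOperator_mul, compOperator_mul]
    congr 1
    refine pequiv_ext fun x y => ?_
    simp only [PEquiv.mem_trans, PEquiv.mem_iff_mem]
    constructor
    · rintro ⟨z, ⟨w, h1, h2⟩, h3⟩
      obtain rfl := PEquiv.inj _ h1 h2
      exact h3
    · exact fun h => ⟨x, ⟨y, h, h⟩, h⟩
  projection a := by
    classical
    constructor
    · rw [IsIdempotentElem]
      ext ψ x
      change ultraFamily hfa (vertex a) (ultraFamily hfa (vertex a) ψ) x = _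
      simp only [ultraFamily_vertex_apply]
      split_ifs <;> rfl
    · rw [IsSelfAdjoint, ultraFamily, star_compOperator, UltraPath.shift_vertex,
        PEquiv.ofSet_symm]
  orthogonal a b hab := by
    classical
    ext ψ x
    change ultraFamily hfa (vertex a) (ultraFamily hfa (vertex b) ψ) x = 0
    simp only [ultraFamily_vertex_apply]
    split_ifs with h1 h2
    · exact absurd ((UltraPath.isUltra h2).tgt _ h1) hab
    · rfl
    · rfl
  mul_eq lam mu h := by
    rw [ultraFamily, ultraFamily, compOperator_mul, UltraPath.shift_trans h, comp_eq_mul]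
    rfl
  star_mul_eq lam mu := by
    simp only [ultraFamily, star_compOperator, compOperator_mul]
    refine compOperator_eq_sum _ _ _ (fun x y => UltraPath.mem_symm_trans_iff_exists_minExt) ?_
    intro p hp q hq x y z h1 h2
    obtain ⟨y', ⟨h3, h4⟩, -⟩ := UltraPath.mem_shift_trans_symm.1 h1
    obtain ⟨z', ⟨h5, h6⟩, -⟩ := UltraPath.mem_shift_trans_symm.1 h2
    exact UltraPath.minExt_eq_of_mem (x := x) ((hfa lam mu).mem_toFinset.1 hp)
      ((hfa lam mu).mem_toFinset.1 hq) (h4 ▸ UltraPath.mem_prependSet h3)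
      (h6 ▸ UltraPath.mem_prependSet h5)
  gap a l _ hE := by
    ext ψ x
    refine ultraFamily_gap_apply hfa l ψ x (fun h => ?_) hE.1
    exact (UltraPath.isUltra h).exists_mem_of_exhaustive G (List.finite_toSet l) hE

theorem ultraFamily_vertex_ne_zero (hfa : G.FinitelyAligned) (hB : G.ConditionB) (a : Λ) :
    ultraFamily hfa (vertex a) ≠ 0 := by
  classical
  obtain ⟨U, hU, -⟩ := hB.exists_isUltra hfa a
  intro h
  let x : UltraPath Λ := ⟨U, a, hU⟩
  -- The point mass at a maximal filter with range `a` is fixed by t_a.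
  have h1 := ultraFamily_vertex_apply hfa a (lp.single 2 x (1 : ℂ)) x
  rw [h, if_pos hU.vertex_mem, lp.single_apply_self] at h1
  exact zero_ne_one h1

end HigherRank

theorem corollary4p6 {k : ℕ} {Λ : Type u} [Category.{v} Λ] (G : HigherRank.KGraph k Λ)
    (hfa : G.FinitelyAligned) (hB : G.ConditionB) :
    (∃ (A : Type (max u v)) (_ : NonUnitalCStarAlgebra A) (t : HigherRank.Path Λ → A),
      G.IsCuntzKriegerFamily hfa t ∧ ∀ a : Λ, t (HigherRank.Path.vertex a) ≠ 0) ∧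
    ∀ (A : Type w) [NonUnitalCStarAlgebra A] (B : Type w') [NonUnitalCStarAlgebra B]
      (s : HigherRank.Path Λ → A) (t : HigherRank.Path Λ → B),
      G.IsCuntzKriegerFamily hfa s → (∀ a : Λ, s (HigherRank.Path.vertex a) ≠ 0) →
      G.IsCuntzKriegerFamily hfa t → (∀ a : Λ, t (HigherRank.Path.vertex a) ≠ 0) →
      ∃! φ : HigherRank.generatedCStar s ≃⋆ₐ[ℂ] HigherRank.generatedCStar t,
        ∀ lam : HigherRank.Path Λ,
          φ (HigherRank.generator s lam) = HigherRank.generator t lam :=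
  ⟨⟨_, inferInstance, HigherRank.ultraFamily hfa, HigherRank.isCuntzKriegerFamily_ultraFamily hfa,
    HigherRank.ultraFamily_vertex_ne_zero hfa hB⟩,
  fun _ _ _ _ _ _ hs hs0 ht ht0 =>
    HigherRank.existsUnique_generatedCStar_equiv hB hs hs0 ht ht0⟩
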